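/- Let $G$ be a finite group, let $g\ge 1$ and $r\ge 0$ be integers, and let $\Sigma$ be the closed connected non-orientable surface of Euler characteristic $\chi(\Sigma)=2-g$, that is, a space homeomorphic to the connected sum of $g$ copies of ${\mathbb P}^2({\mathbb R})$ (the quotient of the closed disc whose boundary is divided into $2g$ edges identified according to the word $a_1a_1a_2a_2\cdots a_ga_g$). Let $\Sigma'=\Sigma\setminus\bigcup_{j=1}^r D_j$, where $D_1,\dots,D_r$ are open discs whose closures are pairwise disjoint closed discs; thus $\Sigma'$ is the compact connected non-orientable surface with $r$ boundary circles $C_1,\dots,C_r$, with $C_j=\partial D_j$. Fix a point $x\in\Sigma'$ and, for each $j$, a loop $\ell_j$ based at $x$ that is freely homotopic in $\Sigma'$ to $C_j$ run through once (in one of its two directions). For $\gamma_1,\dots,\gamma_r\in G$ let $O(\gamma_j)$ denote the conjugacy class of $\gamma_j$ and put $$X_G(x,\Sigma,\gamma_1,\dots,\gamma_r)=\{\rho\in \mathrm{Hom}(\pi_1(\Sigma',x),G)\;:\;\rho([\ell_j])\in O(\gamma_j),\ j=1,\dots,r\}.$$ Let $\widehat G$ be the set of isomorphism classes of irreducible finite-dimensional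 complex representations of $G$; for $\pi\in\widehat G$ let $\chi_\pi$ be its character and $\nu_2(\pi)=\frac1{|G|}\sum_{h\in G}\chi_\pi(h^2)$ its Frobenius–Schur indicator. Then $X_G(x,\Sigma,\gamma_1,\dots,\gamma_r)$ is finite and $$\frac{|X_G(x,\Sigma,\gamma_1,\dots,\gamma_r)|}{|G|}=|G|^{-\chi(\Sigma)}\prod_{j=1}^r|O(\gamma_j)|\sum_{\pi\in\widehat G,\ \nu_2(\pi)\neq 0}(\nu_2(\pi)\dim\pi)^{\chi(\Sigma)}\,\frac{\prod_{j=1}^r\chi_\pi(\gamma_j)}{(\dim\pi)^r}.$$ -/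

import Mathlib

noncomputable section

namespace SurfaceCount

/-! ## Irreducible representations of a finite group -/

section Representations

open CategoryTheory

universe u

variable (G : Type u) [Group G]

/-- Isomorphism of irreducible finite-dimensional complex representations. -/
def irrSetoid : Setoid {V : FDRep.{0, u} ℂ G // Simple V} where
  r V W := Nonempty (V.1 ≅ W.1)
  iseqv :=
    { refl := fun V => ⟨Iso.refl V.1⟩
      symm := fun ⟨e⟩ => ⟨e.symm⟩
      trans := fun ⟨e⟩ ⟨f⟩ => ⟨e ≪≫ f⟩ }

/-- The set of isomorphism classes of irreducible finite-dimensional complex representations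
of `G`. -/
def Irr : Type (max 1 u) := Quotient (irrSetoid G)

variable {G}

/-- The character of an isomorphism class of irreducible representations. -/
def Irr.character (π : Irr G) : G → ℂ :=
  Quotient.lift (s := irrSetoid G) (fun V => V.1.character)
    (fun _ _ ⟨e⟩ => FDRep.char_iso e) π

/-- The (complex) dimension of an isomorphism class of irreducible representations. -/
def Irr.dim (π : Irr G) : ℕ :=
  Quotient.lift (s := irrSetoid G) (fun V => Module.finrank ℂ V.1)
    (fun _ _ ⟨e⟩ => (FDRep.isoToLinearEquiv e).finrank_eq) π

/-- The Frobenius-Schur indicator: the mean value of `χ_π(h²)` over the group. -/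
def Irr.frobeniusSchur [Fintype G] (π : Irr G) : ℂ :=
  (Fintype.card G : ℂ)⁻¹ * ∑ h : G, π.character (h ^ 2)

open scoped Classical in
theorem Irr.orthonormal [Fintype G] (π σ : Irr G) :
    (Nat.card G : ℂ)⁻¹ * ∑ h : G, π.character h * σ.character h⁻¹ = if π = σ then 1 else 0 := by
  obtain ⟨V, rfl⟩ := Quotient.exists_rep (s := irrSetoid G) π
  obtain ⟨W, rfl⟩ := Quotient.exists_rep (s := irrSetoid G) σ
  have := V.2
  have := W.2
  let _ : Invertible (Nat.card G : ℂ) :=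
    invertibleOfNonzero (by exact_mod_cast Nat.card_pos.ne')
  have h : Nonempty (V.1 ≅ W.1) ↔
      Quotient.mk (irrSetoid G) V = Quotient.mk (irrSetoid G) W :=
    (Quotient.eq (r := irrSetoid G)).symm
  exact (FDRep.char_orthonormal V.1 W.1).trans (if_congr h rfl rfl)

/-- A finite group has finitely many irreducible representations up to isomorphism. -/
instance Irr.instFinite [Finite G] : Finite (Irr G) := by
  classical
  have := Fintype.ofFinite G
  have hli : LinearIndependent ℂ (fun π : Irr G => π.character) := by
    rw [linearIndependent_iff']
    intro s a h0 σ hσ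
    have h1 : ∑ π ∈ s, a π * ((Nat.card G : ℂ)⁻¹ *
        ∑ h : G, π.character h * σ.character h⁻¹) = 0 := by
      have h2 : ∀ h : G, ∑ π ∈ s, a π * π.character h = 0 := fun h => by
        simpa [Finset.sum_apply] using congrFun h0 h
      calc _ = (Nat.card G : ℂ)⁻¹ *
            ∑ h : G, (∑ π ∈ s, a π * π.character h) * σ.character h⁻¹ := by
            simp only [Finset.mul_sum, Finset.sum_mul]
            rw [Finset.sum_comm]
            refine Finset.sum_congr rfl fun _ _ => Finset.sum_congr rfl fun _ _ => ?_
            ring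
        _ = 0 := by simp [h2]
    simp only [Irr.orthonormal] at h1
    simpa [hσ] using h1
  exact hli.finite

instance Irr.instFintype [Finite G] : Fintype (Irr G) := Fintype.ofFinite _

end Representations

/-! ## Non-orientable surfaces with boundary circles -/

/-- The closed unit disc in the complex plane. -/
abbrev Disc : Type := Metric.closedBall (0 : ℂ) 1

/-- The point `exp (2 π i t)` of the boundary circle of the disc. -/
def bdryPoint (t : ℝ) : Disc :=
  ⟨Complex.exp (((2 * Real.pi * t : ℝ) : ℂ) * Complex.I), by
    rw [mem_closedBall_zero_iff, Complex.norm_exp_ofReal_mul_I]⟩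

/-- The boundary circle is divided into `2 g` consecutive arcs of equal length, all of them
oriented counterclockwise; the arcs number `2 k` and `2 k + 1` are identified respecting the
orientation, so that the word of the polygon is `a₁ a₁ a₂ a₂ ⋯ a_g a_g`. -/
def Glue (g : ℕ) (z w : Disc) : Prop :=
  ∃ k : Fin g, ∃ s ∈ Set.Icc (0 : ℝ) 1,
    z = bdryPoint ((2 * (k : ℕ) + s) / (2 * g)) ∧ w = bdryPoint ((2 * (k : ℕ) + 1 + s) / (2 * g))

/-- The closed non-orientable surface of Euler characteristic `2 - g` (for `g ≥ 1`), that is, the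
connected sum of `g` projective planes, as the `2 g`-gon with word `a₁ a₁ ⋯ a_g a_g`. -/
abbrev ClosedSurface (g : ℕ) : Type := Quot (Glue g)

/-- The centre of the hole number `j`. -/
def holeCenter {r : ℕ} (j : Fin r) : ℝ := (2 * (j : ℕ) + 1 - r) / (r + 1)

/-- The radius of each of the `r` holes. -/
def holeRadius (r : ℕ) : ℝ := 1 / (2 * (r + 1))

/-- The open disc `D_j` in the closed surface. The closures of `D_1, …, D_r` are pairwise disjoint
closed discs in the interior of the polygon. -/
def hole (g : ℕ) {r : ℕ} (j : Fin r) : Set (ClosedSurface g) :=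
  Quot.mk (Glue g) '' {z : Disc | dist (z : ℂ) (holeCenter j : ℂ) < holeRadius r}

/-- The compact non-orientable surface with `r` boundary circles obtained from the closed
surface by removing the open discs `D_1, …, D_r`. -/
abbrev HoledSurface (g r : ℕ) : Type := {p : ClosedSurface g // p ∉ ⋃ j : Fin r, hole g j}

/-- The point `c_j + ρ exp (2 π i t)` of the boundary circle of the `j`-th hole, in the plane. -/
def holeBdry {r : ℕ} (j : Fin r) (t : ℝ) : ℂ :=
  (holeCenter j : ℂ) + (holeRadius r : ℂ) * Complex.exp (((2 * Real.pi * t : ℝ) : ℂ) * Complex.I)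

theorem holeRadius_pos (r : ℕ) : 0 < holeRadius r := by
  unfold holeRadius; positivity

theorem abs_holeCenter_add_lt {r : ℕ} (j : Fin r) : |holeCenter j| + holeRadius r < 1 := by
  have hj : ((j : ℕ) : ℝ) + 1 ≤ r := by exact_mod_cast j.2
  have hr : (0 : ℝ) < r + 1 := by positivity
  have hj0 : (0 : ℝ) ≤ ((j : ℕ) : ℝ) := by positivity
  unfold holeCenter holeRadius
  rw [abs_div, abs_of_pos hr]
  have h1 : |2 * ((j : ℕ) : ℝ) + 1 - r| ≤ r - 1 := abs_le.2 ⟨by linarith, by linarith⟩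
  have h2 : 1 / (2 * ((r : ℝ) + 1)) = (1 / 2) / (r + 1) := by field_simp
  rw [h2, ← add_div, div_lt_one hr]
  linarith

theorem two_mul_holeRadius_lt {r : ℕ} {i j : Fin r} (h : i ≠ j) :
    2 * holeRadius r < |holeCenter i - holeCenter j| := by
  have hr : (0 : ℝ) < r + 1 := by positivity
  have h1 : (1 : ℝ) ≤ |((i : ℕ) : ℝ) - ((j : ℕ) : ℝ)| := by
    have h2 : ((i : ℕ) : ℤ) - ((j : ℕ) : ℤ) ≠ 0 := fun h3 => h (Fin.ext (by omega))
    exact_mod_cast Int.one_le_abs h2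
  have h3 : holeCenter i - holeCenter j =
      2 * (((i : ℕ) : ℝ) - ((j : ℕ) : ℝ)) / (r + 1) := by
    unfold holeCenter; field_simp; ring
  have h4 : 2 * holeRadius r = 1 / (r + 1) := by unfold holeRadius; field_simp
  rw [h3, h4, abs_div, abs_mul, abs_of_pos hr, abs_two]
  gcongr
  linarith

theorem dist_holeBdry {r : ℕ} (j : Fin r) (t : ℝ) :
    dist (holeBdry j t) (holeCenter j : ℂ) = holeRadius r := by
  rw [holeBdry, dist_self_add_left, norm_mul, Complex.norm_exp_ofReal_mul_I, mul_one,
    Complex.norm_real, Real.norm_of_nonneg (holeRadius_pos r).le]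

theorem norm_lt_one_of_dist_le {r : ℕ} {j : Fin r} {z : ℂ}
    (h : dist z (holeCenter j : ℂ) ≤ holeRadius r) : ‖z‖ < 1 := by
  have h1 : ‖z‖ ≤ dist z (holeCenter j : ℂ) + ‖(holeCenter j : ℂ)‖ := by
    rw [dist_eq_norm]; simpa using norm_add_le (z - holeCenter j) (holeCenter j : ℂ)
  rw [Complex.norm_real, Real.norm_eq_abs] at h1
  linarith [abs_holeCenter_add_lt j]

theorem norm_bdryPoint (t : ℝ) : ‖(bdryPoint t : ℂ)‖ = 1 := Complex.norm_exp_ofReal_mul_I _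

open scoped Classical in
/-- No identification is made in the interior of the disc. -/
theorem eq_of_mk_eq {g : ℕ} {z w : Disc} (hz : ‖(z : ℂ)‖ < 1) (hw : ‖(w : ℂ)‖ < 1)
    (h : Quot.mk (Glue g) z = Quot.mk (Glue g) w) : z = w := by
  let f : ClosedSurface g → Option Disc :=
    Quot.lift (fun u => if ‖(u : ℂ)‖ < 1 then some u else none) (by
      rintro _ _ ⟨k, s, -, rfl, rfl⟩
      simp [norm_bdryPoint])
  have h1 : f (Quot.mk _ z) = f (Quot.mk _ w) := congrArg f h
  simpa [f, hz, hw] using h1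

/-- The boundary circle of the `j`-th hole, as a map to the surface. -/
def holeBdryMap (g : ℕ) {r : ℕ} (j : Fin r) (t : ℝ) : HoledSurface g r :=
  ⟨Quot.mk (Glue g) ⟨holeBdry j t,
      mem_closedBall_zero_iff.2 (norm_lt_one_of_dist_le (dist_holeBdry j t).le).le⟩, by
    intro hmem
    obtain ⟨i, z, hz, hzw⟩ := Set.mem_iUnion.1 hmem
    have hz' : dist (z : ℂ) (holeCenter i : ℂ) < holeRadius r := hz
    obtain rfl := eq_of_mk_eq (norm_lt_one_of_dist_le hz'.le)
      (norm_lt_one_of_dist_le (dist_holeBdry j t).le) hzw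
    have hz'' : dist (holeBdry j t) (holeCenter i : ℂ) < holeRadius r := hz'
    have hd := dist_holeBdry j t
    rcases eq_or_ne i j with rfl | hij
    · exact absurd hd hz''.ne
    · have h1 := dist_triangle_left (holeCenter i : ℂ) (holeCenter j : ℂ) (holeBdry j t)
      rw [dist_eq_norm, ← Complex.ofReal_sub, Complex.norm_real, Real.norm_eq_abs] at h1
      linarith [two_mul_holeRadius_lt hij]⟩

/-- The `j`-th boundary circle `C_j` of the surface, run through once. -/
def boundaryCircle (g : ℕ) {r : ℕ} (j : Fin r) :
    Path (holeBdryMap g j 0) (holeBdryMap g j 0) where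
  toFun t := holeBdryMap g j (t : ℝ)
  continuous_toFun := by
    unfold holeBdryMap holeBdry
    refine Continuous.subtype_mk (continuous_quot_mk.comp (Continuous.subtype_mk ?_ _)) _
    fun_prop
  source' := by simp
  target' := by
    refine Subtype.ext (congrArg (Quot.mk (Glue g)) (Subtype.ext ?_))
    simp [holeBdry, Complex.exp_two_pi_mul_I]

/-! ## Holonomy around the boundary circles -/

section Holonomy

variable {X : Type*} [TopologicalSpace X]

/-- The loop `ℓ` is freely homotopic to the closed curve `c`, run through in one of its two
directions: `ℓ` is homotopic, relative to its base point, to a path from the base point to the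
curve, followed by the curve and by the way back. -/
def GoesAround {x y : X} (ℓ : Path x x) (c : Path y y) : Prop :=
  ∃ p : Path x y, ℓ.Homotopic ((p.trans c).trans p.symm) ∨
    ℓ.Homotopic ((p.trans c.symm).trans p.symm)

/-- The set of morphisms `π₁(X, x) → G` (equivalently, of isomorphism classes of principal
`G`-bundles over `X` with a marked point in the fibre over `x`) whose holonomy along `ℓ_j` lies
in the conjugacy class of `γ_j`, for all `j`. -/
def holonomySet {G : Type*} [Group G] {r : ℕ} {x : X} (ℓ : Fin r → Path x x) (γ : Fin r → G) :
    Set (FundamentalGroup X x →* G) :=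
  {ρ | ∀ j, ρ (FundamentalGroup.fromPath (Path.Homotopic.Quotient.mk (ℓ j))) ∈ conjugatesOf (γ j)}

end Holonomy

end SurfaceCount

end

/-! The holed surface is a polygon with word a₁a₁⋯a_ga_g from which discs are removed. Its
fundamental group is generated by g edge loops and r loops around the holes, subject to the single
relation a₁²⋯a_g² = k₁⋯k_r. A homomorphism to G is thus a solution of this equation in G, the
boundary conditions confine each k_j to a conjugacy class, and such solutions are counted with
characters.

Algebra (`card_solutions`). By `sum_dim_mul_character`, the sum of dim π · χ_π is |G| times the
indicator of the identity, so it detects the equation. A class function acts on an irreducible π by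
a scalar (`Irr.dim_mul_sum`); hence each square contributes |G|ν₂(π)/dim π and each k_j contributes
the size of its class times a normalized character value. By `Irr.frobeniusSchur_sq`, ν₂(π)² is 1 if
χ_π is invariant under inversion of its argument and 0 otherwise. This restricts the sum to ν₂(π) ≠
0, turns ν₂^g into ν₂^(2-g), and makes the directions of the boundary loops irrelevant.

Topology (`nonempty_equiv_holonomySet`). The presentation of the group is replaced by a
classification of flat bundles. A homomorphism extends to a functor from the fundamental groupoid
(`Hol`), which is described by the transition functions of its frames over an open cover by
contractible charts: a slit open disc, strips to the right of the hole centres, a neighbourhood of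
the vertex, and neighbourhoods of the open edges. The frames can be normalized
(`exists_isNormalized`) so that the remaining data are one element a_i per pair of edges and one
element d_{j+1} below each gap. These data determine all transition functions
(`IsNormalized.transition_eq`), and comparing the two sides of the positive real axis yields the
relation (`IsNormalized.relation`). Conversely, data satisfying the relation form a locally constant
cocycle, whose covering space has the required holonomy (`exists_hol_frame`,
`exists_hol_of_cocycle`). The lemmas `eq_of_val_eq` and `IsNormalized.val_eq` make the
correspondence bijective once the frame at the base point is fixed, and
`IsNormalized.isConj_val_boundaryCircle` identifies the holonomy around the hole j, up to conjugacy,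
with k_j = d_j⁻¹ d_{j+1}. -/

namespace SurfaceCount

/-! ## Characters of finite groups -/

section Characters

universe u

variable {G : Type u} [Group G]

/-! ### Schur's lemma and the action of class functions -/

section Schur

variable {V : Type*} [AddCommGroup V] [Module ℂ V] [FiniteDimensional ℂ V]
  (ρ : Representation ℂ G V)

/-- Schur's lemma for a representation whose character has norm one. -/
theorem exists_eq_smul_of_commute [Fintype G]
    (hρ : ∑ g : G, ρ.character g * ρ.character g⁻¹ = Nat.card G)
    (T : V →ₗ[ℂ] V) (hT : ∀ g, T ∘ₗ ρ g = ρ g ∘ₗ T) : ∃ c : ℂ, T = c • LinearMap.id := by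
  have : Invertible (Nat.card G : ℂ) :=
    invertibleOfNonzero (by exact_mod_cast Nat.card_pos.ne')
  -- The averaged norm of the character is the dimension of the space of self-intertwiners; it
  -- equals 1, so the identity spans this space.
  have h1 := Representation.card_inv_mul_sum_char_mul_char_eq_finrank ρ ρ
  rw [hρ, inv_mul_cancel_of_invertible] at h1
  have h2 : Module.finrank ℂ (ρ.IntertwiningMap ρ) = 1 := by exact_mod_cast h1.symm
  have hne : (Representation.IntertwiningMap.id ρ) ≠ 0 := by
    intro h0
    have : Nontrivial (ρ.IntertwiningMap ρ) :=
      Module.nontrivial_of_finrank_pos (R := ℂ) (h2.symm ▸ one_pos)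
    obtain ⟨f, hf⟩ := exists_ne (0 : ρ.IntertwiningMap ρ)
    apply hf
    ext v
    have hv : v = 0 := congrArg (fun F : ρ.IntertwiningMap ρ => F v) h0
    simp [hv]
  obtain ⟨c, hc⟩ := (finrank_eq_one_iff_of_nonzero' _ hne).1 h2 ⟨T, hT⟩
  exact ⟨c, by simpa using (congrArg Representation.IntertwiningMap.toLinearMap hc).symm⟩

/-- A linear combination of group elements with coefficients constant on conjugacy classes acts
as a scalar, which is determined by its trace. -/
theorem finrank_smul_sum_eq [Fintype G]
    (hρ : ∑ g : G, ρ.character g * ρ.character g⁻¹ = Nat.card G)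
    (f : G → ℂ) (hf : ∀ g h, f (h * g * h⁻¹) = f g) :
    (Module.finrank ℂ V : ℂ) • ∑ g, f g • ρ g = (∑ g, f g * ρ.character g) • LinearMap.id := by
  obtain ⟨c, hc⟩ := exists_eq_smul_of_commute ρ hρ (∑ g, f g • ρ g) (by
    intro h
    change (∑ g, f g • ρ g) * ρ h = ρ h * ∑ g, f g • ρ g
    rw [Finset.sum_mul, Finset.mul_sum]
    refine Fintype.sum_equiv (MulAut.conj h⁻¹).toEquiv _ _ fun g => ?_
    have h1 : f (h⁻¹ * g * h⁻¹⁻¹) = f g := hf g h⁻¹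
    simp only [MulEquiv.toEquiv_eq_coe, EquivLike.coe_coe, MulAut.conj_apply, h1,
      smul_mul_assoc, mul_smul_comm, ← map_mul]
    congr 2
    group)
  -- Taking traces identifies the scalar: c · dim V is the sum of f against the character.
  have h1 := congrArg (LinearMap.trace ℂ V) hc
  simp only [map_sum, map_smul, LinearMap.trace_id, smul_eq_mul] at h1
  rw [hc, smul_smul, mul_comm, ← h1]
  rfl

end Schur

/-! ### Elementary properties of irreducible characters -/

theorem Irr.exists_rep (π : Irr G) : ∃ V : FDRep.{0, u} ℂ G, CategoryTheory.Simple V ∧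
    (∀ g, π.character g = Representation.character V.ρ g) ∧ π.dim = Module.finrank ℂ V := by
  obtain ⟨V, rfl⟩ := Quotient.exists_rep (s := irrSetoid G) π
  exact ⟨V.1, V.2, fun _ => rfl, rfl⟩

theorem Irr.sum_character_mul_inv [Fintype G] (π : Irr G) :
    ∑ g : G, π.character g * π.character g⁻¹ = Nat.card G := by
  have h := Irr.orthonormal π π
  rw [if_pos rfl, inv_mul_eq_one₀ (by exact_mod_cast Nat.card_pos.ne')] at h
  exact h.symm

theorem Irr.character_conj (π : Irr G) (g h : G) :
    π.character (h * g * h⁻¹) = π.character g := by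
  obtain ⟨V, -, hV, -⟩ := π.exists_rep
  rw [hV, hV]
  exact FDRep.char_conj V g h

theorem Irr.character_mul_comm (π : Irr G) (g h : G) :
    π.character (g * h) = π.character (h * g) := by
  obtain ⟨V, -, hV, -⟩ := π.exists_rep
  rw [hV, hV]
  exact FDRep.char_mul_comm V h g

theorem Irr.character_one (π : Irr G) : π.character 1 = π.dim := by
  obtain ⟨V, -, hV, hd⟩ := π.exists_rep
  rw [hV, hd]
  exact FDRep.char_one V

/-- This is the trace of π(x) composed with the scalar by which the class function f acts. Every
factor in the counting formula is an instance, with f the number of square roots or the indicator of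
a conjugacy class. -/
theorem Irr.dim_mul_sum [Fintype G] (π : Irr G) (f : G → ℂ)
    (hf : ∀ g h, f (h * g * h⁻¹) = f g) (x : G) :
    (π.dim : ℂ) * ∑ g, f g * π.character (x * g) =
      (∑ g, f g * π.character g) * π.character x := by
  obtain ⟨V, -, hV, hd⟩ := π.exists_rep
  have h1 : ∑ g : G, Representation.character V.ρ g * Representation.character V.ρ g⁻¹ =
      Nat.card G := by simpa only [hV] using π.sum_character_mul_inv
  have h2 := congrArg (fun T => LinearMap.trace ℂ V (V.ρ x * T))
    (finrank_smul_sum_eq V.ρ h1 f hf)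
  simp only [mul_smul_comm, Finset.mul_sum, ← map_mul, map_smul, map_sum, smul_eq_mul] at h2
  simp only [hV, hd, Finset.mul_sum]
  exact h2

theorem Irr.dim_ne_zero [Finite G] (π : Irr G) : (π.dim : ℂ) ≠ 0 := by
  have := Fintype.ofFinite G
  intro h0
  have h := π.dim_mul_sum (fun g => π.character g⁻¹) (fun g h => by
    simp only [mul_inv_rev, inv_inv, ← mul_assoc, π.character_conj]) 1
  rw [h0, zero_mul, π.character_one, h0]at h
  obtain ⟨V, -, hV, hd⟩ := π.exists_rep
  have h2 : Module.finrank ℂ V = 0 := by rw [← hd]; exact_mod_cast h0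
  have h3 : ∀ g, π.character g = 0 := fun g => by
    have : Subsingleton V := Module.finrank_zero_iff.1 h2
    rw [hV, Representation.character, Subsingleton.elim (V.ρ g) 0, map_zero]
  have h4 := π.sum_character_mul_inv
  simp only [h3, mul_zero, Finset.sum_const_zero] at h4
  exact Nat.card_pos.ne (by exact_mod_cast h4)

/-! ### Completeness of the irreducible characters -/

open CategoryTheory in
theorem simple_of_sum_character_mul_inv [Fintype G] (V : FDRep.{0, u} ℂ G)
    (hV : ∑ g : G, V.character g * V.character g⁻¹ = Nat.card G) : Simple V := by
  -- The norm-one criterion is applied to a copy of the group in the universe of ℂ. Restriction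
  -- along the isomorphism is an equivalence of categories, so it preserves and reflects simplicity,
  -- and it only reindexes the sum.
  let e : Shrink.{0} G ≃* G := Shrink.mulEquiv
  let F : FDRep.{0, u} ℂ G ⥤ FDRep.{0, 0} ℂ (Shrink.{0} G) :=
    (Action.resEquiv (FGModuleCat.{0} ℂ) e).functor
  have : F.IsEquivalence := (Action.resEquiv (FGModuleCat.{0} ℂ) e).isEquivalence_functor
  have : Fintype (Shrink.{0} G) := Fintype.ofEquiv G e.symm.toEquiv
  rw [← simple_obj_iff F V, FDRep.simple_iff_char_is_norm_one, Nat.card_congr e.toEquiv, ← hV]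
  refine Fintype.sum_equiv e.toEquiv _ _ fun g => ?_
  have h : ∀ g, (F.obj V).character g = V.character (e g) := fun _ => rfl
  rw [h, h, map_inv]
  rfl

/-- Every irreducible representation is, up to isomorphism, in the list `Irr G`. -/
theorem exists_irr_character_eq [Fintype G] {V : Type*} [AddCommGroup V] [Module ℂ V]
    [FiniteDimensional ℂ V] (ρ : Representation ℂ G V)
    (hρ : ∑ g : G, ρ.character g * ρ.character g⁻¹ = Nat.card G) :
    ∃ π : Irr G, ∀ g, π.character g = ρ.character g := by
  -- A basis moves the representation to a space ℂⁿ, which lies in the universe used by `Irr`.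
  let e := (Module.finBasis ℂ V).equivFun
  let σ : Representation ℂ G (Fin (Module.finrank ℂ V) → ℂ) :=
    (e.conjAlgEquiv ℂ : _ →* _).comp ρ
  have hσ : ∀ g, (FDRep.of σ).character g = ρ.character g := fun g => by
    change LinearMap.trace ℂ _ (e.conj (ρ g)) = _
    exact LinearMap.trace_conj' _ _
  have hs : CategoryTheory.Simple (FDRep.of σ) :=
    simple_of_sum_character_mul_inv _ (by simpa only [hσ] using hρ)
  exact ⟨Quotient.mk (irrSetoid G) ⟨FDRep.of σ, hs⟩, hσ⟩

theorem Irr.exists_dual [Fintype G] (π : Irr G) :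
    ∃ σ : Irr G, ∀ g, σ.character g = π.character g⁻¹ := by
  obtain ⟨V, -, hV, -⟩ := π.exists_rep
  have h : ∀ g, Representation.character (Representation.dual V.ρ) g = π.character g⁻¹ :=
    fun g => by rw [hV]; exact Representation.char_dual V.ρ g
  obtain ⟨σ, hσ⟩ := exists_irr_character_eq (Representation.dual V.ρ) (by
    simp only [h, inv_inv]
    simp only [mul_comm (π.character _⁻¹), π.sum_character_mul_inv])
  exact ⟨σ, fun g => (hσ g).trans (h g)⟩

/-- By Schur's lemma the operator is a scalar whose trace is the sum of f against an irreducible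
character. That trace is zero, and the dimension is nonzero. -/
theorem sum_smul_eq_zero_of_isIrreducible [Fintype G] {V : Type*} [AddCommGroup V] [Module ℂ V]
    [FiniteDimensional ℂ V] (ρ : Representation ℂ G V) [ρ.IsIrreducible]
    (f : G → ℂ) (hf : ∀ g h, f (h * g * h⁻¹) = f g)
    (hf0 : ∀ σ : Irr G, ∑ g, f g * σ.character g = 0) : ∑ g, f g • ρ g = 0 := by
  have hG : (Nat.card G : ℂ) ≠ 0 := by exact_mod_cast Nat.card_pos.ne'
  have : Invertible (Nat.card G : ℂ) := invertibleOfNonzero hG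
  have h1 := Representation.card_inv_mul_sum_char_mul_char_eq_finrank ρ ρ
  rw [Representation.IsIrreducible.finrank_intertwiningMap_self, Nat.cast_one,
    inv_mul_eq_one₀ hG] at h1
  obtain ⟨σ, hσ⟩ := exists_irr_character_eq ρ h1.symm
  have h2 := finrank_smul_sum_eq ρ h1.symm f hf
  have h3 : (Module.finrank ℂ V : ℂ) = σ.dim := by
    rw [← σ.character_one, hσ, Representation.char_one]
  simp only [← hσ, hf0, zero_smul, h3] at h2
  exact (smul_eq_zero.1 h2).resolve_left σ.dim_ne_zero

theorem sum_single_smul_eq_zero [Fintype G] (Q : Type*) [AddCommGroup Q] [Module ℂ Q]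
    [Module (MonoidAlgebra ℂ G) Q] [IsScalarTower ℂ (MonoidAlgebra ℂ G) Q]
    [IsSimpleModule (MonoidAlgebra ℂ G) Q]
    (f : G → ℂ) (hf : ∀ g h, f (h * g * h⁻¹) = f g)
    (hf0 : ∀ σ : Irr G, ∑ g, f g * σ.character g = 0) (q : Q) :
    (∑ g, MonoidAlgebra.single g (f g)) • q = 0 := by
  let ρ : Representation ℂ G Q := Representation.ofModule' Q
  have hρ : ∀ a : MonoidAlgebra ℂ G, ρ.asAlgebraHom a = Algebra.lsmul ℂ ℂ Q a := fun a => by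
    rw [Representation.asAlgebraHom_def]
    exact DFunLike.congr_fun
      ((MonoidAlgebra.lift ℂ (Module.End ℂ Q) G).apply_symm_apply (Algebra.lsmul ℂ ℂ Q)) a
  let e : ρ.asModule ≃ₗ[MonoidAlgebra ℂ G] Q :=
    { ρ.asModuleEquiv with
      map_smul' := fun a v => by
        change ρ.asModuleEquiv (a • v) = a • ρ.asModuleEquiv v
        rw [Representation.asModuleEquiv_map_smul, hρ, Algebra.lsmul_coe] }
  have : IsSimpleModule (MonoidAlgebra ℂ G) ρ.asModule := IsSimpleModule.congr e
  have : ρ.IsIrreducible := (Representation.irreducible_iff_isSimpleModule_asModule ρ).2 this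
  have : FiniteDimensional ℂ (MonoidAlgebra ℂ G) :=
    Module.Finite.equiv (MonoidAlgebra.coeffLinearEquiv ℂ).symm
  have : FiniteDimensional ℂ Q := Module.Finite.trans (MonoidAlgebra ℂ G) _
  have h1 := sum_smul_eq_zero_of_isIrreducible ρ f hf hf0
  have h3 : ρ.asAlgebraHom (∑ g, MonoidAlgebra.single g (f g)) = 0 := by
    rw [map_sum, ← h1]
    exact Finset.sum_congr rfl fun g _ => Representation.asAlgebraHom_single _ g _
  rw [hρ] at h3
  exact LinearMap.congr_fun h3 q

/-- A class function orthogonal to all irreducible characters vanishes. -/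
theorem eq_zero_of_forall_irr [Fintype G] (f : G → ℂ) (hf : ∀ g h, f (h * g * h⁻¹) = f g)
    (hf0 : ∀ σ : Irr G, ∑ g, f g * σ.character g = 0) : f = 0 := by
  let a : MonoidAlgebra ℂ G := ∑ g, MonoidAlgebra.single g (f g)
  have : NeZero (Nat.card G : ℂ) := ⟨by exact_mod_cast Nat.card_pos.ne'⟩
  -- The element a annihilates every simple module, in particular every quotient by a maximal left
  -- ideal M; applied to the class of 1 this puts a in M. Hence a lies in the Jacobson radical,
  -- which vanishes because the group algebra is semisimple.
  have hmem : a ∈ Ring.jacobson (MonoidAlgebra ℂ G) := by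
    rw [Ring.jacobson_eq_sInf_isMaximal, Ideal.mem_sInf]
    intro M hM
    have hM' : M.IsMaximal := hM
    have : IsSimpleModule (MonoidAlgebra ℂ G) (MonoidAlgebra ℂ G ⧸ M) :=
      isSimpleModule_iff_isCoatom.2 (Ideal.isMaximal_def.1 hM')
    have h2 := sum_single_smul_eq_zero (MonoidAlgebra ℂ G ⧸ M) f hf hf0 (Submodule.Quotient.mk 1)
    rw [← Submodule.Quotient.mk_smul, smul_eq_mul, mul_one] at h2
    exact (Submodule.Quotient.mk_eq_zero M).1 h2
  rw [IsSemisimpleRing.jacobson_eq_bot] at hmem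
  have ha : a = 0 := hmem
  classical
  funext x
  have := congrArg (fun b : MonoidAlgebra ℂ G => b.coeff x) ha
  simpa [a, MonoidAlgebra.coeff_sum, Finsupp.single_apply] using this

open scoped Classical in
/-- The decomposition of the regular representation. -/
theorem sum_dim_mul_character [Fintype G] [DecidableEq G] (x : G) :
    ∑ π : Irr G, (π.dim : ℂ) * π.character x = if x = 1 then (Nat.card G : ℂ) else 0 := by
  -- Completeness is applied to the difference of the two sides. The characters are taken at x⁻¹
  -- since orthogonality pairs a value at g with a value at g⁻¹, and the outcome is evaluated at x⁻¹
  -- to compensate.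
  have h0 := congrFun (eq_zero_of_forall_irr (G := G)
    (fun x => (if x = 1 then (Nat.card G : ℂ) else 0) -
      ∑ π : Irr G, (π.dim : ℂ) * π.character x⁻¹) ?_ ?_) x⁻¹
  · simp only [inv_eq_one, inv_inv, Pi.zero_apply] at h0
    exact (sub_eq_zero.1 h0).symm
  · intro g h
    have h1 : ∀ π : Irr G, π.character (h * g * h⁻¹)⁻¹ = π.character g⁻¹ := fun π => by
      rw [mul_inv_rev, mul_inv_rev, inv_inv, ← mul_assoc, π.character_conj]
    simp only [h1, conj_eq_one_iff]
  · intro σ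
    have h1 : ∀ π : Irr G, ∑ g : G, π.character g⁻¹ * σ.character g =
        if σ = π then (Nat.card G : ℂ) else 0 := fun π => by
      have h2 := Irr.orthonormal σ π
      rw [inv_mul_eq_iff_eq_mul₀ (by exact_mod_cast Nat.card_pos.ne')] at h2
      simp only [mul_comm (π.character _), h2]
      split_ifs <;> simp
    simp only [sub_mul, Finset.sum_sub_distrib, Finset.sum_mul]
    rw [Finset.sum_comm]
    simp only [mul_assoc, ← Finset.mul_sum, h1]
    simp [σ.character_one, mul_comm (σ.dim : ℂ)]

/-! ### The Frobenius-Schur indicator -/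

theorem Irr.dim_mul_sum_conj [Fintype G] (π : Irr G) (x y : G) :
    (π.dim : ℂ) * ∑ h : G, π.character (x * (h * y * h⁻¹)) =
      Nat.card G * (π.character x * π.character y) := by
  classical
  have h1 : ∀ F : G → ℂ, ∑ g, (∑ h : G, if h * y * h⁻¹ = g then 1 else 0) * F g =
      ∑ h : G, F (h * y * h⁻¹) := fun F => by
    simp only [Finset.sum_mul]
    rw [Finset.sum_comm]
    simp
  have h2 := π.dim_mul_sum (fun g => ∑ h : G, if h * y * h⁻¹ = g then 1 else 0) (fun g k => by
    refine Fintype.sum_equiv (Equiv.mulLeft k⁻¹) _ _ fun h => ?_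
    refine if_congr ?_ rfl rfl
    simp only [Equiv.coe_mulLeft, mul_inv_rev, inv_inv]
    constructor
    · intro h0
      calc k⁻¹ * h * y * (h⁻¹ * k) = k⁻¹ * (h * y * h⁻¹) * k := by group
        _ = g := by rw [h0]; group
    · rintro rfl
      group) x
  rw [h1, h1] at h2
  simp only [π.character_conj, Finset.sum_const, nsmul_eq_mul, Finset.card_univ] at h2
  rw [h2, Nat.card_eq_fintype_card]
  ring

/-- Here the class function counts square roots; its pairing with χ_π is |G| times the indicator.
This is the contribution of one crosscap. -/
theorem Irr.dim_mul_sum_sq [Fintype G] (π : Irr G) (x : G) :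
    (π.dim : ℂ) * ∑ a : G, π.character (x * a ^ 2) =
      Nat.card G * π.frobeniusSchur * π.character x := by
  classical
  have h1 : ∀ F : G → ℂ, ∑ g, (∑ a : G, if a ^ 2 = g then 1 else 0) * F g =
      ∑ a : G, F (a ^ 2) := fun F => by
    simp only [Finset.sum_mul]
    rw [Finset.sum_comm]
    simp
  have h2 := π.dim_mul_sum (fun g => ∑ a : G, if a ^ 2 = g then 1 else 0) (fun g k => by
    refine Fintype.sum_equiv (MulAut.conj k⁻¹).toEquiv _ _ fun h => ?_
    refine if_congr ?_ rfl rfl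
    simp only [MulEquiv.toEquiv_eq_coe, EquivLike.coe_coe, ← map_pow]
    rw [← (MulAut.conj k⁻¹).injective.eq_iff (a := h ^ 2)]
    have : (MulAut.conj k⁻¹) (k * g * k⁻¹) = g := by simp [mul_assoc]
    rw [this]) x
  rw [h1, h1] at h2
  have : (Fintype.card G : ℂ) ≠ 0 := by exact_mod_cast Fintype.card_ne_zero
  rw [h2, Irr.frobeniusSchur, Nat.card_eq_fintype_card, mul_inv_cancel_left₀ this]

/-- The indicator of a conjugacy class acts as a scalar; this is the contribution of one boundary
circle. -/
theorem Irr.dim_mul_sum_conjugatesOf [Fintype G] (π : Irr G) (x y : G)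
    [Fintype (conjugatesOf y)] :
    (π.dim : ℂ) * ∑ k : conjugatesOf y, π.character (x * k) =
      Nat.card (conjugatesOf y) * π.character y * π.character x := by
  classical
  have h1 : ∀ F : G → ℂ, ∑ g, (if g ∈ conjugatesOf y then 1 else 0) * F g =
      ∑ k : conjugatesOf y, F k := fun F => by
    simp only [ite_mul, one_mul, zero_mul]
    rw [← Finset.sum_filter]
    refine (Finset.sum_subtype _ (fun g => ?_) F)
    simp
  have h2 := π.dim_mul_sum (fun g => if g ∈ conjugatesOf y then 1 else 0) (fun g k => by
    refine if_congr ?_ rfl rfl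
    have hk : IsConj g (k * g * k⁻¹) := isConj_iff.2 ⟨k, rfl⟩
    exact ⟨fun h => IsConj.trans h hk.symm, fun h => IsConj.trans h hk⟩) x
  rw [h1, h1] at h2
  have h3 : ∀ k : conjugatesOf y, π.character k = π.character y := by
    rintro ⟨k, hk⟩
    obtain ⟨c, rfl⟩ := isConj_iff.1 (show IsConj y k from hk)
    exact π.character_conj _ _
  rw [h2]
  simp only [h3, Finset.sum_const, nsmul_eq_mul, Finset.card_univ, Nat.card_eq_fintype_card]

-- The sum of χ(a²b²) over all a, b is evaluated twice. Summing the squares one after the other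
-- gives |G|²ν₂²/dim. Rewriting it as a sum over conjugates gives |G|/dim times the sum of χ(c)²,
-- which by orthogonality is |G|²/dim when π equals its dual and 0 otherwise.
open scoped Classical in
theorem Irr.frobeniusSchur_sq [Fintype G] (π : Irr G) :
    π.frobeniusSchur ^ 2 = if ∀ g, π.character g⁻¹ = π.character g then 1 else 0 := by
  have hG : (Nat.card G : ℂ) ≠ 0 := by exact_mod_cast Nat.card_pos.ne'
  have hd := π.dim_ne_zero
  obtain ⟨σ, hσ⟩ := π.exists_dual
  have h1 : (π.dim : ℂ) ^ 2 * ∑ a : G, ∑ b : G, π.character (a ^ 2 * b ^ 2) =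
      (Nat.card G * π.frobeniusSchur) ^ 2 * π.dim := by
    have h2 := π.dim_mul_sum_sq 1
    simp only [one_mul, π.character_one] at h2
    calc _ = π.dim * ∑ a : G, π.dim * ∑ b : G, π.character (a ^ 2 * b ^ 2) := by
          rw [← Finset.mul_sum]; ring
      _ = (Nat.card G * π.frobeniusSchur) * (π.dim * ∑ a : G, π.character (a ^ 2)) := by
          simp only [π.dim_mul_sum_sq, ← Finset.mul_sum]; ring
      _ = _ := by rw [h2]; ring
  -- Substituting c = ab gives a²b² = (a c a⁻¹) c.
  have h2 : ∑ a : G, ∑ b : G, π.character (a ^ 2 * b ^ 2) =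
      ∑ c : G, ∑ a : G, π.character (c * (a * c * a⁻¹)) := by
    rw [Finset.sum_comm (γ := G) (s := Finset.univ) (t := Finset.univ)
      (f := fun c a => π.character (c * (a * c * a⁻¹)))]
    refine Finset.sum_congr rfl fun a _ => ?_
    refine Fintype.sum_equiv (Equiv.mulLeft a) _ _ fun b => ?_
    rw [π.character_mul_comm (Equiv.mulLeft a b)]
    simp only [Equiv.coe_mulLeft, pow_two]
    congr 1
    group
  have h3 : (π.dim : ℂ) * ∑ c : G, ∑ a : G, π.character (c * (a * c * a⁻¹)) =
      Nat.card G * ∑ c : G, π.character c * σ.character c⁻¹ := by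
    rw [Finset.mul_sum, Finset.mul_sum]
    refine Finset.sum_congr rfl fun c _ => ?_
    rw [π.dim_mul_sum_conj, hσ, inv_inv]
  have h4 := Irr.orthonormal π σ
  rw [inv_mul_eq_iff_eq_mul₀ hG] at h4
  rw [h2, pow_two (π.dim : ℂ), mul_assoc, h3, h4] at h1
  have h5 : π.frobeniusSchur ^ 2 = if π = σ then 1 else 0 := by
    have : (π.dim * (Nat.card G : ℂ) ^ 2) * (if π = σ then 1 else 0) =
        (π.dim * (Nat.card G : ℂ) ^ 2) * π.frobeniusSchur ^ 2 := by
      linear_combination h1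
    exact (mul_left_cancel₀ (by positivity) this).symm
  rw [h5]
  refine if_congr ⟨fun h g => ?_, fun h => ?_⟩ rfl rfl
  · rw [← hσ, ← h]
  · by_contra hne
    have h6 := Irr.orthonormal π σ
    rw [if_neg hne] at h6
    have h7 := Irr.orthonormal π π
    rw [if_pos rfl] at h7
    simp only [hσ, h] at h6 h7
    exact zero_ne_one (h6.symm.trans h7)

/-! ### Counting solutions of a product of squares equal to a product in conjugacy classes -/

/-- Each weighted factor acts as the scalar c_j/dim, so the factors can be stripped off one at a
time. The induction keeps x arbitrary, because the first factor is absorbed into it. -/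
theorem Irr.dim_pow_mul_sum_prod [Fintype G] (π : Irr G) {n : ℕ} (f : Fin n → G → ℂ)
    (φ : Fin n → G → G) (c : Fin n → ℂ)
    (h : ∀ j x, (π.dim : ℂ) * ∑ y, f j y * π.character (x * φ j y) = c j * π.character x)
    (x : G) :
    (π.dim : ℂ) ^ n * ∑ y : Fin n → G, (∏ j, f j (y j)) *
      π.character (x * (List.ofFn fun j => φ j (y j)).prod) = (∏ j, c j) * π.character x := by
  induction n generalizing x with
  | zero => simp
  | succ n ih =>
    rw [← (Fin.consEquiv fun _ : Fin (n + 1) => G).sum_comp, Fintype.sum_prod_type]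
    have h1 : ∀ y₀ : G, (π.dim : ℂ) ^ n * ∑ y : Fin n → G,
        (∏ j, f j ((Fin.consEquiv fun _ : Fin (n + 1) => G) (y₀, y) j)) *
          π.character (x * (List.ofFn fun j => φ j
            ((Fin.consEquiv fun _ : Fin (n + 1) => G) (y₀, y) j)).prod) =
        f 0 y₀ * ((∏ j : Fin n, c j.succ) * π.character (x * φ 0 y₀)) := fun y₀ => by
      rw [← ih (fun j => f j.succ) (fun j => φ j.succ) (fun j => c j.succ)
        (fun j => h j.succ) (x * φ 0 y₀), Finset.mul_sum, Finset.mul_sum, Finset.mul_sum]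
      refine Finset.sum_congr rfl fun y _ => ?_
      simp only [Fin.consEquiv_apply, Fin.prod_univ_succ, Fin.cons_zero, Fin.cons_succ,
        List.ofFn_succ, List.prod_cons, mul_assoc]
      ring
    calc _ = (π.dim : ℂ) * ∑ y₀ : G, (π.dim : ℂ) ^ n * ∑ y : Fin n → G,
        (∏ j, f j ((Fin.consEquiv fun _ : Fin (n + 1) => G) (y₀, y) j)) *
          π.character (x * (List.ofFn fun j => φ j
            ((Fin.consEquiv fun _ : Fin (n + 1) => G) (y₀, y) j)).prod) := by
          rw [← Finset.mul_sum]; ring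
      _ = (∏ j : Fin n, c j.succ) *
          ((π.dim : ℂ) * ∑ y₀ : G, f 0 y₀ * π.character (x * φ 0 y₀)) := by
          simp only [h1, Finset.mul_sum]
          exact Finset.sum_congr rfl fun _ _ => by ring
      _ = _ := by rw [h, Fin.prod_univ_succ]; ring

theorem card_conjugatesOf_inv (y : G) :
    Nat.card (conjugatesOf y⁻¹) = Nat.card (conjugatesOf y) := by
  refine Nat.card_congr ((Equiv.inv G).subtypeEquiv fun z => ?_)
  change IsConj y⁻¹ z ↔ IsConj y z⁻¹
  simp only [isConj_iff]
  refine exists_congr fun c => ?_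
  rw [← inv_inj (b := z)]
  simp [mul_assoc]

theorem Irr.frobeniusSchur_ne_zero_iff [Fintype G] (π : Irr G) :
    π.frobeniusSchur ≠ 0 ↔ π.frobeniusSchur ^ 2 = 1 ∧ ∀ g, π.character g⁻¹ = π.character g := by
  classical
  have h := π.frobeniusSchur_sq
  constructor
  · intro h0
    split_ifs at h with h1
    · exact ⟨h, h1⟩
    · exact absurd h (pow_ne_zero 2 h0)
  · rintro ⟨h1, -⟩ h0
    rw [h0] at h1
    norm_num at h1

/-- Since ν₂² = 1, only the parity of the exponent matters; the g squares produce the exponent g,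
the formula has the Euler characteristic. -/
theorem Irr.zpow_frobeniusSchur [Fintype G] (π : Irr G) (hπ : π.frobeniusSchur ≠ 0) (g : ℕ) :
    π.frobeniusSchur ^ (2 - (g : ℤ)) = π.frobeniusSchur ^ g := by
  have h := (π.frobeniusSchur_ne_zero_iff.1 hπ).1
  have h1 : π.frobeniusSchur ^ (2 * (g : ℤ)) = 1 := by
    rw [zpow_mul, zpow_ofNat, h, one_zpow]
  rw [zpow_sub₀ hπ, zpow_ofNat, h,
    div_eq_iff (zpow_ne_zero _ hπ), zpow_natCast, ← pow_add, ← two_mul, ← h1]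
  norm_cast

/-- The equation is detected by the regular character evaluated at the left product times the
inverse of the right one; for each π, the sum over all variables then factors into scalars. Allowing
γ'_j to be γ_j or its inverse absorbs the unknown directions of the loops. -/
theorem card_solutions [Fintype G] (g r : ℕ) (hg : 1 ≤ g) (γ γ' : Fin r → G)
    (hγ : ∀ j, γ' j = γ j ∨ γ' j = (γ j)⁻¹) :
    (Nat.card {p : (Fin g → G) × (Fin r → G) // (∀ j, p.2 j ∈ conjugatesOf (γ' j)) ∧
        (List.ofFn fun i => p.1 i ^ 2).prod = (List.ofFn p.2).prod} : ℂ) / (Nat.card G : ℂ) =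
      (Nat.card G : ℂ) ^ (-(2 - (g : ℤ))) * (∏ j, (Nat.card (conjugatesOf (γ j)) : ℂ)) *
        ∑ π : {π : Irr G // π.frobeniusSchur ≠ 0},
          (π.1.frobeniusSchur * (π.1.dim : ℂ)) ^ (2 - (g : ℤ)) *
            ((∏ j, π.1.character (γ j)) / (π.1.dim : ℂ) ^ r) := by
  classical
  have hG : (Nat.card G : ℂ) ≠ 0 := by exact_mod_cast Nat.card_pos.ne'
  have hO : ∀ j, Nat.card (conjugatesOf (γ' j)) = Nat.card (conjugatesOf (γ j)) := fun j => by
    rcases hγ j with h | h <;> rw [h]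
    exact card_conjugatesOf_inv _
  let w : Fin r → G → ℂ := fun j k => if k ∈ conjugatesOf (γ' j) then 1 else 0
  have h1 : (Nat.card {p : (Fin g → G) × (Fin r → G) // (∀ j, p.2 j ∈ conjugatesOf (γ' j)) ∧
        (List.ofFn fun i => p.1 i ^ 2).prod = (List.ofFn p.2).prod} : ℂ) * Nat.card G =
      ∑ a : Fin g → G, ∑ k : Fin r → G, (∏ j, w j (k j)) * ∑ π : Irr G, (π.dim : ℂ) *
        π.character ((List.ofFn fun i => a i ^ 2).prod * (List.ofFn k).prod⁻¹) := by
    simp only [sum_dim_mul_character, mul_inv_eq_one]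
    rw [← Fintype.sum_prod_type'
      (f := fun (a : Fin g → G) (k : Fin r → G) => (∏ j, w j (k j)) *
        if (List.ofFn fun i => a i ^ 2).prod = (List.ofFn k).prod then (Nat.card G : ℂ) else 0),
      Nat.card_eq_fintype_card, Fintype.card_subtype, Finset.card_filter, Nat.cast_sum,
      Finset.sum_mul]
    refine Finset.sum_congr rfl fun p _ => ?_
    simp only [w, Finset.prod_ite_zero, Finset.prod_const_one, Finset.mem_univ, forall_true_left]
    split_ifs <;> simp_all
  have h2 : ∀ π : Irr G, (π.dim : ℂ) ^ (g + r) * ∑ a : Fin g → G, ∑ k : Fin r → G,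
      (∏ j, w j (k j)) *
        π.character ((List.ofFn fun i => a i ^ 2).prod * (List.ofFn k).prod⁻¹) =
      (Nat.card G * π.frobeniusSchur) ^ g *
        (∏ j, Nat.card (conjugatesOf (γ j)) * π.character (γ' j)⁻¹) * π.dim := fun π => by
    -- The product of the k_j enters inverted. Passing to the dual representation removes the
    -- inverse, so that the general product formula applies.
    obtain ⟨σ, hσ⟩ := π.exists_dual
    have hd : σ.dim = π.dim := by
      have := hσ 1
      rw [inv_one, σ.character_one, π.character_one] at this
      exact_mod_cast this
    have e1 : ∀ x, (π.dim : ℂ) ^ r * ∑ k : Fin r → G, (∏ j, w j (k j)) *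
        π.character (x * (List.ofFn k).prod⁻¹) =
        (∏ j, (Nat.card (conjugatesOf (γ j)) * π.character (γ' j)⁻¹)) * π.character x := by
      intro x
      have := σ.dim_pow_mul_sum_prod w (fun _ y => y)
        (fun j => Nat.card (conjugatesOf (γ' j)) * σ.character (γ' j)) (fun j y => by
          rw [← σ.dim_mul_sum_conjugatesOf y (γ' j)]
          congr 1
          simp only [w, ite_mul, one_mul, zero_mul]
          rw [← Finset.sum_filter]
          exact Finset.sum_subtype _ (fun g => by simp) (fun k => σ.character (y * k))) x⁻¹
      simp only [hσ, hd, hO, mul_inv_rev, inv_inv, π.character_mul_comm _ x] at this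
      exact this
    have e2 := π.dim_pow_mul_sum_prod (n := g) (fun _ _ => 1) (fun _ y => y ^ 2)
      (fun _ => Nat.card G * π.frobeniusSchur) (fun _ x => by
        simpa only [one_mul] using π.dim_mul_sum_sq x) 1
    simp only [one_mul, Finset.prod_const_one, Finset.prod_const, Finset.card_univ,
      Fintype.card_fin, π.character_one] at e2
    calc _ = (π.dim : ℂ) ^ g * ∑ a : Fin g → G, (π.dim : ℂ) ^ r * ∑ k : Fin r → G,
      (∏ j, w j (k j)) *
        π.character ((List.ofFn fun i => a i ^ 2).prod * (List.ofFn k).prod⁻¹) := by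
          rw [← Finset.mul_sum, pow_add]; ring
      _ = (∏ j, (Nat.card (conjugatesOf (γ j)) * π.character (γ' j)⁻¹)) *
          ((π.dim : ℂ) ^ g * ∑ a : Fin g → G,
            π.character (List.ofFn fun i => a i ^ 2).prod) := by
          simp only [e1, ← Finset.mul_sum]; ring
      _ = _ := by rw [e2]; ring
  have h3 : ∀ π : Irr G, (π.dim : ℂ) * ∑ a : Fin g → G, ∑ k : Fin r → G,
      (∏ j, w j (k j)) *
        π.character ((List.ofFn fun i => a i ^ 2).prod * (List.ofFn k).prod⁻¹) =
      if π.frobeniusSchur ≠ 0 then (Nat.card G : ℂ) ^ g *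
        (∏ j, (Nat.card (conjugatesOf (γ j)) : ℂ)) *
          ((π.frobeniusSchur * (π.dim : ℂ)) ^ (2 - (g : ℤ)) *
            ((∏ j, π.character (γ j)) / (π.dim : ℂ) ^ r)) else 0 := fun π => by
    have hd := π.dim_ne_zero
    have h4 := h2 π
    split_ifs with hν
    -- A nonzero indicator makes the character invariant under inversion, so γ_j and γ_j⁻¹
    -- contribute equally.
    · have hr := (π.frobeniusSchur_ne_zero_iff.1 hν).2
      have hγ' : ∀ j, π.character (γ' j)⁻¹ = π.character (γ j) := fun j => by
        rw [hr]
        rcases hγ j with h | h <;> rw [h]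
        exact hr _
      simp only [hγ', Finset.prod_mul_distrib] at h4
      rw [mul_zpow, π.zpow_frobeniusSchur hν, zpow_sub₀ hd, zpow_natCast,
        ← mul_right_inj' (pow_ne_zero (g + r) hd)]
      calc _ = (π.dim : ℂ) * ((π.dim : ℂ) ^ (g + r) * ∑ a : Fin g → G, ∑ k : Fin r → G,
            (∏ j, w j (k j)) *
            π.character ((List.ofFn fun i => a i ^ 2).prod * (List.ofFn k).prod⁻¹)) := by ring
        _ = _ := by
          rw [h4]
          rw [zpow_ofNat]
          field_simp
          ring
    · rw [not_not] at hν
      -- Here g ≥ 1 is essential: at least one square contributes a factor ν₂(π) = 0.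
      rw [hν, mul_zero, zero_pow (by omega), zero_mul, zero_mul, mul_eq_zero] at h4
      rw [h4.resolve_left (pow_ne_zero _ hd), mul_zero]
  have h5 : (Nat.card {p : (Fin g → G) × (Fin r → G) // (∀ j, p.2 j ∈ conjugatesOf (γ' j)) ∧
        (List.ofFn fun i => p.1 i ^ 2).prod = (List.ofFn p.2).prod} : ℂ) * Nat.card G =
      (Nat.card G : ℂ) ^ g * (∏ j, (Nat.card (conjugatesOf (γ j)) : ℂ)) *
        ∑ π : {π : Irr G // π.frobeniusSchur ≠ 0},
          (π.1.frobeniusSchur * (π.1.dim : ℂ)) ^ (2 - (g : ℤ)) *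
            ((∏ j, π.1.character (γ j)) / (π.1.dim : ℂ) ^ r) := by
    rw [h1, Finset.mul_sum]
    have : ∑ a : Fin g → G, ∑ k : Fin r → G, (∏ j, w j (k j)) * ∑ π : Irr G, (π.dim : ℂ) *
        π.character ((List.ofFn fun i => a i ^ 2).prod * (List.ofFn k).prod⁻¹) =
        ∑ π : Irr G, (π.dim : ℂ) * ∑ a : Fin g → G, ∑ k : Fin r → G, (∏ j, w j (k j)) *
          π.character ((List.ofFn fun i => a i ^ 2).prod * (List.ofFn k).prod⁻¹) := by
      simp only [Finset.mul_sum]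
      simp only [Finset.sum_comm (s := (Finset.univ : Finset (Fin r → G)))
        (t := (Finset.univ : Finset (Irr G)))]
      rw [Finset.sum_comm]
      exact Finset.sum_congr rfl fun _ _ => Finset.sum_congr rfl fun _ _ =>
        Finset.sum_congr rfl fun _ _ => by ring
    rw [this]
    simp only [h3]
    rw [← Finset.sum_filter]
    exact Finset.sum_subtype _ (fun π => by simp) _
  rw [neg_sub, zpow_sub₀ hG, zpow_natCast, zpow_ofNat,
    div_eq_iff hG, ← mul_left_inj' hG, h5]
  field_simp

end Characters

/-! ## Holonomy functions and their local frames -/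

section LocalFrames

open Topology unitInterval

variable {X G : Type*} [TopologicalSpace X] [Group G]

/-- A homotopy invariant multiplicative function on paths, that is, a functor from the fundamental
groupoid to a group. -/
structure Hol (X G : Type*) [TopologicalSpace X] [Group G] where
  val : ∀ {x y : X}, Path x y → G
  val_trans : ∀ {x y z : X} (p : Path x y) (q : Path y z), val (p.trans q) = val p * val q
  val_congr : ∀ {x y : X} {p q : Path x y}, p.Homotopic q → val p = val q

namespace Hol

variable (h h' : Hol X G)

@[simp]
theorem val_refl (x : X) : h.val (Path.refl x) = 1 := by
  have h1 := h.val_trans (Path.refl x) (Path.refl x)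
  rw [Path.refl_trans_refl] at h1
  exact (mul_eq_left.1 h1.symm)

theorem val_symm {x y : X} (p : Path x y) : h.val p.symm = (h.val p)⁻¹ := by
  rw [eq_inv_iff_mul_eq_one, ← h.val_trans, ← h.val_refl y]
  exact h.val_congr ⟨(Path.Homotopy.reflSymmTrans p).symm⟩

theorem val_cast {x y x' y' : X} (p : Path x y) (hx : x' = x) (hy : y' = y) :
    h.val (p.cast hx hy) = h.val p := by
  subst hx hy
  rfl

theorem val_subpath_mul {x y : X} (p : Path x y) (s t u : I) :
    h.val (p.subpath s t) * h.val (p.subpath t u) = h.val (p.subpath s u) := by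
  rw [← h.val_trans]
  exact h.val_congr ⟨Path.Homotopy.subpathTransSubpath p s t u⟩

theorem val_subpath_zero_one {x y : X} (p : Path x y) : h.val (p.subpath 0 1) = h.val p := by
  rw [Path.subpath_zero_one]
  exact h.val_cast _ _ _

/-- A frame over `U`: the values on paths inside `U` are differences of the function `l`. -/
def IsFrame (U : Set X) (l : X → G) : Prop :=
  ∀ ⦃x y : X⦄ (p : Path x y), (∀ t, p t ∈ U) → h.val p = (l x)⁻¹ * l y

variable {h h'}

/-- The frame at y is the holonomy along a path in U from a fixed point to y; simple connectedness
makes it independent of the path. Off U the value 1 is a placeholder. -/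
theorem exists_isFrame (h : Hol X G) (U : Set X) [SimplyConnectedSpace U] :
    ∃ l, h.IsFrame U l := by
  classical
  obtain ⟨u₀⟩ : Nonempty U := inferInstance
  let l : X → G := fun y => if hy : y ∈ U then
    h.val ((PathConnectedSpace.somePath u₀ ⟨y, hy⟩).map continuous_subtype_val) else 1
  refine ⟨l, fun x y p hp => ?_⟩
  have hx : x ∈ U := by simpa using hp 0
  have hy : y ∈ U := by simpa using hp 1
  let p' : Path (⟨x, hx⟩ : U) ⟨y, hy⟩ :=
    { toFun := fun t => ⟨p t, hp t⟩
      continuous_toFun := p.continuous.subtype_mk _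
      source' := Subtype.ext p.source
      target' := Subtype.ext p.target }
  have hp' : p'.map continuous_subtype_val = p := by ext t; rfl
  have h1 : ((PathConnectedSpace.somePath u₀ ⟨x, hx⟩).trans p').Homotopic
      (PathConnectedSpace.somePath u₀ ⟨y, hy⟩) := SimplyConnectedSpace.paths_homotopic _ _
  have h2 := h.val_congr (h1.map ⟨Subtype.val, continuous_subtype_val⟩)
  have h3 : h.val ((PathConnectedSpace.somePath u₀ ⟨x, hx⟩).map continuous_subtype_val) * h.val p =
      h.val ((PathConnectedSpace.somePath u₀ ⟨y, hy⟩).map continuous_subtype_val) := by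
    rw [← h.val_trans]
    conv_lhs => rw [← hp']
    rw [← Path.map_trans]
    exact h2
  simp only [l, dif_pos hx, dif_pos hy]
  rw [← h3, inv_mul_cancel_left]

theorem IsFrame.const_mul {U : Set X} {l : X → G} (hl : h.IsFrame U l) (c : G) :
    h.IsFrame U fun x => c * l x := fun x y p hp => by
  rw [hl p hp]; group

/-- Both frames have the same differences l(x)⁻¹ l(y), so l' l⁻¹ is constant along paths inside U.
-/
theorem IsFrame.exists_eq_mul {U : Set X} {l l' : X → G} (hl : h.IsFrame U l)
    (hl' : h.IsFrame U l') (hU : IsPathConnected U) : ∃ c, ∀ x ∈ U, l' x = c * l x := by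
  obtain ⟨u, hu, hU⟩ := hU
  refine ⟨l' u * (l u)⁻¹, fun x hx => ?_⟩
  obtain ⟨p, hp⟩ := hU hx
  have h1 := hl p hp
  rw [hl' p hp] at h1
  rw [mul_assoc, ← h1, mul_inv_cancel_left]

/-- The transition function of two frames is constant along connected subsets of the overlap. -/
theorem IsFrame.transition_eq {U V : Set X} {l m : X → G} (hl : h.IsFrame U l)
    (hm : h.IsFrame V m) {E : Type*} [TopologicalSpace E] {S : Set E} (hS : IsPathConnected S)
    {f : E → X} (hf : ContinuousOn f S) (hfU : ∀ s ∈ S, f s ∈ U) (hfV : ∀ s ∈ S, f s ∈ V)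
    {s t : E} (hs : s ∈ S) (ht : t ∈ S) :
    l (f s) * (m (f s))⁻¹ = l (f t) * (m (f t))⁻¹ := by
  obtain ⟨p, hp⟩ := hS.joinedIn s hs t ht
  let q : Path (f s) (f t) := p.map' (hf.mono (by rintro _ ⟨u, rfl⟩; exact hp u))
  have h1 := hl q fun u => hfU _ (hp u)
  rw [hm q fun u => hfV _ (hp u)] at h1
  calc _ = l (f s) * ((m (f s))⁻¹ * m (f t)) * (m (f t))⁻¹ := by group
    _ = _ := by rw [h1]; group

/-- Holonomy functions with frames over an open cover that have the same transition functions
are equivalent. -/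
theorem frame_mul_val_eq {ι : Type*} {U : ι → Set X} (hU : ∀ i, IsOpen (U i))
    (hcov : ∀ x, ∃ i, x ∈ U i) {l l' : ι → X → G} (hl : ∀ i, h.IsFrame (U i) (l i))
    (hl' : ∀ i, h'.IsFrame (U i) (l' i))
    (htr : ∀ i j, ∀ x ∈ U i, x ∈ U j → l i x * (l j x)⁻¹ = l' i x * (l' j x)⁻¹)
    {x y : X} (p : Path x y) {i j : ι} (hx : x ∈ U i) (hy : y ∈ U j) :
    l i x * h.val p * (l j y)⁻¹ = l' i x * h'.val p * (l' j y)⁻¹ := by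
  choose idx hidx using hcov
  -- The candidate for an isomorphism of the two bundles; equality of the transition functions makes
  -- it independent of the chart.
  let β : X → G := fun x => (l (idx x) x)⁻¹ * l' (idx x) x
  have hβ : ∀ i, ∀ x ∈ U i, β x = (l i x)⁻¹ * l' i x := fun i x hx => by
    have h1 := htr i (idx x) x hx (hidx x)
    calc β x = (l i x)⁻¹ * (l i x * (l (idx x) x)⁻¹) * l' (idx x) x := by simp only [β]; group
      _ = _ := by rw [h1]; group
  -- Transport to time t with h, comparison by β, and transport back with h'. This is locally
  -- constant on the interval, and equality of its end values says that β intertwines the two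
  -- holonomies along p.
  let φ : I → G := fun t => h.val (p.subpath 0 t) * β (p t) * (h'.val (p.subpath 0 t))⁻¹
  have hφ : IsLocallyConstant φ := by
    rw [IsLocallyConstant.iff_eventually_eq]
    intro t₀
    have h1 : ∀ᶠ t in 𝓝 t₀, p t ∈ U (idx (p t₀)) :=
      p.continuous.continuousAt ((hU _).mem_nhds (hidx (p t₀)))
    have h2 : ∀ᶠ t in 𝓝 t₀, ∀ s ∈ Set.uIcc t₀ t, p s ∈ U (idx (p t₀)) :=
      ((tendsto_const_nhds (x := t₀)).uIcc Filter.tendsto_id).eventually h1.smallSets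
    filter_upwards [h2] with t ht
    have h3 : ∀ s, p.subpath t₀ t s ∈ U (idx (p t₀)) := fun s => by
      have h4 : p.subpath t₀ t s ∈ Set.range (p.subpath t₀ t) := ⟨s, rfl⟩
      rw [Path.range_subpath] at h4
      obtain ⟨u, hu, hu'⟩ := h4
      rw [← hu']
      exact ht u hu
    simp only [φ]
    rw [← h.val_subpath_mul p 0 t₀ t, ← h'.val_subpath_mul p 0 t₀ t,
      hl _ (p.subpath t₀ t) h3, hl' _ (p.subpath t₀ t) h3,
      hβ _ _ (ht t Set.right_mem_uIcc), hβ _ _ (ht t₀ Set.left_mem_uIcc)]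
    group
  have h1 : φ 0 = φ 1 := hφ.apply_eq_of_preconnectedSpace 0 1
  simp only [φ, val_subpath_zero_one, Path.subpath_self, val_refl, Path.source, Path.target,
    inv_one, one_mul, mul_one, hβ i x hx, hβ j y hy] at h1
  calc _ = l i x * (h.val p * ((l j y)⁻¹ * l' j y) * (h'.val p)⁻¹) * h'.val p * (l' j y)⁻¹ := by
        group
    _ = _ := by rw [← h1]; group

/-- With a chosen path q_x from y₀ to each x, the change of gauge is h(q_x)⁻¹ h'(q_x); the loop q_x
p q_y⁻¹ reduces every path to the hypothesis. -/
theorem exists_gauge [PathConnectedSpace X] (y₀ : X)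
    (hloop : ∀ p : Path y₀ y₀, h.val p = h'.val p) :
    ∃ b : X → G, b y₀ = 1 ∧ ∀ {x y : X} (p : Path x y), h.val p = b x * h'.val p * (b y)⁻¹ := by
  let q : ∀ x, Path y₀ x := fun x => PathConnectedSpace.somePath y₀ x
  refine ⟨fun x => (h.val (q x))⁻¹ * h'.val (q x), by simp [hloop], fun {x y} p => ?_⟩
  have h1 := hloop (((q x).trans p).trans (q y).symm)
  simp only [val_trans, val_symm] at h1
  calc h.val p = (h.val (q x))⁻¹ * (h.val (q x) * h.val p * (h.val (q y))⁻¹) * h.val (q y) := by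
        group
    _ = _ := by rw [h1]; group

end Hol

/-! ### Holonomy of the covering space defined by a cocycle -/

section Cocycle

variable {ι : Type*}

/-- The covering space glued from copies of `G` by a locally constant cocycle. -/
def cocycleBundle [TopologicalSpace G] [DiscreteTopology G] (U : ι → Set X)
    (hU : ∀ i, IsOpen (U i)) (idx : X → ι)
    (hidx : ∀ x, x ∈ U (idx x)) (c : ι → ι → X → G)
    (hself : ∀ i, ∀ x ∈ U i, c i i x = 1)
    (hc : ∀ i j k, ∀ x, x ∈ U i → x ∈ U j → x ∈ U k → c i j x * c j k x = c i k x)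
    (hcont : ∀ i j, ContinuousOn (c i j) (U i ∩ U j)) : FiberBundleCore ι X G where
  baseSet := U
  isOpen_baseSet := hU
  indexAt := idx
  mem_baseSet_at := hidx
  coordChange i j x v := v * c i j x
  coordChange_self i x hx v := by rw [hself i x hx, mul_one]
  continuousOn_coordChange i j :=
    continuousOn_snd.mul ((hcont i j).comp continuousOn_fst fun _ hp => hp.1)
  coordChange_comp i j k x hx v := by
    rw [mul_assoc, hc i j k x hx.1.1 hx.1.2 hx.2]

/-- Paths are lifted to the covering space with discrete fibre G, and the holonomy is the end value
of the lift starting at 1. The fibre over x is identified with G through the chart `idx x`, which is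
why the frame of that chart equals 1 at x. -/
theorem exists_hol_of_cocycle (U : ι → Set X) (hU : ∀ i, IsOpen (U i)) (idx : X → ι)
    (hidx : ∀ x, x ∈ U (idx x)) (c : ι → ι → X → G)
    (hc : ∀ i j k, ∀ x, x ∈ U i → x ∈ U j → x ∈ U k → c i j x * c j k x = c i k x)
    (hcont : ∀ i j, ∀ x ∈ U i ∩ U j, ∀ᶠ y in 𝓝 x, c i j y = c i j x) :
    ∃ (h : Hol X G) (l : ι → X → G), (∀ i, h.IsFrame (U i) (l i)) ∧
      (∀ i j, ∀ x ∈ U i, x ∈ U j → l i x * (l j x)⁻¹ = c i j x) ∧ ∀ x, l (idx x) x = 1 := by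
  let _ : TopologicalSpace G := ⊥
  have : DiscreteTopology G := ⟨rfl⟩
  have hself : ∀ i, ∀ x ∈ U i, c i i x = 1 := fun i x hx =>
    mul_eq_left.1 (hc i i i x hx hx hx)
  let Z := cocycleBundle U hU idx hidx c hself hc fun i j x hx =>
    (continuousAt_const.congr ((hcont i j x hx).mono fun y hy => hy.symm)).continuousWithinAt
  have hcov : IsCoveringMap Z.proj := FiberBundle.isCoveringMap (F := G) (E := Z.Fiber)
  let pt : X → G → Z.TotalSpace := fun x v => ⟨x, v⟩
  let snd : Z.TotalSpace → G := fun e => e.2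
  have htriv : ∀ i e, Z.localTriv i e = (e.1, snd e * c (idx e.1) i e.1) := fun i e =>
    Z.localTriv_apply i e
  have hext : ∀ {e : Z.TotalSpace} {x v}, e.1 = x → snd e = v → e = pt x v := by
    rintro ⟨x, v⟩ _ _ rfl rfl; rfl
  have hmul : ∀ w, Continuous fun e : Z.TotalSpace => pt e.1 (w * snd e) := fun w => by
    rw [continuous_iff_continuousAt]
    intro e
    refine (Z.localTriv (idx e.1)).continuousAt_of_comp_left Z.continuous_proj.continuousAt
      (hidx e.1) ?_
    have h1 : Z.localTriv (idx e.1) ∘ (fun e : Z.TotalSpace => pt e.1 (w * snd e)) =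
        Prod.map id (w * ·) ∘ Z.localTriv (idx e.1) := by
      funext e'
      simp only [Function.comp_apply, htriv, Prod.map_apply, id]
      exact Prod.ext rfl (mul_assoc (G := G) _ _ _)
    rw [h1]
    refine ContinuousAt.comp (by fun_prop) ((Z.localTriv (idx e.1)).continuousAt ?_)
    exact (Z.localTriv (idx e.1)).mem_source.2 (hidx e.1)
  let lift : ∀ {x y : X} (p : Path x y) (v : G), C(I, Z.TotalSpace) := fun {x y} p v =>
    hcov.liftPath p.toContinuousMap (pt x v) p.source
  have hlift : ∀ {x y : X} (p : Path x y) (v : G) (Γ : I → Z.TotalSpace), Continuous Γ →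
      (∀ t, (Γ t).1 = p t) → Γ 0 = pt x v → Γ 1 = lift p v 1 := fun p v Γ h1 h2 h3 =>
    congrFun ((hcov.eq_liftPath_iff (γ := p.toContinuousMap) p.source).2 ⟨h1, funext h2, h3⟩) 1
  have hlift_fst : ∀ {x y : X} (p : Path x y) (v : G) (t : I), (lift p v t).1 = p t :=
    fun p v t => congrFun (hcov.liftPath_lifts p.toContinuousMap _ p.source) t
  have hlift_zero : ∀ {x y : X} (p : Path x y) (v : G), lift p v 0 = pt x v :=
    fun p v => hcov.liftPath_zero p.toContinuousMap _ p.source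
  -- The cocycle acts by right multiplication, so left translations are deck transformations and
  -- commute with lifting. This makes the holonomy multiplicative.
  have hlift_mul : ∀ {x y : X} (p : Path x y) (v : G), snd (lift p v 1) = v * snd (lift p 1 1) :=
    fun {x y} p v => by
      rw [← hlift p v (fun t => pt (lift p 1 t).1 (v * snd (lift p 1 t)))
        ((hmul v).comp (lift p 1).continuous) (fun t => hlift_fst p 1 t)
        (by simp only [hlift_zero]; simp [pt, snd])]
  have hlift_one : ∀ {x y : X} (p : Path x y) (v : G),
      lift p v 1 = pt y (v * snd (lift p 1 1)) := fun p v =>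
    hext ((hlift_fst p v 1).trans p.target) (hlift_mul p v)
  let h : Hol X G :=
    { val := fun p => snd (lift p 1 1)
      val_trans := fun {x y z} p q => by
        have h1 := congrArg (fun Γ : C(I, Z.TotalSpace) => Γ 1)
          (hcov.liftPath_trans (e := pt x 1) rfl p q)
        rw [← hlift_mul q]
        refine congrArg snd (h1.trans ?_)
        refine (Path.target _).trans ?_
        have h2 : hcov.liftPath p.toContinuousMap (pt x 1) p.source 1 =
          pt y (snd (lift p 1 1)) := by simpa using hlift_one p 1
        have h3 : ∀ e e' : Z.TotalSpace, e = e' → ∀ (h₁ : q.toContinuousMap 0 = Z.proj e)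
            (h₂ : q.toContinuousMap 0 = Z.proj e'),
            hcov.liftPath q.toContinuousMap e h₁ 1 = hcov.liftPath q.toContinuousMap e' h₂ 1 := by
          rintro _ _ rfl _ _; rfl
        exact h3 _ _ h2 _ _
      val_congr := fun {x y p q} hpq =>
        congrArg snd (hcov.liftPath_apply_one_eq_of_homotopicRel hpq _ p.source q.source) }
  refine ⟨h, fun i x => c i (idx x) x, fun i x y p hp => ?_, fun i j x hi hj => ?_, fun x =>
    hself _ _ (hidx x)⟩
  · have hx : x ∈ U i := by simpa using hp 0
    have hinv : ∀ i j x, x ∈ U i → x ∈ U j → (c i j x)⁻¹ = c j i x := fun i j x hi hj => by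
      rw [inv_eq_iff_mul_eq_one, hc i j i x hi hj hi, hself i x hi]
    -- In the trivialization over U i this lift has constant second coordinate, and it starts at 1.
    let Γ : I → Z.TotalSpace := fun t => pt (p t) ((c i (idx x) x)⁻¹ * c i (idx (p t)) (p t))
    have hΓ : Continuous Γ := by
      rw [continuous_iff_continuousAt]
      intro t
      refine (Z.localTriv i).continuousAt_of_comp_left p.continuous.continuousAt (hp t) ?_
      have h1 : Z.localTriv i ∘ Γ = fun t => (p t, (c i (idx x) x)⁻¹) := by
        funext t
        simp only [Function.comp_apply, htriv, Γ, pt, snd, mul_assoc]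
        rw [hc i _ i _ (hp t) (hidx _) (hp t), hself i _ (hp t), mul_one]
      rw [h1]
      fun_prop
    have h1 := hlift p 1 Γ hΓ (fun _ => rfl) (by
      refine hext p.source ?_
      simp only [Γ, pt, snd, Path.source, inv_mul_cancel])
    change snd (lift p 1 1) = _
    rw [← h1]
    simp [Γ, pt, snd]
  · have h1 := hc j (idx x) j x hj (hidx x) hj
    rw [hself j x hj] at h1
    rw [inv_eq_of_mul_eq_one_right h1, hc i (idx x) j x hi (hidx x) hj]

end Cocycle

end LocalFrames

/-! ## The holed surface as a quotient of a holed disc -/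

section Surface

open Topology

variable (g r : ℕ)

/-- The closed disc without the holes. -/
def holedDisc : Set ℂ := {z | ‖z‖ ≤ 1 ∧ ∀ j : Fin r, holeRadius r ≤ dist z (holeCenter j : ℂ)}

/-- Points of modulus larger than this number lie outside the holes. -/
noncomputable def innerRadius : ℝ := r / (r + 1)

theorem innerRadius_nonneg : 0 ≤ innerRadius r := by unfold innerRadius; positivity

theorem innerRadius_lt_one : innerRadius r < 1 := by
  unfold innerRadius; rw [div_lt_one (by positivity)]; linarith

variable {r} in
theorem abs_holeCenter_add_lt_innerRadius (j : Fin r) :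
    |holeCenter j| + holeRadius r < innerRadius r := by
  have hj : ((j : ℕ) : ℝ) + 1 ≤ r := by exact_mod_cast j.2
  have hr : (0 : ℝ) < r + 1 := by positivity
  have hj0 : (0 : ℝ) ≤ ((j : ℕ) : ℝ) := by positivity
  unfold holeCenter holeRadius innerRadius
  rw [abs_div, abs_of_pos hr]
  have h1 : |2 * ((j : ℕ) : ℝ) + 1 - r| ≤ r - 1 := abs_le.2 ⟨by linarith, by linarith⟩
  have h2 : 1 / (2 * ((r : ℝ) + 1)) = (1 / 2) / (r + 1) := by field_simp
  rw [h2, ← add_div]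
  gcongr
  linarith

variable {r} in
theorem norm_lt_innerRadius {j : Fin r} {z : ℂ} (h : dist z (holeCenter j : ℂ) ≤ holeRadius r) :
    ‖z‖ < innerRadius r := by
  have h1 : ‖z‖ ≤ dist z (holeCenter j : ℂ) + ‖(holeCenter j : ℂ)‖ := by
    rw [dist_eq_norm]; simpa using norm_add_le (z - holeCenter j) (holeCenter j : ℂ)
  rw [Complex.norm_real, Real.norm_eq_abs] at h1
  linarith [abs_holeCenter_add_lt_innerRadius j]

variable {r} in
theorem mem_holedDisc_of_innerRadius_lt {z : ℂ} (h : innerRadius r < ‖z‖) (h1 : ‖z‖ ≤ 1) :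
    z ∈ holedDisc r :=
  ⟨h1, fun _ => le_of_not_ge fun h2 => (norm_lt_innerRadius h2).not_gt h⟩

theorem one_mem_holedDisc : (1 : ℂ) ∈ holedDisc r :=
  mem_holedDisc_of_innerRadius_lt (by simpa using innerRadius_lt_one r) (by simp)

variable {g r}

theorem norm_lt_one_iff_of_mk_eq {z w : Disc}
    (h : Quot.mk (Glue g) z = Quot.mk (Glue g) w) : ‖(z : ℂ)‖ < 1 ↔ ‖(w : ℂ)‖ < 1 := by
  let f : ClosedSurface g → Prop := Quot.lift (fun u => ‖(u : ℂ)‖ < 1) (by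
    rintro _ _ ⟨k, s, -, rfl, rfl⟩
    simp [norm_bdryPoint])
  exact iff_of_eq (congrArg f h)

theorem mk_mem_hole_iff {z : Disc} {j : Fin r} :
    Quot.mk (Glue g) z ∈ hole g j ↔ dist (z : ℂ) (holeCenter j : ℂ) < holeRadius r := by
  constructor
  · rintro ⟨w, hw, h⟩
    have hw' : dist (w : ℂ) (holeCenter j : ℂ) < holeRadius r := hw
    have h1 : ‖(w : ℂ)‖ < 1 := norm_lt_one_of_dist_le hw'.le
    rw [← eq_of_mk_eq h1 ((norm_lt_one_iff_of_mk_eq h).1 h1) h]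
    exact hw'
  · exact fun h => ⟨z, h, rfl⟩

variable (g r) in
/-- The quotient map from the holed disc to the holed surface. -/
def quotMap (z : holedDisc r) : HoledSurface g r :=
  ⟨Quot.mk (Glue g) ⟨z, mem_closedBall_zero_iff.2 z.2.1⟩, by
    simp only [Set.mem_iUnion, mk_mem_hole_iff, not_exists, not_lt]
    exact z.2.2⟩

/-- A restriction of a quotient map need not be one. Here an open set of the holed disc is enlarged
by the open holes, which lie away from the gluing, to the preimage of an open set of the closed
surface. -/
theorem isQuotientMap_quotMap : IsQuotientMap (quotMap g r) := by
  have hcont : Continuous (quotMap g r) :=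
    (continuous_quot_mk.comp (continuous_subtype_val.subtype_mk _)).subtype_mk _
  refine (isQuotientMap_iff _).2 ⟨isCoinducing_iff.2 fun s =>
    ⟨fun hs => ?_, fun hs => hs.preimage hcont⟩, ?_⟩
  swap
  · rintro ⟨p, hp⟩
    obtain ⟨z, rfl⟩ := Quot.exists_rep p
    simp only [Set.mem_iUnion, mk_mem_hole_iff, not_exists, not_lt] at hp
    exact ⟨⟨z, mem_closedBall_zero_iff.1 z.2, hp⟩, rfl⟩
  · obtain ⟨O, hO, hOs⟩ := isOpen_induced_iff.1 hs
    -- Points of the holes belong to S vacuously.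
    let S : Set (ClosedSurface g) := {p | ∀ h : p ∉ ⋃ j : Fin r, hole g j, (⟨p, h⟩ : HoledSurface g r) ∈ s}
    have hS : Quot.mk (Glue g) ⁻¹' S = Subtype.val ⁻¹'
        (O ∪ ⋃ j : Fin r, Metric.ball (holeCenter j : ℂ) (holeRadius r)) := by
      ext z
      by_cases hz : ∃ j : Fin r, dist (z : ℂ) (holeCenter j : ℂ) < holeRadius r
      · have h1 : Quot.mk (Glue g) z ∈ ⋃ j : Fin r, hole g j := by
          simpa only [Set.mem_iUnion, mk_mem_hole_iff] using hz
        have h2 : Quot.mk (Glue g) z ∈ S := fun h => absurd h1 h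
        simp only [Set.mem_preimage, h2, true_iff]
        exact Or.inr (Set.mem_iUnion.2 hz)
      · have h1 : Quot.mk (Glue g) z ∉ ⋃ j : Fin r, hole g j := by
          simpa only [Set.mem_iUnion, mk_mem_hole_iff] using hz
        have hz' : (z : ℂ) ∈ holedDisc r :=
          ⟨mem_closedBall_zero_iff.1 z.2, by simpa using hz⟩
        have h2 : (⟨z, hz'⟩ : holedDisc r) ∈ Subtype.val ⁻¹' O ↔
          (⟨z, hz'⟩ : holedDisc r) ∈ quotMap g r ⁻¹' s := by rw [hOs]
        have h3 : (z : ℂ) ∉ ⋃ j : Fin r, Metric.ball (holeCenter j : ℂ) (holeRadius r) := by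
          simpa only [Set.mem_iUnion, Metric.mem_ball] using hz
        simp only [Set.mem_preimage, Set.mem_union, h3, or_false] at h2 ⊢
        rw [h2]
        exact ⟨fun h => h h1, fun h _ => h⟩
    have hSo : IsOpen S := by
      rw [← isQuotientMap_quot_mk.isOpen_preimage, hS]
      exact (hO.union (isOpen_iUnion fun _ => Metric.isOpen_ball)).preimage continuous_subtype_val
    have : s = Subtype.val ⁻¹' S := by
      ext p
      exact ⟨fun h _ => h, fun h => h p.2⟩
    rw [this]
    exact hSo.preimage continuous_subtype_val

open scoped Classical in
variable (g r) in
/-- The point of the surface represented by a point of the holed disc. -/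
noncomputable def pt (z : ℂ) : HoledSurface g r :=
  if h : z ∈ holedDisc r then quotMap g r ⟨z, h⟩ else quotMap g r ⟨1, one_mem_holedDisc r⟩

theorem pt_of_mem {z : ℂ} (h : z ∈ holedDisc r) : pt g r z = quotMap g r ⟨z, h⟩ := dif_pos h

theorem domRestrict_pt : (holedDisc r).domRestrict (pt g r) = quotMap g r :=
  funext fun z => pt_of_mem z.2

theorem isQuotientMap_domRestrict_pt : IsQuotientMap ((holedDisc r).domRestrict (pt g r)) := by
  rw [domRestrict_pt]; exact isQuotientMap_quotMap

theorem continuousOn_pt : ContinuousOn (pt g r) (holedDisc r) :=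
  continuousOn_iff_continuous_domRestrict.2 isQuotientMap_domRestrict_pt.continuous

theorem exists_pt_eq (p : HoledSurface g r) : ∃ z ∈ holedDisc r, pt g r z = p := by
  obtain ⟨z, hz⟩ := isQuotientMap_domRestrict_pt.surjective p
  exact ⟨z, z.2, hz⟩

/-! ### Polar coordinates -/

variable (g) in
/-- Polar coordinates in which the corners of the polygon have integral angle. -/
noncomputable def polar (s t : ℝ) : ℂ := s * Complex.exp ((Real.pi * t / g : ℝ) * Complex.I)

variable (g) in
/-- The angle of a point, in `(0, 2 g]`. -/
noncomputable def ang (z : ℂ) : ℝ := g * ((-z).arg / Real.pi + 1)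

theorem continuous_polar : Continuous fun p : ℝ × ℝ => polar g p.1 p.2 := by
  unfold polar; fun_prop

theorem norm_polar {s : ℝ} (hs : 0 ≤ s) (t : ℝ) : ‖polar g s t‖ = s := by
  rw [polar, norm_mul, Complex.norm_exp_ofReal_mul_I, mul_one, Complex.norm_real,
    Real.norm_of_nonneg hs]

theorem polar_ang (hg : 1 ≤ g) (z : ℂ) : polar g ‖z‖ (ang g z) = z := by
  have hg' : (g : ℝ) ≠ 0 := by positivity
  have h1 : Real.pi * ang g z / g = (-z).arg + Real.pi := by
    unfold ang; field_simp
  rw [polar, h1]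
  push_cast
  rw [add_mul, Complex.exp_add, Complex.exp_pi_mul_I, mul_neg_one, mul_neg, ← norm_neg z,
    Complex.norm_mul_exp_arg_mul_I, neg_neg]

theorem ang_polar (hg : 1 ≤ g) {s t : ℝ} (hs : 0 < s) (ht : 0 < t) (ht' : t ≤ 2 * g) :
    ang g (polar g s t) = t := by
  have hg' : (0 : ℝ) < g := by positivity
  have h1 : -polar g s t = s * Complex.exp ((Real.pi * t / g - Real.pi : ℝ) * Complex.I) := by
    rw [polar]
    push_cast
    rw [sub_mul, Complex.exp_sub, Complex.exp_pi_mul_I]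
    ring
  have h2 : (-polar g s t).arg = Real.pi * t / g - Real.pi := by
    rw [h1, Complex.arg_real_mul _ hs, Complex.arg_exp_mul_I, toIocMod_eq_self]
    constructor
    · have : 0 < Real.pi * t / g := by positivity
      linarith
    · have : Real.pi * t / g ≤ 2 * Real.pi := by
        rw [div_le_iff₀ hg']; nlinarith [Real.pi_pos]
      linarith
  rw [ang, h2]
  field_simp
  ring

theorem ang_pos (hg : 1 ≤ g) (z : ℂ) : 0 < ang g z := by
  have hg' : (0 : ℝ) < g := by positivity
  have := Complex.neg_pi_lt_arg (-z)
  have h2 : -1 < (-z).arg / Real.pi := by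
    rw [lt_div_iff₀ Real.pi_pos]; linarith
  exact mul_pos hg' (by linarith)

theorem ang_le (z : ℂ) : ang g z ≤ 2 * g := by
  have h2 : (-z).arg / Real.pi ≤ 1 := by
    rw [div_le_iff₀ Real.pi_pos]; linarith [Complex.arg_le_pi (-z)]
  have : (g : ℝ) * ((-z).arg / Real.pi + 1) ≤ g * 2 := by gcongr; linarith
  unfold ang; linarith

theorem continuousAt_ang {z : ℂ} (hz : -z ∈ Complex.slitPlane) : ContinuousAt (ang g) z := by
  have h1 : ContinuousAt (fun z : ℂ => (-z).arg) z :=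
    ContinuousAt.comp (f := fun z : ℂ => -z) (g := Complex.arg)
      (Complex.continuousAt_arg hz) continuous_neg.continuousAt
  unfold ang
  exact continuousAt_const.mul ((h1.div_const _).add continuousAt_const)

theorem coe_bdryPoint (t : ℝ) (hg : 1 ≤ g) : (bdryPoint (t / (2 * g)) : ℂ) = polar g 1 t := by
  have hg' : (g : ℝ) ≠ 0 := by positivity
  change Complex.exp _ = _
  rw [polar, Complex.ofReal_one, one_mul]
  congr 3
  field_simp

/-- The power 2g turns a unit of angle into a full turn: rays through the corners go to the positive
real axis, rays through the midpoints of the edges to the negative one. -/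
theorem polar_pow (hg : 1 ≤ g) (s t : ℝ) :
    polar g s t ^ (2 * g) = (s : ℂ) ^ (2 * g) * Complex.exp ((2 * Real.pi * t : ℝ) * Complex.I) := by
  have hg' : (g : ℂ) ≠ 0 := by exact_mod_cast (by omega : g ≠ 0)
  rw [polar, mul_pow, ← Complex.exp_nat_mul]
  congr 2
  push_cast
  field_simp

/-! ### Gluing -/

variable (g) in
/-- A set of points of the plane is compatible with the gluing of the boundary of the polygon. -/
def Saturated (S : Set ℂ) : Prop :=
  ∀ k : Fin g, ∀ s ∈ Set.Icc (0 : ℝ) 1,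
    polar g 1 (2 * (k : ℕ) + s) ∈ S ↔ polar g 1 (2 * (k : ℕ) + 1 + s) ∈ S

theorem Saturated.inter {S T : Set ℂ} (hS : Saturated g S) (hT : Saturated g T) :
    Saturated g (S ∩ T) := fun k s hs => and_congr (hS k s hs) (hT k s hs)

theorem pt_glue (hg : 1 ≤ g) (k : Fin g) {s : ℝ} (hs : s ∈ Set.Icc (0 : ℝ) 1) :
    pt g r (polar g 1 (2 * (k : ℕ) + s)) = pt g r (polar g 1 (2 * (k : ℕ) + 1 + s)) := by
  have h1 : ∀ t, polar g 1 t ∈ holedDisc r := fun t =>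
    mem_holedDisc_of_innerRadius_lt (by rw [norm_polar zero_le_one]; exact innerRadius_lt_one r)
      (by rw [norm_polar zero_le_one])
  rw [pt_of_mem (h1 _), pt_of_mem (h1 _)]
  refine Subtype.ext (Quot.sound ⟨k, s, hs, Subtype.ext ?_, Subtype.ext ?_⟩)
  · exact (coe_bdryPoint _ hg).symm
  · exact (coe_bdryPoint _ hg).symm

open scoped Classical in
/-- Functions compatible with the gluing descend to the surface. -/
theorem eq_of_pt_eq (hg : 1 ≤ g) {Y : Type*} {S : Set ℂ} (hS : Saturated g S) (F : ℂ → Y)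
    (hF : ∀ k : Fin g, ∀ s ∈ Set.Icc (0 : ℝ) 1, polar g 1 (2 * (k : ℕ) + s) ∈ S →
      polar g 1 (2 * (k : ℕ) + 1 + s) ∈ S →
      F (polar g 1 (2 * (k : ℕ) + s)) = F (polar g 1 (2 * (k : ℕ) + 1 + s)))
    {z w : ℂ} (hz : z ∈ holedDisc r) (hw : w ∈ holedDisc r) (h : pt g r z = pt g r w) :
    (z ∈ S ↔ w ∈ S) ∧ (z ∈ S → F z = F w) := by
  -- One function on the quotient encodes both claims: `none` records that the point is outside S,
  -- `some` records the value of F.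
  let f : ClosedSurface g → Option Y :=
    Quot.lift (fun u => if (u : ℂ) ∈ S then some (F u) else none) (by
      rintro _ _ ⟨k, s, hs, rfl, rfl⟩
      simp only [coe_bdryPoint _ hg]
      by_cases h1 : polar g 1 (2 * (k : ℕ) + s) ∈ S
      · have h2 := (hS k s hs).1 h1
        rw [if_pos h1, if_pos h2, hF k s hs h1 h2]
      · rw [if_neg h1, if_neg (mt (hS k s hs).2 h1)])
  rw [pt_of_mem hz, pt_of_mem hw] at h
  have h1 : (if z ∈ S then some (F z) else none) = if w ∈ S then some (F w) else none :=
    congrArg f (congrArg Subtype.val h)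
  by_cases hzS : z ∈ S <;> by_cases hwS : w ∈ S <;> simp_all

variable (g r) in
/-- The part of the surface represented by a set of points of the plane. -/
def region (S : Set ℂ) : Set (HoledSurface g r) := pt g r '' (holedDisc r ∩ S)

theorem pt_mem_region_iff (hg : 1 ≤ g) {S : Set ℂ} (hS : Saturated g S) {z : ℂ}
    (hz : z ∈ holedDisc r) : pt g r z ∈ region g r S ↔ z ∈ S := by
  constructor
  · rintro ⟨w, ⟨hw, hwS⟩, h⟩
    exact ((eq_of_pt_eq hg hS (fun _ => ()) (fun _ _ _ _ _ => rfl) hz hw h.symm).1).2 hwS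
  · exact fun h => ⟨z, ⟨hz, h⟩, rfl⟩

theorem isOpen_region (hg : 1 ≤ g) {S : Set ℂ} (hS : Saturated g S) (ho : IsOpen S) :
    IsOpen (region g r S) := by
  rw [← isQuotientMap_domRestrict_pt.isOpen_preimage]
  convert ho.preimage continuous_subtype_val using 1
  ext z
  exact pt_mem_region_iff hg hS z.2

end Surface

/-! ## Charts of the holed surface -/

section Charts

open Topology unitInterval

variable {g r : ℕ}

/-- A deformation of a region of the plane that is compatible with the gluing and contracts the
corresponding region of the surface. -/
theorem contractibleSpace_region (hg : 1 ≤ g) {S : Set ℂ} (hS : Saturated g S) (ho : IsOpen S)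
    (H : ℂ → ℝ → ℂ) (hH : ContinuousOn (Function.uncurry H) ((holedDisc r ∩ S) ×ˢ Set.Icc 0 1))
    (hmem : ∀ z ∈ holedDisc r ∩ S, ∀ t ∈ Set.Icc (0 : ℝ) 1, H z t ∈ holedDisc r ∩ S)
    (h0 : ∀ z ∈ holedDisc r ∩ S, H z 0 = z) {z₀ : ℂ} (hz₀ : z₀ ∈ holedDisc r ∩ S)
    (h1 : ∀ z ∈ holedDisc r ∩ S, pt g r (H z 1) = pt g r z₀)
    (hglue : ∀ t ∈ Set.Icc (0 : ℝ) 1, ∀ k : Fin g, ∀ s ∈ Set.Icc (0 : ℝ) 1,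
      polar g 1 (2 * (k : ℕ) + s) ∈ S → polar g 1 (2 * (k : ℕ) + 1 + s) ∈ S →
      pt g r (H (polar g 1 (2 * (k : ℕ) + s)) t) = pt g r (H (polar g 1 (2 * (k : ℕ) + 1 + s)) t)) :
    ContractibleSpace (region g r S) := by
  have hq := isQuotientMap_domRestrict_pt.restrictPreimage_isOpen (isOpen_region (r := r) hg hS ho)
  have hwd : ∀ z ∈ holedDisc r ∩ S, ∀ w ∈ holedDisc r ∩ S, pt g r z = pt g r w →
      ∀ t ∈ Set.Icc (0 : ℝ) 1, pt g r (H z t) = pt g r (H w t) := fun z hz w hw h t ht =>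
    (eq_of_pt_eq hg hS (fun z => pt g r (H z t)) (hglue t ht) hz.1 hw.1 h).2 hz.2
  have hrep : ∀ p : region g r S, ∃ z ∈ holedDisc r ∩ S, pt g r z = p := fun p => p.2
  choose rep hrep hpt using hrep
  let F : region g r S × I → region g r S := fun p =>
    ⟨pt g r (H (rep p.1) p.2), _, hmem _ (hrep p.1) _ p.2.2, rfl⟩
  have hF : Continuous F := by
    -- The product of the restricted quotient map with the interval is still a quotient map, so
    -- continuity can be checked before gluing.
    refine hq.continuous_lift_prod_left (Continuous.subtype_mk (f := fun p => _) ?_ _)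
    have h2 : ∀ z : ((holedDisc r).domRestrict (pt g r) ⁻¹' region g r S), (z : ℂ) ∈ holedDisc r ∩ S :=
      fun z => ⟨z.1.2, (pt_mem_region_iff hg hS z.1.2).1 z.2⟩
    have h3 : (fun p : ((holedDisc r).domRestrict (pt g r) ⁻¹' region g r S) × I =>
        pt g r (H (rep ((region g r S).restrictPreimage
          ((holedDisc r).domRestrict (pt g r)) p.1)) p.2)) =
        fun p => pt g r (H (p.1 : ℂ) p.2) := funext fun p =>
      hwd _ (hrep _) _ (h2 p.1) (hpt _) _ p.2.2
    rw [h3]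
    refine continuousOn_pt.comp_continuous ?_ fun p => (hmem _ (h2 p.1) _ p.2.2).1
    exact hH.comp_continuous
      (f := fun p : ((holedDisc r).domRestrict (pt g r) ⁻¹' region g r S) × I =>
        (((p.1 : ℂ), (p.2 : ℝ)) : ℂ × ℝ)) (by fun_prop) fun p => ⟨h2 p.1, p.2.2⟩
  rw [contractible_iff_id_nullhomotopic]
  refine ⟨⟨pt g r z₀, z₀, hz₀, rfl⟩, ⟨⟨⟨fun p => F (p.2, p.1), by fun_prop⟩, ?_, ?_⟩⟩⟩
  · intro p
    refine Subtype.ext ?_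
    change pt g r (H (rep p) 0) = p
    rw [h0 _ (hrep p), hpt]
  · intro p
    exact Subtype.ext (h1 _ (hrep p))

/-! ### The retraction onto the complement of the holes -/

variable (r) in
/-- The open disc without the centres of the holes. -/
def puncturedDisc : Set ℂ := {z | ‖z‖ < 1 ∧ ∀ j : Fin r, z ≠ (holeCenter j : ℂ)}

variable (r) in
/-- The map pushing the punctured holes radially onto their boundary circles. -/
noncomputable def push (z : ℂ) : ℂ :=
  z + ∑ j : Fin r, ((max 0 (holeRadius r / ‖z - holeCenter j‖ - 1) : ℝ) : ℂ) * (z - holeCenter j)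

theorem continuousOn_push : ContinuousOn (push r) (puncturedDisc r) := by
  unfold push
  refine continuousOn_id.add (continuousOn_finsetSum _ fun j _ => ?_)
  refine ContinuousOn.mul (Complex.continuous_ofReal.comp_continuousOn ?_) (by fun_prop)
  refine ContinuousOn.sup continuousOn_const (ContinuousOn.sub ?_ continuousOn_const)
  refine continuousOn_const.div (by fun_prop) fun z hz => ?_
  rw [norm_ne_zero_iff, sub_ne_zero]
  exact hz.2 j

theorem push_of_mem {z : ℂ} (hz : z ∈ holedDisc r) : push r z = z := by
  rw [push, Finset.sum_eq_zero, add_zero]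
  intro j _
  have h1 := hz.2 j
  rw [dist_eq_norm] at h1
  rw [max_eq_left, Complex.ofReal_zero, zero_mul]
  rw [sub_nonpos]
  exact div_le_one_of_le₀ h1 (norm_nonneg _)

theorem push_of_dist_lt {z : ℂ} {j : Fin r} (hz : z ≠ (holeCenter j : ℂ))
    (hj : dist z (holeCenter j : ℂ) < holeRadius r) :
    push r z = holeCenter j + ((holeRadius r / ‖z - holeCenter j‖ : ℝ) : ℂ) * (z - holeCenter j) := by
  rw [dist_eq_norm] at hj
  have h0 : 0 < ‖z - holeCenter j‖ := norm_pos_iff.2 (sub_ne_zero.2 hz)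
  rw [push, Finset.sum_eq_single j]
  · rw [max_eq_right (by rw [sub_nonneg, one_le_div h0]; exact hj.le)]
    push_cast; ring
  · intro i _ hij
    have h1 := two_mul_holeRadius_lt hij
    have h2 : |holeCenter i - holeCenter j| ≤ ‖z - holeCenter i‖ + ‖z - holeCenter j‖ := by
      have := dist_triangle_left (holeCenter i : ℂ) (holeCenter j : ℂ) z
      rwa [dist_eq_norm, dist_eq_norm, dist_eq_norm, ← Complex.ofReal_sub, Complex.norm_real,
        Real.norm_eq_abs] at this
    rw [max_eq_left, Complex.ofReal_zero, zero_mul]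
    rw [sub_nonpos]
    exact div_le_one_of_le₀ (by linarith) (norm_nonneg _)
  · simp

/-- A point of the punctured disc either is fixed, or it is pushed out of exactly one hole. -/
theorem push_cases {z : ℂ} (hz : z ∈ puncturedDisc r) :
    (z ∈ holedDisc r ∧ push r z = z) ∨ ∃ j : Fin r, ∃ c : ℝ, 1 < c ∧
      ‖z - holeCenter j‖ < holeRadius r ∧ ‖push r z - holeCenter j‖ = holeRadius r ∧
      push r z - holeCenter j = c * (z - holeCenter j) := by
  by_cases h : ∀ j : Fin r, holeRadius r ≤ dist z (holeCenter j : ℂ)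
  · have hz' : z ∈ holedDisc r := ⟨hz.1.le, h⟩
    exact Or.inl ⟨hz', push_of_mem hz'⟩
  · push Not at h
    obtain ⟨j, hj⟩ := h
    have h0 : 0 < ‖z - holeCenter j‖ := norm_pos_iff.2 (sub_ne_zero.2 (hz.2 j))
    have h1 : push r z - holeCenter j =
        ((holeRadius r / ‖z - holeCenter j‖ : ℝ) : ℂ) * (z - holeCenter j) := by
      rw [push_of_dist_lt (hz.2 j) hj]; ring
    rw [dist_eq_norm] at hj
    refine Or.inr ⟨j, _, (one_lt_div h0).2 hj, hj, ?_, h1⟩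
    rw [h1, norm_mul, Complex.norm_real, Real.norm_of_nonneg
      (div_nonneg (holeRadius_pos r).le h0.le), div_mul_cancel₀ _ h0.ne']

theorem push_mem {z : ℂ} (hz : z ∈ puncturedDisc r) : push r z ∈ holedDisc r := by
  rcases push_cases hz with ⟨h1, h2⟩ | ⟨j, c, -, -, h2, -⟩
  · rwa [h2]
  · refine ⟨(norm_lt_one_of_dist_le (by rw [dist_eq_norm, h2])).le, fun i => ?_⟩
    rcases eq_or_ne i j with rfl | hij
    · rw [dist_eq_norm, h2]
    · have h1 := two_mul_holeRadius_lt hij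
      have h3 := dist_triangle_left (holeCenter i : ℂ) (holeCenter j : ℂ) (push r z)
      rw [dist_eq_norm, dist_eq_norm _ (holeCenter j : ℂ), ← Complex.ofReal_sub, Complex.norm_real,
        Real.norm_eq_abs, h2] at h3
      linarith

theorem norm_push_lt {z : ℂ} (hz : z ∈ puncturedDisc r) : ‖push r z‖ < 1 := by
  rcases push_cases hz with ⟨-, h2⟩ | ⟨j, c, -, -, h2, -⟩
  · rw [h2]; exact hz.1
  · exact norm_lt_one_of_dist_le (by rw [dist_eq_norm, h2])

theorem exists_im_push_eq {z : ℂ} (hz : z ∈ puncturedDisc r) :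
    ∃ c : ℝ, 0 < c ∧ (push r z).im = c * z.im := by
  rcases push_cases hz with ⟨-, h2⟩ | ⟨j, c, h1, -, -, h2⟩
  · exact ⟨1, one_pos, by rw [h2, one_mul]⟩
  · refine ⟨c, by linarith, ?_⟩
    have := congrArg Complex.im h2
    simpa using this

/-- The retraction does not cross the vertical lines avoiding the interior of the holes, except
possibly in their centres. -/
theorem re_push_lt_iff {z : ℂ} (hz : z ∈ puncturedDisc r) {b : ℝ}
    (hb : ∀ j : Fin r, b = holeCenter j ∨ holeRadius r < |b - holeCenter j|) :
    ((push r z).re < b ↔ z.re < b) ∧ (b < (push r z).re ↔ b < z.re) := by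
  rcases push_cases hz with ⟨-, h2⟩ | ⟨j, c, h1, hz1, h2, h3⟩
  · rw [h2]; simp
  · have hre : (push r z).re - holeCenter j = c * (z.re - holeCenter j) := by
      have := congrArg Complex.re h3
      simpa using this
    have h4 : |z.re - holeCenter j| < holeRadius r := by
      have := Complex.abs_re_le_norm (z - holeCenter j)
      simp only [Complex.sub_re, Complex.ofReal_re] at this
      linarith
    have h5 : |(push r z).re - holeCenter j| ≤ holeRadius r := by
      have := Complex.abs_re_le_norm (push r z - holeCenter j)
      simp only [Complex.sub_re, Complex.ofReal_re] at this
      linarith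
    -- If the line passes through the centre, scaling from the centre preserves its sides. Otherwise
    -- the whole closed hole lies on one side of it.
    rcases hb j with rfl | hb
    · constructor <;> constructor <;> intro h6 <;> nlinarith
    · rw [abs_lt] at h4
      rw [abs_le] at h5
      rcases lt_abs.1 hb with h6 | h6
      · exact ⟨⟨fun _ => by linarith, fun _ => by linarith⟩,
          ⟨fun _ => by linarith, fun _ => by linarith⟩⟩
      · exact ⟨⟨fun _ => by linarith, fun _ => by linarith⟩,
          ⟨fun _ => by linarith, fun _ => by linarith⟩⟩

/-! ### The charts -/

/-- The pieces of the surface: the open disc slit along the real axis from the first centre of a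
hole, the vertical strips to the right of the holes, a neighbourhood of the vertex of the polygon,
and neighbourhoods of the open edges. -/
inductive Chart (g r : ℕ)
  | cell
  | vertex
  | gap (j : Fin r)
  | edge (k : Fin g)

/-- The points of the plane in a chart. -/
def chartSet : Chart g r → Set ℂ
  | .cell => {z | ‖z‖ < 1 ∧ (z.im ≠ 0 ∨ ∀ j : Fin r, z.re < holeCenter j)}
  | .vertex => {z | innerRadius r < ‖z‖ ∧ z ^ (2 * g) ∈ Complex.slitPlane}
  | .gap j => {z | ‖z‖ < 1 ∧ holeCenter j < z.re ∧ z.re < holeCenter j + 4 * holeRadius r}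
  | .edge k => {z | innerRadius r < ‖z‖ ∧ -z ∈ Complex.slitPlane ∧ 2 * ((k : ℕ) : ℝ) < ang g z ∧
      ang g z < 2 * ((k : ℕ) : ℝ) + 2 ∧ ang g z ≠ 2 * ((k : ℕ) : ℝ) + 1}

theorem isOpen_chartSet (i : Chart g r) : IsOpen (chartSet i) := by
  have hn : ∀ a : ℝ, IsOpen {z : ℂ | a < ‖z‖} := fun a => isOpen_lt continuous_const continuous_norm
  have hn' : IsOpen {z : ℂ | ‖z‖ < 1} := isOpen_lt continuous_norm continuous_const
  cases i with
  | cell =>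
    refine hn'.inter (IsOpen.union (isOpen_ne_fun Complex.continuous_im continuous_const) ?_)
    have h : IsOpen (⋂ j : Fin r, {z : ℂ | z.re < holeCenter j}) :=
      isOpen_iInter_of_finite fun j => isOpen_lt Complex.continuous_re continuous_const
    have h' : (⋂ j : Fin r, {z : ℂ | z.re < holeCenter j}) =
        {z : ℂ | ∀ j : Fin r, z.re < holeCenter j} := by ext z; simp
    rw [h'] at h
    exact h
  | vertex => exact (hn _).inter (Complex.isOpen_slitPlane.preimage (continuous_pow _))
  | gap j =>
    exact hn'.inter ((isOpen_lt continuous_const Complex.continuous_re).inter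
      (isOpen_lt Complex.continuous_re continuous_const))
  | edge k =>
    refine (hn _).inter ?_
    have h1 : IsOpen {z : ℂ | -z ∈ Complex.slitPlane} :=
      Complex.isOpen_slitPlane.preimage continuous_neg
    have h2 : ContinuousOn (ang g) {z : ℂ | -z ∈ Complex.slitPlane} := fun z hz =>
      (continuousAt_ang hz).continuousWithinAt
    have h3 : IsOpen {t : ℝ | 2 * ((k : ℕ) : ℝ) < t ∧ t < 2 * ((k : ℕ) : ℝ) + 2 ∧
        t ≠ 2 * ((k : ℕ) : ℝ) + 1} :=
      isOpen_Ioi.inter (isOpen_Iio.inter isOpen_ne)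
    exact h2.isOpen_inter_preimage h1 h3

theorem neg_polar_mem_slitPlane_iff (hg : 1 ≤ g) {s t : ℝ} (hs : 0 < s) (ht : 0 < t)
    (ht' : t ≤ 2 * g) : -polar g s t ∈ Complex.slitPlane ↔ t < 2 * g := by
  have hg' : (0 : ℝ) < g := by positivity
  have h1 : -polar g s t ≠ 0 := by
    rw [neg_ne_zero, ← norm_ne_zero_iff, norm_polar hs.le]; exact hs.ne'
  have h2 := ang_polar hg hs ht ht'
  rw [Complex.mem_slitPlane_iff_arg, and_iff_left h1, lt_iff_le_and_ne, and_iff_right ht',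
    not_iff_not]
  unfold ang at h2
  constructor
  · intro h
    rw [h, div_self Real.pi_ne_zero] at h2
    linarith
  · intro h
    rw [h] at h2 ⊢
    have h3 : (-polar g s (2 * g)).arg / Real.pi = 1 := by
      have : (g : ℝ) * ((-polar g s (2 * g)).arg / Real.pi + 1) = g * 2 := by linarith
      have := mul_left_cancel₀ hg'.ne' this
      linarith
    rwa [div_eq_one_iff_eq Real.pi_ne_zero] at h3

theorem polar_mem_edge_iff (hg : 1 ≤ g) {s t : ℝ} (hs : innerRadius r < s) (ht : 0 ≤ t)
    (ht' : t ≤ 2 * g) (k : Fin g) : polar g s t ∈ chartSet (.edge k : Chart g r) ↔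
      2 * ((k : ℕ) : ℝ) < t ∧ t < 2 * ((k : ℕ) : ℝ) + 2 ∧ t ≠ 2 * ((k : ℕ) : ℝ) + 1 := by
  have hs0 : 0 < s := (innerRadius_nonneg r).trans_lt hs
  have hk : ((k : ℕ) : ℝ) + 1 ≤ g := by exact_mod_cast k.2
  rcases ht.eq_or_lt with rfl | ht
  · have h1 : polar g s 0 = s := by simp [polar]
    have h2 : -(polar g s 0) ∉ Complex.slitPlane := by
      rw [h1, ← Complex.ofReal_neg, Complex.ofReal_mem_slitPlane]; linarith
    constructor
    · rintro ⟨-, h, -⟩; exact absurd h h2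
    · rintro ⟨h, -⟩
      have : (0 : ℝ) ≤ ((k : ℕ) : ℝ) := by positivity
      linarith
  · change innerRadius r < ‖polar g s t‖ ∧ _ ↔ _
    rw [norm_polar hs0.le, and_iff_right hs, ang_polar hg hs0 ht ht',
      neg_polar_mem_slitPlane_iff hg hs0 ht ht']
    constructor
    · exact fun h => h.2
    · exact fun h => ⟨by linarith [h.2.1], h⟩

/-- The cell and the gaps avoid the boundary of the polygon; the vertex chart depends only on the
angle modulo 1; an edge chart contains either both or neither of two identified points, namely both
exactly for 0 < s < 1 on its own pair of edges. -/
theorem saturated_chartSet (hg : 1 ≤ g) (i : Chart g r) : Saturated g (chartSet i) := by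
  intro k s hs
  have hk : ((k : ℕ) : ℝ) + 1 ≤ g := by exact_mod_cast k.2
  have hk0 : (0 : ℝ) ≤ ((k : ℕ) : ℝ) := by positivity
  have h1 : ∀ t, ‖polar g 1 t‖ = 1 := norm_polar zero_le_one
  cases i with
  | cell => simp [chartSet, h1]
  | gap j => simp [chartSet, h1]
  | vertex =>
    simp only [chartSet, Set.mem_ofPred_eq, h1, polar_pow hg]
    have h2 : Complex.exp ((2 * Real.pi * (2 * (k : ℕ) + 1 + s) : ℝ) * Complex.I) =
        Complex.exp ((2 * Real.pi * (2 * (k : ℕ) + s) : ℝ) * Complex.I) := by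
      rw [← Complex.exp_periodic (((2 * Real.pi * (2 * (k : ℕ) + s) : ℝ) : ℂ) * Complex.I)]
      congr 1
      push_cast; ring
    rw [h2]
  | edge k' =>
    rw [polar_mem_edge_iff hg (innerRadius_lt_one r) (by linarith [hs.1]) (by linarith [hs.2]),
      polar_mem_edge_iff hg (innerRadius_lt_one r) (by linarith [hs.1]) (by linarith [hs.2])]
    obtain ⟨hs0, hs1⟩ := hs
    rcases lt_trichotomy (k : ℕ) k' with h | h | h
    · have h' : ((k : ℕ) : ℝ) + 1 ≤ (k' : ℕ) := by exact_mod_cast h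
      constructor
      · rintro ⟨h, -⟩; linarith
      · rintro ⟨h, -⟩; linarith
    · rw [h]
      constructor
      · rintro ⟨h1, h2, h3⟩
        have : s ≠ 1 := fun h => h3 (by linarith)
        have : s < 1 := lt_of_le_of_ne hs1 this
        exact ⟨by linarith, by linarith, fun h => by linarith⟩
      · rintro ⟨h1, h2, h3⟩
        have : s ≠ 0 := fun h => h3 (by linarith)
        have : 0 < s := lt_of_le_of_ne hs0 this.symm
        exact ⟨by linarith, by linarith, fun h => by linarith⟩
    · have h' : ((k' : ℕ) : ℝ) + 1 ≤ (k : ℕ) := by exact_mod_cast h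
      constructor
      · rintro ⟨h, h4, -⟩; linarith
      · rintro ⟨h, h4, -⟩; linarith

end Charts

/-! ## Contractibility of the charts -/

section Contractibility

open Topology unitInterval

variable {g r : ℕ}

/-- The straight-line contraction towards p may run through a hole, so it is followed by the
retraction `push`; only the centres of the holes must be avoided. No gluing occurs in the open disc.
-/
theorem contractibleSpace_region_of_push (hg : 1 ≤ g) {S : Set ℂ} (hS : Saturated g S)
    (ho : IsOpen S) (hnorm : ∀ z ∈ S, ‖z‖ < 1) {p : ℂ} (hp : p ∈ holedDisc r ∩ S)
    (hstar : ∀ z ∈ holedDisc r ∩ S, ∀ t ∈ Set.Icc (0 : ℝ) 1,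
      ((1 - t : ℝ) : ℂ) * z + (t : ℂ) * p ∈ puncturedDisc r ∩ S)
    (hpush : ∀ z ∈ puncturedDisc r ∩ S, push r z ∈ S) :
    ContractibleSpace (region g r S) := by
  refine contractibleSpace_region hg hS ho
    (fun z t => push r (((1 - t : ℝ) : ℂ) * z + (t : ℂ) * p)) ?_ ?_ ?_ hp ?_ ?_
  · refine continuousOn_push.comp (f := fun q : ℂ × ℝ => ((1 - q.2 : ℝ) : ℂ) * q.1 + (q.2 : ℂ) * p)
      (by fun_prop) ?_
    rintro ⟨z, t⟩ ⟨hz, ht⟩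
    exact (hstar z hz t ht).1
  · intro z hz t ht
    exact ⟨push_mem (hstar z hz t ht).1, hpush _ (hstar z hz t ht)⟩
  · intro z hz
    simp [push_of_mem hz.1]
  · intro z _
    simp [push_of_mem hp.1]
  · intro t _ k s _ h _
    have := hnorm _ h
    rw [norm_polar zero_le_one] at this
    exact absurd this (lt_irrefl _)

theorem holeCenter_sub (i j : Fin r) :
    holeCenter i - holeCenter j = 4 * holeRadius r * (((i : ℕ) : ℝ) - ((j : ℕ) : ℝ)) := by
  unfold holeCenter holeRadius
  field_simp
  ring

theorem norm_convex_lt {z p : ℂ} (hz : ‖z‖ < 1) (hp : ‖p‖ < 1) {t : ℝ} (ht : t ∈ Set.Icc (0 : ℝ) 1) :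
    ‖((1 - t : ℝ) : ℂ) * z + (t : ℂ) * p‖ < 1 := by
  have h := convex_ball (0 : ℂ) 1 (mem_ball_zero_iff.2 hz) (mem_ball_zero_iff.2 hp)
    (sub_nonneg.2 ht.2) ht.1 (by ring)
  rw [mem_ball_zero_iff] at h
  simpa using h

theorem push_mem_cell {z : ℂ} (hz : z ∈ puncturedDisc r) (hc : z ∈ chartSet (.cell : Chart g r)) :
    push r z ∈ chartSet (.cell : Chart g r) := by
  have hR := holeRadius_pos r
  refine ⟨norm_push_lt hz, ?_⟩
  obtain ⟨c, hc0, hc'⟩ := exists_im_push_eq hz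
  refine hc.2.imp (fun h => ?_) fun h j => ?_
  · rw [hc']; exact mul_ne_zero hc0.ne' h
  · refine (re_push_lt_iff hz fun i => ?_).1.2 (h j)
    rcases eq_or_ne j i with rfl | hij
    · exact Or.inl rfl
    · exact Or.inr (by linarith [two_mul_holeRadius_lt hij])

theorem push_mem_gap {z : ℂ} {j : Fin r} (hz : z ∈ puncturedDisc r)
    (hc : z ∈ chartSet (.gap j : Chart g r)) : push r z ∈ chartSet (.gap j : Chart g r) := by
  have hR := holeRadius_pos r
  -- Consecutive centres are four radii apart: the right end of the gap is the next centre, and it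
  -- is at least four radii away from every other centre.
  have hb : ∀ i : Fin r, holeCenter j + 4 * holeRadius r = holeCenter i ∨
      holeRadius r < |holeCenter j + 4 * holeRadius r - holeCenter i| := by
    intro i
    have h3 := holeCenter_sub j i
    rcases eq_or_ne (i : ℕ) ((j : ℕ) + 1) with h | h
    · left
      rw [h] at h3
      push_cast at h3
      linarith
    · right
      have h4 : holeCenter j + 4 * holeRadius r - holeCenter i =
          4 * holeRadius r * (((j : ℕ) : ℝ) + 1 - ((i : ℕ) : ℝ)) := by linarith
      have h5 : (1 : ℝ) ≤ |((j : ℕ) : ℝ) + 1 - ((i : ℕ) : ℝ)| := by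
        have h6 : ((j : ℕ) : ℤ) + 1 - ((i : ℕ) : ℤ) ≠ 0 := by omega
        exact_mod_cast Int.one_le_abs h6
      rw [h4, abs_mul, abs_of_pos (by linarith)]
      nlinarith
  refine ⟨norm_push_lt hz, (re_push_lt_iff hz fun i => ?_).2.2 hc.2.1,
    (re_push_lt_iff hz hb).1.2 hc.2.2⟩
  rcases eq_or_ne j i with rfl | hij
  · exact Or.inl rfl
  · exact Or.inr (by linarith [two_mul_holeRadius_lt hij])

/-- A point in the middle of a gap. -/
noncomputable def gapPoint (j : Fin r) (y : ℝ) : ℂ := ⟨holeCenter j + 2 * holeRadius r, y⟩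

theorem gapPoint_mem_holedDisc (j : Fin r) {y : ℝ} (hy : |y| ≤ holeRadius r) :
    gapPoint j y ∈ holedDisc r ∧ ‖gapPoint j y‖ < 1 := by
  have hR := holeRadius_pos r
  have hj : ((j : ℕ) : ℝ) + 1 ≤ r := by exact_mod_cast j.2
  have hj0 : (0 : ℝ) ≤ ((j : ℕ) : ℝ) := by positivity
  have hn : ‖gapPoint j y‖ < 1 := by
    refine (Complex.norm_le_abs_re_add_abs_im _).trans_lt ?_
    have h1 : holeCenter j + 2 * holeRadius r = (2 * (j : ℕ) + 2 - r) / (r + 1) := by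
      unfold holeCenter holeRadius; field_simp; ring
    have h2 : holeRadius r = (1 / 2) / (r + 1) := by unfold holeRadius; field_simp
    have h3 : |(2 * ((j : ℕ) : ℝ) + 2 - r)| ≤ r := abs_le.2 ⟨by linarith, by linarith⟩
    have h4 : |holeCenter j + 2 * holeRadius r| ≤ r / (r + 1) := by
      rw [h1, abs_div, abs_of_pos (by positivity : (0 : ℝ) < r + 1)]
      gcongr
    have h5 : (r : ℝ) / (r + 1) + (1 / 2) / (r + 1) < 1 := by
      rw [← add_div, div_lt_one (by positivity)]; linarith
    change |holeCenter j + 2 * holeRadius r| + |y| < 1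
    linarith
  refine ⟨⟨hn.le, fun i => ?_⟩, hn⟩
  rw [dist_eq_norm]
  refine le_trans ?_ (Complex.abs_re_le_norm (gapPoint j y - holeCenter i))
  change _ ≤ |holeCenter j + 2 * holeRadius r - holeCenter i|
  have h3 := holeCenter_sub j i
  have h4 : holeCenter j + 2 * holeRadius r - holeCenter i =
        2 * holeRadius r * (2 * (((j : ℕ) : ℝ) - ((i : ℕ) : ℝ)) + 1) := by linarith
  have h5 : (1 : ℝ) ≤ |2 * (((j : ℕ) : ℝ) - ((i : ℕ) : ℝ)) + 1| := by
    have h6 : 2 * (((j : ℕ) : ℤ) - ((i : ℕ) : ℤ)) + 1 ≠ 0 := by omega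
    exact_mod_cast Int.one_le_abs h6
  rw [h4, abs_mul, abs_of_pos (by linarith)]
  nlinarith

theorem gapPoint_mem_gap (j : Fin r) {y : ℝ} (hy : |y| ≤ holeRadius r) :
    gapPoint j y ∈ chartSet (.gap j : Chart g r) := by
  have hR := holeRadius_pos r
  refine ⟨(gapPoint_mem_holedDisc j hy).2, ?_, ?_⟩
  · change _ < holeCenter j + 2 * holeRadius r
    linarith
  · change holeCenter j + 2 * holeRadius r < _
    linarith

/-- The slit disc is star-shaped about a real point to the left of all holes: a segment from a
nonreal point stays nonreal until its end, and one from a real point stays left of the slit. -/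
theorem contractibleSpace_cell (hg : 1 ≤ g) :
    ContractibleSpace (region g r (chartSet (.cell : Chart g r))) := by
  have hR := holeRadius_pos r
  have hI : ∀ j : Fin r, -innerRadius r < holeCenter j - holeRadius r := fun j => by
    linarith [(abs_lt.1 (show |holeCenter j| < innerRadius r - holeRadius r by
      linarith [abs_holeCenter_add_lt_innerRadius j])).1]
  have hn : ‖((-innerRadius r : ℝ) : ℂ)‖ < 1 := by
    rw [Complex.norm_real, norm_neg, Real.norm_of_nonneg (innerRadius_nonneg r)]
    exact innerRadius_lt_one r
  have hpc : ∀ z ∈ chartSet (.cell : Chart g r), z ∈ puncturedDisc r := by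
    refine fun z hz => ⟨hz.1, fun j h => ?_⟩
    rcases hz.2 with h1 | h1
    · rw [h] at h1; simp at h1
    · have := h1 j
      rw [h] at this; simp at this
  refine contractibleSpace_region_of_push hg (saturated_chartSet hg _) (isOpen_chartSet _)
    (fun z hz => hz.1) (p := ((-innerRadius r : ℝ) : ℂ)) ⟨⟨hn.le, fun j => ?_⟩, hn, Or.inr fun j => ?_⟩ ?_ ?_
  · rw [dist_eq_norm, ← Complex.ofReal_sub, Complex.norm_real, Real.norm_eq_abs, le_abs]
    right; linarith [hI j]
  · rw [Complex.ofReal_re]; linarith [hI j]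
  · intro z hz t ht
    refine (fun h => ⟨hpc _ h, h⟩) ⟨norm_convex_lt hz.2.1 hn ht, ?_⟩
    simp only [Complex.add_im, Complex.add_re, Complex.im_ofReal_mul, Complex.re_ofReal_mul,
      Complex.ofReal_im, Complex.ofReal_re]
    rcases eq_or_ne z.im 0 with h0 | h0
    · right
      intro j
      have h1 := (hz.2.2.resolve_left (not_not.2 h0)) j
      have h2 := mul_nonneg (sub_nonneg.2 ht.2) (sub_nonneg.2 h1.le)
      rcases ht.1.eq_or_lt with rfl | h3
      · simpa using h1
      · have h4 := mul_pos h3 (show 0 < holeCenter j + innerRadius r by linarith [hI j])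
        linarith
    · rcases eq_or_ne t 1 with rfl | h1
      · right
        intro j
        linarith [hI j]
      · left
        simpa using ⟨sub_ne_zero.2 h1.symm, h0⟩
  · exact fun z hz => push_mem_cell hz.1 hz.2

/-- The strip is convex and contains no centre, because the centres are four radii apart. -/
theorem contractibleSpace_gap (hg : 1 ≤ g) (j : Fin r) :
    ContractibleSpace (region g r (chartSet (.gap j : Chart g r))) := by
  have hR := holeRadius_pos r
  have h0 : |(0 : ℝ)| ≤ holeRadius r := by rw [abs_zero]; exact hR.le
  have hp := gapPoint_mem_gap (g := g) j h0
  have hpc : ∀ z ∈ chartSet (.gap j : Chart g r), z ∈ puncturedDisc r := by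
    refine fun z hz => ⟨hz.1, fun i h => ?_⟩
    have h1 := hz.2.1
    have h2 := hz.2.2
    rw [h, Complex.ofReal_re] at h1 h2
    have h3 := holeCenter_sub i j
    have h4 : (0 : ℝ) < ((i : ℕ) : ℝ) - ((j : ℕ) : ℝ) := by
      by_contra h; nlinarith
    have h5 : (1 : ℝ) ≤ ((i : ℕ) : ℝ) - ((j : ℕ) : ℝ) := by
      have h6 : (j : ℕ) < i := by exact_mod_cast sub_pos.1 h4
      have h7 : ((j : ℕ) : ℝ) + 1 ≤ (i : ℕ) := by exact_mod_cast h6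
      linarith
    nlinarith
  refine contractibleSpace_region_of_push hg (saturated_chartSet hg _) (isOpen_chartSet _)
    (fun z hz => hz.1) (p := gapPoint j 0) ⟨(gapPoint_mem_holedDisc j h0).1, hp⟩ ?_ ?_
  · intro z hz t ht
    refine (fun h => ⟨hpc _ h, h⟩) ⟨norm_convex_lt hz.2.1 hp.1 ht, ?_⟩
    simp only [Complex.add_re, Complex.re_ofReal_mul]
    exact convex_Ioo _ _ hz.2.2 hp.2 (sub_nonneg.2 ht.2) ht.1 (by ring)
  · exact fun z hz => push_mem_gap hz.1 hz.2

/-! ### Charts near the boundary of the polygon -/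

variable (g) in
/-- The deformation of a sector around a ray where `ε z ^ (2 g)` is positive to the end of the
ray. -/
noncomputable def spin (ε : ℝ) (z : ℂ) (t : ℝ) : ℂ :=
  z * Complex.exp (-(t : ℂ) * (Complex.log (ε * z ^ (2 * g)) / (2 * g)))

theorem log_real_mul_exp {s θ : ℝ} (hs : 0 < s) (hθ : |θ| < 1 / 2) :
    Complex.log (s * Complex.exp ((2 * Real.pi * θ : ℝ) * Complex.I)) =
      Real.log s + (2 * Real.pi * θ : ℝ) * Complex.I := by
  rw [abs_lt] at hθ
  have h1 := Real.pi_pos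
  rw [Complex.log_ofReal_mul hs (Complex.exp_ne_zero _), Complex.log_exp]
  · rw [Complex.im_ofReal_mul, Complex.I_im]; nlinarith
  · rw [Complex.im_ofReal_mul, Complex.I_im]; nlinarith

theorem real_mul_exp_mem_slitPlane {s θ : ℝ} (hs : 0 < s) (hθ : |θ| < 1 / 2) :
    (s * Complex.exp ((2 * Real.pi * θ : ℝ) * Complex.I) : ℂ) ∈ Complex.slitPlane := by
  have h1 := Real.pi_pos
  rw [Complex.mem_slitPlane_iff_arg]
  refine ⟨?_, mul_ne_zero (by exact_mod_cast hs.ne') (Complex.exp_ne_zero _)⟩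
  have h2 := congrArg Complex.im (log_real_mul_exp hs hθ)
  rw [Complex.log_im, Complex.add_im, Complex.ofReal_im, Complex.im_ofReal_mul, Complex.I_im] at h2
  rw [h2]
  rw [abs_lt] at hθ
  nlinarith

/-- The ray of angle `m` is the one where `ε z ^ (2 g)` is positive that is closest to the ray of
angle `τ`. -/
def Near (ε τ m : ℝ) : Prop :=
  |τ - m| < 1 / 2 ∧ (ε : ℂ) * Complex.exp ((2 * Real.pi * τ : ℝ) * Complex.I) =
    Complex.exp ((2 * Real.pi * (τ - m) : ℝ) * Complex.I)

theorem Near.mul_polar_pow (hg : 1 ≤ g) {ε s τ m : ℝ} (h : Near ε τ m) :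
    (ε : ℂ) * polar g s τ ^ (2 * g) =
      ((s ^ (2 * g) : ℝ) : ℂ) * Complex.exp ((2 * Real.pi * (τ - m) : ℝ) * Complex.I) := by
  rw [polar_pow hg, ← h.2]
  push_cast
  ring

/-- In the coordinates (logarithm of the radius, angle) the deformation is linear: the radius tends
to 1 and the angle to m. -/
theorem Near.spin_polar (hg : 1 ≤ g) {ε s τ m : ℝ} (h : Near ε τ m) (hs : 0 < s) (t : ℝ) :
    spin g ε (polar g s τ) t = polar g (Real.exp ((1 - t) * Real.log s)) (τ - t * (τ - m)) := by
  have hg' : (g : ℂ) ≠ 0 := by exact_mod_cast (by omega : g ≠ 0)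
  rw [spin, h.mul_polar_pow hg, log_real_mul_exp (by positivity) h.1, polar, polar,
    Real.log_pow]
  rw [Complex.ofReal_exp]
  have h1 : (s : ℂ) = Complex.exp (Real.log s) := by
    rw [← Complex.ofReal_exp, Real.exp_log hs]
  conv_lhs => rw [h1]
  rw [← Complex.exp_add, ← Complex.exp_add, ← Complex.exp_add]
  congr 1
  push_cast
  field_simp
  ring

/-- Each sector is contracted to the boundary point on its central ray, and these end points all
represent the same point of the surface. The last hypothesis keeps boundary points on their own
edge, so that identified points move in parallel. -/
theorem contractibleSpace_region_of_spin (hg : 1 ≤ g) {S : Set ℂ} (hS : Saturated g S)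
    (ho : IsOpen S) (ε : ℝ) (hr : ∀ z ∈ S, innerRadius r < ‖z‖) (m : ℂ → ℝ)
    (hm : ∀ z ∈ S, Near ε (ang g z) (m z))
    (hseg : ∀ z ∈ S, ∀ s, innerRadius r < s → ∀ t ∈ Set.Icc (0 : ℝ) 1,
      polar g s (ang g z - t * (ang g z - m z)) ∈ S)
    {z₀ : ℂ} (hz₀ : z₀ ∈ holedDisc r ∩ S) (hend : ∀ z ∈ S, pt g r (polar g 1 (m z)) = pt g r z₀)
    (hgl : ∀ k : Fin g, ∀ s ∈ Set.Icc (0 : ℝ) 1, polar g 1 (2 * (k : ℕ) + s) ∈ S →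
      ∃ m₀ ∈ Set.Icc (0 : ℝ) 1, Near ε s m₀) :
    ContractibleSpace (region g r S) := by
  have hpos : ∀ z ∈ S, 0 < ‖z‖ := fun z hz => (innerRadius_nonneg r).trans_lt (hr z hz)
  have hspin : ∀ z ∈ S, ∀ t, spin g ε z t =
      polar g (Real.exp ((1 - t) * Real.log ‖z‖)) (ang g z - t * (ang g z - m z)) :=
    fun z hz t => by
      conv_lhs => rw [← polar_ang hg z]
      exact (hm z hz).spin_polar hg (hpos z hz) t
  have hexp : ∀ z ∈ holedDisc r ∩ S, ∀ t ∈ Set.Icc (0 : ℝ) 1,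
      innerRadius r < Real.exp ((1 - t) * Real.log ‖z‖) ∧ Real.exp ((1 - t) * Real.log ‖z‖) ≤ 1 := by
    intro z hz t ht
    have h1 : Real.log ‖z‖ ≤ 0 := Real.log_nonpos (norm_nonneg _) hz.1.1
    constructor
    · refine (hr z hz.2).trans_le ?_
      conv_lhs => rw [← Real.exp_log (hpos z hz.2)]
      rw [Real.exp_le_exp]
      nlinarith [ht.1]
    · rw [Real.exp_le_one_iff]
      nlinarith [ht.2]
  refine contractibleSpace_region hg hS ho (spin g ε) ?_ ?_ ?_ hz₀ ?_ ?_
  · have hc : ContinuousOn (fun q : ℂ × ℝ => Complex.log ((ε : ℂ) * q.1 ^ (2 * g)))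
        ((holedDisc r ∩ S) ×ˢ Set.Icc 0 1) := by
      refine ContinuousOn.clog (by fun_prop) ?_
      rintro ⟨z, t⟩ ⟨hz, -⟩
      change (ε : ℂ) * z ^ (2 * g) ∈ _
      rw [← polar_ang hg z, (hm z hz.2).mul_polar_pow hg]
      exact real_mul_exp_mem_slitPlane (by have := hpos z hz.2; positivity) (hm z hz.2).1
    change ContinuousOn (fun q : ℂ × ℝ => q.1 *
      Complex.exp (-(q.2 : ℂ) * (Complex.log ((ε : ℂ) * q.1 ^ (2 * g)) / (2 * g)))) _
    have hg' : (2 * g : ℂ) ≠ 0 := by exact_mod_cast (by omega : 2 * g ≠ 0)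
    refine continuousOn_fst.mul (Complex.continuous_exp.comp_continuousOn ?_)
    exact ContinuousOn.mul (by fun_prop) (hc.div_const _)
  · intro z hz t ht
    rw [hspin z hz.2]
    obtain ⟨h1, h2⟩ := hexp z hz t ht
    refine ⟨mem_holedDisc_of_innerRadius_lt ?_ ?_, hseg z hz.2 _ h1 t ht⟩ <;>
      rwa [norm_polar (Real.exp_pos _).le]
  · intro z _
    simp [spin]
  · intro z hz
    rw [hspin z hz.2, sub_self, zero_mul, Real.exp_zero, one_mul, sub_sub_cancel]
    exact hend z hz.2
  · intro t ht k s hs h1 _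
    obtain ⟨m₀, hm₀, h3, h4⟩ := hgl k s hs h1
    -- Identified boundary points differ by one unit of angle, and the choice of central ray is
    -- invariant under that shift.
    have hper : ∀ n : ℕ, Near ε (n + s) (n + m₀) := fun n => by
      refine ⟨by rwa [add_sub_add_left_eq_sub], ?_⟩
      rw [add_sub_add_left_eq_sub, ← h4]
      congr 1
      rw [← Complex.exp_periodic.nat_mul n (((2 * Real.pi * s : ℝ) : ℂ) * Complex.I)]
      congr 1
      push_cast; ring
    have e1 := (hper (2 * k)).spin_polar hg one_pos t
    have e2 := (hper (2 * k + 1)).spin_polar hg one_pos t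
    push_cast at e1 e2
    rw [e1, e2, Real.log_one, mul_zero, Real.exp_zero]
    have h5 : s - t * (s - m₀) ∈ Set.Icc (0 : ℝ) 1 := by
      obtain ⟨a1, a2⟩ := hs
      obtain ⟨b1, b2⟩ := hm₀
      obtain ⟨c1, c2⟩ := ht
      constructor <;> nlinarith
    have h6 := pt_glue (r := r) hg k h5
    have h7 : 2 * ((k : ℕ) : ℝ) + s - t * (2 * ((k : ℕ) : ℝ) + s - (2 * ((k : ℕ) : ℝ) + m₀)) =
      2 * ((k : ℕ) : ℝ) + (s - t * (s - m₀)) := by ring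
    have h8 : 2 * ((k : ℕ) : ℝ) + 1 + s - t * (2 * ((k : ℕ) : ℝ) + 1 + s -
      (2 * ((k : ℕ) : ℝ) + 1 + m₀)) = 2 * ((k : ℕ) : ℝ) + 1 + (s - t * (s - m₀)) := by ring
    rw [h7, h8, h6]

theorem near_one {τ : ℝ} {m : ℤ} (h : |τ - m| < 1 / 2) : Near 1 τ m := by
  refine ⟨h, ?_⟩
  rw [← Complex.exp_periodic.sub_int_mul_eq m]
  push_cast
  rw [one_mul]
  congr 1
  ring

theorem near_neg_one {τ : ℝ} {m : ℤ} (h1 : m < τ) (h2 : τ < m + 1) : Near (-1) τ (m + 1 / 2) := by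
  refine ⟨by rw [abs_lt]; constructor <;> linarith, ?_⟩
  have h3 : ((2 * Real.pi * (τ - (m + 1 / 2)) : ℝ) : ℂ) * Complex.I =
      ((2 * Real.pi * τ : ℝ) : ℂ) * Complex.I - Real.pi * Complex.I - m * (2 * Real.pi * Complex.I) := by
    push_cast; ring
  rw [h3, Complex.exp_periodic.sub_int_mul_eq m, Complex.exp_sub, Complex.exp_pi_mul_I]
  push_cast
  ring

theorem polar_mem_vertex (hg : 1 ≤ g) {s τ : ℝ} (hs : innerRadius r < s) {m : ℤ}
    (h : |τ - m| < 1 / 2) : polar g s τ ∈ chartSet (.vertex : Chart g r) := by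
  have hs0 : 0 < s := (innerRadius_nonneg r).trans_lt hs
  refine ⟨by rwa [norm_polar hs0.le], ?_⟩
  have h1 := (near_one h).mul_polar_pow hg (s := s)
  rw [Complex.ofReal_one, one_mul] at h1
  rw [h1]
  exact real_mul_exp_mem_slitPlane (by positivity) h

theorem abs_sub_round_lt_of_mem_vertex (hg : 1 ≤ g) {s τ : ℝ}
    (h : polar g s τ ∈ chartSet (.vertex : Chart g r)) : |τ - round τ| < 1 / 2 := by
  refine (abs_sub_round τ).lt_of_ne fun h1 => ?_
  have h2 := h.2
  rw [polar_pow hg] at h2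
  have h3 : Complex.exp ((2 * Real.pi * τ : ℝ) * Complex.I) = -1 := by
    rw [← Complex.exp_periodic.sub_int_mul_eq (round τ)]
    have h4 : ((2 * Real.pi * τ : ℝ) : ℂ) * Complex.I - (round τ : ℤ) * (2 * Real.pi * Complex.I) =
      ((2 * Real.pi * (τ - round τ) : ℝ) : ℂ) * Complex.I := by push_cast; ring
    rw [h4]
    rcases eq_or_eq_neg_of_abs_eq h1 with h5 | h5 <;> rw [h5]
    · rw [← Complex.exp_pi_mul_I]; congr 1; push_cast; ring
    · rw [← inv_inj, ← Complex.exp_neg, inv_neg, inv_one, ← Complex.exp_pi_mul_I]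
      congr 1; push_cast; ring
  rw [h3, ← Complex.ofReal_pow, mul_neg_one, ← Complex.ofReal_neg, Complex.ofReal_mem_slitPlane,
    pow_mul] at h2
  have : 0 ≤ (s ^ 2) ^ g := by positivity
  linarith

/-- Gluing at s = 0 identifies the corners 2k and 2k + 1, at s = 1 the corners 2k + 1 and 2k + 2; so
the polygon has a single vertex. -/
theorem pt_corner (hg : 1 ≤ g) : ∀ n : ℕ, n ≤ 2 * g → pt g r (polar g 1 n) = pt g r (polar g 1 0)
  | 0, _ => by simp
  | n + 1, hn => by
    rw [← pt_corner hg n (by omega)]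
    rcases Nat.even_or_odd' n with ⟨k, rfl | rfl⟩
    · have h := pt_glue (r := r) hg ⟨k, by omega⟩ (s := 0) ⟨le_rfl, zero_le_one⟩
      simp only [add_zero] at h
      push_cast
      exact h.symm
    · have h := pt_glue (r := r) hg ⟨k, by omega⟩ (s := 1) ⟨zero_le_one, le_rfl⟩
      simp only at h
      push_cast
      exact h.symm

/-- Every sector is spun to the nearest corner, at an integral angle, and all corners are the same
point. -/
theorem contractibleSpace_vertex (hg : 1 ≤ g) :
    ContractibleSpace (region g r (chartSet (.vertex : Chart g r))) := by
  have hz : ∀ z ∈ chartSet (.vertex : Chart g r), |ang g z - round (ang g z)| < 1 / 2 :=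
    fun z hz => abs_sub_round_lt_of_mem_vertex (r := r) hg (s := ‖z‖) (by rwa [polar_ang hg])
  refine contractibleSpace_region_of_spin hg (saturated_chartSet hg _) (isOpen_chartSet _) 1
    (fun z hz => hz.1) (fun z => (round (ang g z) : ℤ)) (fun z h => near_one (hz z h)) ?_
    (z₀ := polar g 1 0)
    ⟨?_, polar_mem_vertex hg (innerRadius_lt_one r) (m := 0) (by norm_num)⟩ ?_ ?_
  · intro z h s hs t ht
    refine polar_mem_vertex hg hs (m := round (ang g z)) ?_
    have h1 : ang g z - t * (ang g z - round (ang g z)) - round (ang g z) =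
      (1 - t) * (ang g z - round (ang g z)) := by ring
    rw [h1, abs_mul, abs_of_nonneg (by linarith [ht.2])]
    have := hz z h
    nlinarith [ht.1, abs_nonneg (ang g z - round (ang g z))]
  · refine mem_holedDisc_of_innerRadius_lt ?_ ?_ <;> rw [norm_polar zero_le_one]
    exact innerRadius_lt_one r
  · intro z h
    have h1 := abs_lt.1 (hz z h)
    have h2 := ang_pos hg z
    have h3 := ang_le (g := g) z
    have h4 : (-1 : ℝ) < round (ang g z) := by linarith
    have h5 : (round (ang g z) : ℝ) < 2 * g + 1 := by linarith
    have h6 : -1 < round (ang g z) := by exact_mod_cast h4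
    have h7 : round (ang g z) < 2 * g + 1 := by exact_mod_cast h5
    obtain ⟨n, hn⟩ := Int.eq_ofNat_of_zero_le (by omega : 0 ≤ round (ang g z))
    rw [hn, ← pt_corner hg n (by omega)]
    simp
  · intro k s hs h
    have h1 := abs_sub_round_lt_of_mem_vertex hg h
    have h2 : (2 * ((k : ℕ) : ℝ) + s) = ((2 * (k : ℕ) : ℕ) : ℝ) + s := by push_cast; ring
    rw [h2, round_natCast_add] at h1
    push_cast at h1
    rw [add_sub_add_left_eq_sub] at h1
    refine ⟨_, ?_, near_one h1⟩
    rw [abs_lt] at h1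
    have h4 : (-1 : ℝ) < round s := by linarith [hs.1]
    have h5 : (round s : ℝ) < 2 := by linarith [hs.2]
    have h6 : -1 < round s := by exact_mod_cast h4
    have h7 : round s < 2 := by exact_mod_cast h5
    constructor
    · exact_mod_cast (by omega : 0 ≤ round s)
    · exact_mod_cast (by omega : round s ≤ 1)

/-- The two sectors abutting an edge are spun to its two midpoints, at angles 2k + 1/2 and 2k + 3/2,
which are identified. -/
theorem contractibleSpace_edge (hg : 1 ≤ g) (k : Fin g) :
    ContractibleSpace (region g r (chartSet (.edge k : Chart g r))) := by
  have hk : ((k : ℕ) : ℝ) + 1 ≤ g := by exact_mod_cast k.2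
  have hk0 : (0 : ℝ) ≤ ((k : ℕ) : ℝ) := by positivity
  have hlt := innerRadius_lt_one r
  have hz₀ : polar g 1 (2 * (k : ℕ) + 1 / 2) ∈ chartSet (.edge k : Chart g r) := by
    rw [polar_mem_edge_iff hg hlt (by linarith) (by linarith)]
    exact ⟨by linarith, by linarith, by linarith⟩
  have hcases : ∀ z ∈ chartSet (.edge k : Chart g r), ∃ m : ℤ,
      (m : ℝ) < ang g z ∧ ang g z < m + 1 ∧ (m = 2 * (k : ℕ) ∨ m = 2 * (k : ℕ) + 1) := by
    rintro z ⟨-, -, h1, h2, h3⟩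
    rcases lt_or_gt_of_ne h3 with h | h
    · exact ⟨2 * (k : ℕ), by push_cast; linarith, by push_cast; linarith, Or.inl rfl⟩
    · exact ⟨2 * (k : ℕ) + 1, by push_cast; linarith, by push_cast; linarith, Or.inr rfl⟩
  have hfl : ∀ z ∈ chartSet (.edge k : Chart g r), (⌊ang g z⌋ : ℝ) < ang g z ∧
      ang g z < ⌊ang g z⌋ + 1 ∧ (⌊ang g z⌋ = 2 * (k : ℕ) ∨ ⌊ang g z⌋ = 2 * (k : ℕ) + 1) := by
    intro z hz
    obtain ⟨m, h1, h2, h3⟩ := hcases z hz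
    rw [Int.floor_eq_iff.2 ⟨h1.le, h2⟩]
    exact ⟨h1, h2, h3⟩
  refine contractibleSpace_region_of_spin hg (saturated_chartSet hg _) (isOpen_chartSet _) (-1)
    (fun z hz => hz.1) (fun z => (⌊ang g z⌋ : ℤ) + 1 / 2)
    (fun z h => near_neg_one (hfl z h).1 (hfl z h).2.1) ?_
    (z₀ := polar g 1 (2 * (k : ℕ) + 1 / 2)) ⟨?_, hz₀⟩ ?_ ?_
  · intro z h s hs t ht
    obtain ⟨h1, h2, h3⟩ := hfl z h
    obtain ⟨t0, t1⟩ := ht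
    have h4 : (⌊ang g z⌋ : ℝ) < ang g z - t * (ang g z - (⌊ang g z⌋ + 1 / 2)) := by nlinarith
    have h5 : ang g z - t * (ang g z - (⌊ang g z⌋ + 1 / 2)) < ⌊ang g z⌋ + 1 := by nlinarith
    set τ := ang g z - t * (ang g z - (⌊ang g z⌋ + 1 / 2))
    rcases h3 with h3 | h3 <;> rw [h3] at h4 h5 <;> push_cast at h4 h5 <;>
      rw [polar_mem_edge_iff hg hs (by linarith) (by linarith)]
    · exact ⟨by linarith, by linarith, by linarith⟩
    · exact ⟨by linarith, by linarith, fun h => by linarith⟩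
  · refine mem_holedDisc_of_innerRadius_lt ?_ ?_ <;> rw [norm_polar zero_le_one]
    exact hlt
  · intro z h
    obtain ⟨-, -, h3 | h3⟩ := hfl z h
    · rw [h3]; push_cast; rfl
    · rw [h3, pt_glue hg k (by norm_num : (1 / 2 : ℝ) ∈ Set.Icc (0 : ℝ) 1)]; push_cast; rfl
  · intro k' s hs h
    have hk' : ((k' : ℕ) : ℝ) + 1 ≤ g := by exact_mod_cast k'.2
    have hk0' : (0 : ℝ) ≤ ((k' : ℕ) : ℝ) := by positivity
    have hs' := hs
    obtain ⟨s0, s1⟩ := hs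
    have hS := (saturated_chartSet hg _ k' s hs').1 h
    rw [polar_mem_edge_iff hg hlt (by linarith) (by linarith)] at h hS
    have h0 : s ≠ 0 := by
      rintro rfl
      obtain ⟨h1, h2, h3⟩ := h
      have h4 : ((k : ℕ) : ℝ) < (k' : ℕ) := by linarith
      have h6 : ((k : ℕ) : ℝ) + 1 ≤ (k' : ℕ) := by
        have h5 : (k : ℕ) < k' := by exact_mod_cast h4
        exact_mod_cast h5
      linarith
    have h1' : s ≠ 1 := by
      rintro rfl
      obtain ⟨h1, h2, h3⟩ := hS
      have h4 : ((k' : ℕ) : ℝ) < (k : ℕ) := by linarith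
      have h6 : ((k' : ℕ) : ℝ) + 1 ≤ (k : ℕ) := by
        have h5 : (k' : ℕ) < k := by exact_mod_cast h4
        exact_mod_cast h5
      linarith
    refine ⟨(0 : ℤ) + 1 / 2, by norm_num, near_neg_one ?_ ?_⟩
    · push_cast; exact lt_of_le_of_ne s0 h0.symm
    · push_cast; rw [zero_add]; exact lt_of_le_of_ne s1 h1'

theorem contractibleSpace_chart (hg : 1 ≤ g) (i : Chart g r) :
    ContractibleSpace (region g r (chartSet i)) := by
  cases i with
  | cell => exact contractibleSpace_cell hg
  | vertex => exact contractibleSpace_vertex hg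
  | gap j => exact contractibleSpace_gap hg j
  | edge k => exact contractibleSpace_edge hg k

end Contractibility

/-! ## Bundles from tuples of group elements -/

section Cocycle

open Topology unitInterval

variable {g r : ℕ}

theorem neg_innerRadius_lt_holeCenter (j : Fin r) : -innerRadius r < holeCenter j := by
  have h1 := abs_holeCenter_add_lt_innerRadius j
  have h2 := neg_abs_le (holeCenter j)
  linarith [holeRadius_pos r]

theorem holeCenter_lt_innerRadius (j : Fin r) : holeCenter j < innerRadius r := by
  have h1 := abs_holeCenter_add_lt_innerRadius j
  have h2 := le_abs_self (holeCenter j)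
  linarith [holeRadius_pos r]

theorem holeCenter_add_gap (j : Fin r) :
    holeCenter j + 4 * holeRadius r = innerRadius r + 2 * (((j : ℕ) : ℝ) + 1 - r) / (r + 1) +
      1 / (r + 1) := by
  unfold holeCenter holeRadius innerRadius
  field_simp
  ring

/-- A real point of the disc outside the holes is in the cell or in a gap. -/
theorem exists_chart_of_im_eq_zero {z : ℂ} (hz : z ∈ holedDisc r) (h1 : ‖z‖ < 1) (him : z.im = 0) :
    z ∈ chartSet (.cell : Chart g r) ∨ ∃ j, z ∈ chartSet (.gap j : Chart g r) := by
  have hR := holeRadius_pos r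
  have hne : ∀ j : Fin r, z.re ≠ holeCenter j := by
    intro j hj
    have h2 := hz.2 j
    have h3 : z = (holeCenter j : ℂ) := Complex.ext (by simpa using hj) (by simpa using him)
    rw [h3, dist_self] at h2
    linarith
  by_cases hc : ∀ j : Fin r, z.re < holeCenter j
  · exact Or.inl ⟨h1, Or.inr hc⟩
  · push Not at hc
    right
    -- The last hole whose centre is not to the right of z. Its gap extends to the next centre, or
    -- to the point 1 if there is none.
    obtain ⟨j, hj, hmax⟩ := Set.exists_max_image {j : Fin r | holeCenter j ≤ z.re} id
      (Set.toFinite _) hc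
    refine ⟨j, h1, lt_of_le_of_ne hj (hne j).symm, ?_⟩
    by_contra h3
    push Not at h3
    by_cases hj1 : (j : ℕ) + 1 < r
    · have h4 := holeCenter_sub ⟨j + 1, hj1⟩ j
      push_cast at h4
      have h5 : (⟨j + 1, hj1⟩ : Fin r) ≤ j := hmax _ (by
        change holeCenter (⟨j + 1, hj1⟩ : Fin r) ≤ z.re
        linarith)
      rw [Fin.le_def] at h5
      simp at h5
    · have h4 : ((j : ℕ) : ℝ) + 1 = r := by
        have := j.2
        exact_mod_cast (by omega : (j : ℕ) + 1 = r)
      have h5 := holeCenter_add_gap j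
      have h6 : innerRadius r + 1 / (r + 1) = 1 := by unfold innerRadius; field_simp
      rw [h4, sub_self, mul_zero, zero_div, add_zero, h6] at h5
      have h7 := Complex.abs_re_le_norm z
      have h8 := le_abs_self z.re
      linarith

theorem mem_vertex_or_mem_edge (hg : 1 ≤ g) {z : ℂ} (hz : innerRadius r < ‖z‖) :
    z ∈ chartSet (.vertex : Chart g r) ∨ ∃ k, z ∈ chartSet (.edge k : Chart g r) := by
  have h0 : 0 < ‖z‖ := (innerRadius_nonneg r).trans_lt hz
  rcases (abs_sub_round (ang g z)).lt_or_eq with h | h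
  · left
    have := polar_mem_vertex hg hz h
    rwa [polar_ang hg] at this
  · right
    have hpos := ang_pos hg z
    have hle := ang_le (g := g) z
    obtain ⟨m, hm⟩ : ∃ m : ℤ, ang g z = m + 1 / 2 := by
      rcases eq_or_eq_neg_of_abs_eq h with h | h
      · exact ⟨round (ang g z), by linarith⟩
      · exact ⟨round (ang g z) - 1, by push_cast; linarith⟩
    have hm0 : -1 < m := by
      have : (-1 : ℝ) < m := by linarith
      exact_mod_cast this
    have hm1 : m < 2 * g := by
      have : (m : ℝ) < 2 * g := by linarith
      exact_mod_cast this
    obtain ⟨n, rfl⟩ := Int.eq_ofNat_of_zero_le (by omega : 0 ≤ m)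
    have hk : n / 2 < g := by omega
    refine ⟨⟨n / 2, hk⟩, ?_⟩
    rw [← polar_ang hg z, polar_mem_edge_iff hg hz hpos.le hle, hm]
    simp only
    rcases Nat.even_or_odd' n with ⟨c, rfl | rfl⟩
    · have h1 : 2 * c / 2 = c := by omega
      rw [h1]; push_cast
      exact ⟨by linarith, by linarith, fun h => by linarith⟩
    · have h1 : (2 * c + 1) / 2 = c := by omega
      rw [h1]; push_cast
      exact ⟨by linarith, by linarith, fun h => by linarith⟩

theorem exists_mem_chartSet (hg : 1 ≤ g) {z : ℂ} (hz : z ∈ holedDisc r) :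
    ∃ i : Chart g r, z ∈ chartSet i := by
  rcases hz.1.lt_or_eq with h | h
  · rcases eq_or_ne z.im 0 with h0 | h0
    · rcases exists_chart_of_im_eq_zero hz h h0 with h1 | ⟨j, h1⟩
      · exact ⟨_, h1⟩
      · exact ⟨_, h1⟩
    · exact ⟨.cell, h, Or.inl h0⟩
  · rcases mem_vertex_or_mem_edge hg (r := r) (h ▸ innerRadius_lt_one r) with h1 | ⟨k, h1⟩
    · exact ⟨_, h1⟩
    · exact ⟨_, h1⟩

variable {G : Type*} [Group G]

/-- The frames, in the coordinates of the polygon, of the bundle over the surface whose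
holonomies are encoded by `v` (at the corners of the polygon) and `d` (at the gaps). -/
noncomputable def frame (v d : ℕ → G) : Chart g r → ℂ → G
  | .cell, _ => 1
  | .vertex, z => v ⌊ang g z + 1 / 2⌋₊
  | .gap j, z => if 0 < z.im then 1 else d ((j : ℕ) + 1)
  | .edge _, z => v ⌊ang g z⌋₊

theorem ang_of_im_eq_zero {z : ℂ} (him : z.im = 0) (hre : 0 < z.re) : ang g z = 2 * g := by
  have h1 : (-z).arg = Real.pi := by
    rw [Complex.arg_eq_pi_iff]; simp [hre, him]
  rw [ang, h1, div_self Real.pi_ne_zero]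
  ring

theorem frame_edge {v d : ℕ → G} (hg : 1 ≤ g) {z : ℂ} {n : ℕ} (h0 : (n : ℝ) ≤ ang g z)
    (h1 : ang g z < n + 1) (k : Fin g) : frame v d (.edge k : Chart g r) z = v n := by
  change v _ = v n
  rw [(Nat.floor_eq_iff (ang_pos hg z).le).2 ⟨h0, h1⟩]

theorem frame_vertex {v d : ℕ → G} {z : ℂ} {n : ℕ} (h0 : (n : ℝ) - 1 / 2 ≤ ang g z)
    (h1 : ang g z < n + 1 / 2) : frame v d (.vertex : Chart g r) z = v n := by
  change v _ = v n
  rw [(Nat.floor_eq_iff (n := n) (by linarith [n.cast_nonneg (α := ℝ)])).2 ⟨by linarith, by linarith⟩]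

theorem exists_nat_of_mem_vertex (hg : 1 ≤ g) {z : ℂ} (hz : z ∈ chartSet (.vertex : Chart g r)) :
    ∃ n : ℕ, n ≤ 2 * g ∧ (n : ℝ) - 1 / 2 < ang g z ∧ ang g z < n + 1 / 2 := by
  have h := abs_sub_round_lt_of_mem_vertex (r := r) hg (s := ‖z‖) (τ := ang g z) (by rwa [polar_ang hg])
  rw [abs_lt] at h
  have h2 := ang_pos hg z
  have h3 := ang_le (g := g) z
  have h4 : (-1 : ℝ) < round (ang g z) := by linarith
  have h5 : (round (ang g z) : ℝ) < 2 * g + 1 := by linarith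
  have h6 : -1 < round (ang g z) := by exact_mod_cast h4
  have h7 : round (ang g z) < 2 * g + 1 := by exact_mod_cast h5
  obtain ⟨n, hn⟩ := Int.eq_ofNat_of_zero_le (by omega : 0 ≤ round (ang g z))
  rw [hn] at h
  push_cast at h
  exact ⟨n, by omega, by linarith, by linarith⟩

theorem eventually_frame_vertex (hg : 1 ≤ g) (v d : ℕ → G) {z : ℂ}
    (hz : z ∈ chartSet (.vertex : Chart g r)) (hs : -z ∈ Complex.slitPlane) :
    ∀ᶠ w in 𝓝 z, frame v d (.vertex : Chart g r) w = frame v d (.vertex : Chart g r) z := by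
  obtain ⟨n, -, h1, h2⟩ := exists_nat_of_mem_vertex hg hz
  rw [frame_vertex h1.le h2]
  filter_upwards [(continuousAt_ang hs).eventually (lt_mem_nhds h1),
    (continuousAt_ang hs).eventually (gt_mem_nhds h2)] with w h3 h4
  exact frame_vertex h3.le h4

theorem exists_nat_of_mem_edge {z : ℂ} {k : Fin g} (hz : z ∈ chartSet (.edge k : Chart g r)) :
    ∃ n : ℕ, n / 2 = k ∧ (n : ℝ) < ang g z ∧ ang g z < n + 1 := by
  obtain ⟨-, -, h1, h2, h3⟩ := hz
  rcases lt_or_gt_of_ne h3 with h | h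
  · exact ⟨2 * k, by omega, by push_cast; linarith, by push_cast; linarith⟩
  · exact ⟨2 * k + 1, by omega, by push_cast; linarith, by push_cast; linarith⟩

theorem eventually_frame_edge (hg : 1 ≤ g) (v d : ℕ → G) {z : ℂ} {k : Fin g}
    (hz : z ∈ chartSet (.edge k : Chart g r)) :
    ∀ᶠ w in 𝓝 z, frame v d (.edge k : Chart g r) w = frame v d (.edge k : Chart g r) z := by
  obtain ⟨n, -, h1, h2⟩ := exists_nat_of_mem_edge hz
  rw [frame_edge hg h1.le h2 k]
  filter_upwards [(continuousAt_ang hz.2.1).eventually (lt_mem_nhds h1),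
    (continuousAt_ang hz.2.1).eventually (gt_mem_nhds h2)] with w h3 h4
  exact frame_edge hg h3.le h4 k

theorem eventually_frame_gap (v d : ℕ → G) {z : ℂ} {j : Fin r} (hz : z.im ≠ 0) :
    ∀ᶠ w in 𝓝 z, frame v d (.gap j : Chart g r) w = frame v d (.gap j : Chart g r) z := by
  have hc : ContinuousAt Complex.im z := Complex.continuous_im.continuousAt
  rcases lt_or_gt_of_ne hz with h | h
  · filter_upwards [hc.eventually (gt_mem_nhds h)] with w hw
    simp only [frame, if_neg hw.not_gt, if_neg h.not_gt]
  · filter_upwards [hc.eventually (lt_mem_nhds h)] with w hw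
    simp only [frame, if_pos (show 0 < w.im from hw), if_pos (show 0 < z.im from h)]

/-- The angle jumps across the positive real axis between values near 0 and values near 2g, the axis
itself having angle 2g. Within an argument of π/(4g) the angle varies by less than 1/4, so the
nearest corner does not change on either side. -/
theorem eventually_frame_vertex_of_real (hg : 1 ≤ g) (v d : ℕ → G) {z : ℂ} (him : z.im = 0)
    (hre : 0 < z.re) :
    ∀ᶠ w in 𝓝 z, frame v d (.vertex : Chart g r) w = if 0 < w.im then v 0 else v (2 * g) := by
  have hz : z ∈ Complex.slitPlane := Or.inl hre
  have harg : z.arg = 0 := Complex.arg_eq_zero_iff.2 ⟨hre.le, him⟩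
  have hg' : (0 : ℝ) < g := by positivity
  have hε : 0 < Real.pi / (4 * g) := by have := Real.pi_pos; positivity
  have hc := Complex.continuousAt_arg hz
  rw [ContinuousAt, harg] at hc
  filter_upwards [hc.eventually (lt_mem_nhds (neg_lt_zero.2 hε)), hc.eventually (gt_mem_nhds hε),
    Complex.continuous_re.continuousAt.eventually (lt_mem_nhds hre)] with w h1 h2 h3
  have key : ∀ x : ℝ, -(Real.pi / (4 * g)) < x → x < Real.pi / (4 * g) →
      -(1 / 4) < g * (x / Real.pi) ∧ g * (x / Real.pi) < 1 / 4 := by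
    intro x hx1 hx2
    have hpi := Real.pi_pos
    have e : g * (x / Real.pi) = x * (g / Real.pi) := by ring
    have e2 : Real.pi / (4 * g) * (g / Real.pi) = 1 / 4 := by field_simp
    have h4 : 0 < (g : ℝ) / Real.pi := by positivity
    rw [e, ← e2]
    constructor
    · rw [← neg_mul]; exact mul_lt_mul_of_pos_right hx1 h4
    · exact mul_lt_mul_of_pos_right hx2 h4
  obtain ⟨h4, h5⟩ := key _ h1 h2
  have hadd : ang g w = g * ((-w).arg / Real.pi) + g := by unfold ang; ring
  split_ifs with h
  · have h6 : ang g w = g * (w.arg / Real.pi) := by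
      rw [hadd, Complex.arg_neg_eq_arg_sub_pi_of_im_pos h, sub_div, div_self Real.pi_ne_zero]; ring
    exact frame_vertex (by rw [h6]; push_cast; linarith) (by rw [h6]; push_cast; linarith)
  · have h6 : ang g w = g * (w.arg / Real.pi) + 2 * g := by
      rcases (not_lt.1 h).lt_or_eq with h7 | h7
      · rw [hadd, Complex.arg_neg_eq_arg_add_pi_of_im_neg h7, add_div, div_self Real.pi_ne_zero]; ring
      · rw [ang_of_im_eq_zero h7 h3, Complex.arg_eq_zero_iff.2 ⟨h3.le, h7⟩]; ring
    exact frame_vertex (by rw [h6]; push_cast; linarith) (by rw [h6]; push_cast; linarith)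

theorem gap_disjoint {i j : Fin r} {z : ℂ} (hi : z ∈ chartSet (.gap i : Chart g r))
    (hj : z ∈ chartSet (.gap j : Chart g r)) : i = j := by
  have h := holeCenter_sub i j
  have hR := holeRadius_pos r
  have h1 : (-1 : ℝ) < ((i : ℕ) : ℝ) - ((j : ℕ) : ℝ) := by
    have := hi.2.2; have := hj.2.1; nlinarith
  have h2 : ((i : ℕ) : ℝ) - ((j : ℕ) : ℝ) < 1 := by
    have := hj.2.2; have := hi.2.1; nlinarith
  have h3 : (-1 : ℤ) < ((i : ℕ) : ℤ) - ((j : ℕ) : ℤ) := by exact_mod_cast h1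
  have h4 : ((i : ℕ) : ℤ) - ((j : ℕ) : ℤ) < 1 := by exact_mod_cast h2
  exact Fin.ext (by omega)

theorem re_pos_of_mem_gap {j : Fin r} {z : ℂ} (hz : z ∈ chartSet (.gap j : Chart g r))
    (him : z.im = 0) (hn : innerRadius r < ‖z‖) : innerRadius r < z.re := by
  rw [← Complex.abs_re_eq_norm.2 him] at hn
  rcases lt_abs.1 hn with h | h
  · exact h
  · have := hz.2.1
    linarith [neg_innerRadius_lt_holeCenter j]

theorem eq_last_of_mem_gap {j : Fin r} {z : ℂ} (hz : z ∈ chartSet (.gap j : Chart g r))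
    (hre : innerRadius r < z.re) : (j : ℕ) + 1 = r := by
  have h1 := hz.2.2
  rw [holeCenter_add_gap] at h1
  by_contra h
  have h2 : (j : ℕ) + 2 ≤ r := by have := j.2; omega
  have h3 : ((j : ℕ) : ℝ) + 2 ≤ r := by exact_mod_cast h2
  have h4 : 2 * (((j : ℕ) : ℝ) + 1 - r) / (r + 1) ≤ -2 / (r + 1) := by gcongr; linarith
  have h5 : -2 / ((r : ℝ) + 1) + 1 / (r + 1) < 0 := by
    rw [← add_div]; exact div_neg_of_neg_of_pos (by norm_num) (by positivity)
  linarith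

theorem im_ne_zero_of_mem_cell_gap {j : Fin r} {z : ℂ} (hc : z ∈ chartSet (.cell : Chart g r))
    (hz : z ∈ chartSet (.gap j : Chart g r)) : z.im ≠ 0 :=
  hc.2.resolve_right fun h => (h j).not_gt hz.2.1

theorem im_ne_zero_of_mem_edge_gap {j : Fin r} {k : Fin g} {z : ℂ}
    (hc : z ∈ chartSet (.edge k : Chart g r)) (hz : z ∈ chartSet (.gap j : Chart g r)) :
    z.im ≠ 0 := by
  intro h
  have h1 := re_pos_of_mem_gap hz h hc.1
  have h2 := innerRadius_nonneg r
  rcases hc.2.1 with h3 | h3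
  · rw [Complex.neg_re] at h3; linarith
  · rw [Complex.neg_im, h, neg_zero] at h3
    exact h3 rfl

/-- Near a given point, all the frames jump in the same way. -/
theorem exists_eventually_frame_eq (hg : 1 ≤ g) (v d : ℕ → G) (hv0 : v 0 = 1) (hd0 : d 0 = 1)
    (hrel : v (2 * g) = d r) (z : ℂ) : ∃ ψ : ℂ → G, ∀ i : Chart g r, z ∈ chartSet i →
      ∀ᶠ w in 𝓝 z, frame v d i w = ψ w * frame v d i z := by
  have hA : (-z ∈ Complex.slitPlane) → (∀ j, z ∈ chartSet (.gap j : Chart g r) → z.im ≠ 0) →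
      ∃ ψ : ℂ → G, ∀ i : Chart g r, z ∈ chartSet i →
      ∀ᶠ w in 𝓝 z, frame v d i w = ψ w * frame v d i z := by
    refine fun hs hgap => ⟨fun _ => 1, fun i hi => ?_⟩
    simp only [one_mul]
    cases i with
    | cell => exact Filter.Eventually.of_forall fun _ => rfl
    | vertex => exact eventually_frame_vertex hg v d hi hs
    | gap j => exact eventually_frame_gap v d (hgap j hi)
    | edge k => exact eventually_frame_edge hg v d hi
  by_cases him : z.im = 0
  swap
  · exact hA (Or.inr (by simpa using him)) fun _ _ => him
  by_cases hgap : ∃ j, z ∈ chartSet (.gap j : Chart g r)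
  · obtain ⟨j, hj⟩ := hgap
    -- The frame of the gap jumps by d_{j+1}. The vertex chart meets the real axis inside a gap only
    -- for the last one, where its jump v(2g) is the same by the relation.
    refine ⟨fun w => if 0 < w.im then (d ((j : ℕ) + 1))⁻¹ else 1, fun i hi => ?_⟩
    cases i with
    | cell => exact absurd him (im_ne_zero_of_mem_cell_gap hi hj)
    | edge k => exact absurd him (im_ne_zero_of_mem_edge_gap hi hj)
    | gap i =>
      obtain rfl := gap_disjoint hi hj
      refine Filter.Eventually.of_forall fun w => ?_
      simp only [frame, him, lt_irrefl, if_false]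
      split_ifs <;> simp
    | vertex =>
      have h1 := re_pos_of_mem_gap hj him hi.1
      have h2 := eventually_frame_vertex_of_real (r := r) hg v d him
        ((innerRadius_nonneg r).trans_lt h1)
      have h3 := h2.self_of_nhds
      rw [him, if_neg (lt_irrefl _)] at h3
      filter_upwards [h2] with w hw
      rw [hw, h3, eq_last_of_mem_gap hj h1, ← hrel, hv0]
      split_ifs <;> simp
  · by_cases hs : -z ∈ Complex.slitPlane
    · exact hA hs fun j hj => absurd ⟨j, hj⟩ hgap
    · have hre : 0 ≤ z.re := by
        by_contra h
        exact hs (Or.inl (by rw [Complex.neg_re]; linarith))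
      by_cases hz : z ∈ chartSet (.vertex : Chart g r)
      · have h1 : 0 < z.re := by
          have := (innerRadius_nonneg r).trans_lt hz.1
          rw [← Complex.abs_re_eq_norm.2 him] at this
          exact lt_of_le_of_ne hre (abs_pos.1 this).symm
        have h2 := eventually_frame_vertex_of_real (r := r) hg v d him h1
        have h3 := h2.self_of_nhds
        rw [him, if_neg (lt_irrefl _)] at h3
        refine ⟨fun w => if 0 < w.im then (v (2 * g))⁻¹ else 1, fun i hi => ?_⟩
        cases i with
        | edge k => exact absurd hi.2.1 hs
        | gap j => exact absurd ⟨j, hi⟩ hgap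
        | vertex =>
          filter_upwards [h2] with w hw
          rw [hw, h3, hv0]
          split_ifs <;> simp
        | cell =>
          -- The cell can meet the vertex chart on the positive real axis only when there are no
          -- holes; the relation then reads v(2g) = d(0) = 1.
          have hr : r = 0 := by
            by_contra h
            have h4 := hi.2.resolve_left (not_not.2 him) ⟨r - 1, by omega⟩
            have h5 := holeCenter_lt_innerRadius (⟨r - 1, by omega⟩ : Fin r)
            have h6 := hz.1
            rw [← Complex.abs_re_eq_norm.2 him, abs_of_pos h1] at h6
            linarith
          subst hr
          refine Filter.Eventually.of_forall fun w => ?_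
          rw [hrel, hd0]
          simp [frame]
      · refine ⟨fun _ => 1, fun i hi => ?_⟩
        cases i with
        | edge k => exact absurd hi.2.1 hs
        | gap j => exact absurd ⟨j, hi⟩ hgap
        | vertex => exact absurd hi hz
        | cell => exact Filter.Eventually.of_forall fun w => by simp [frame]

/-- The transition functions between the frames are compatible with the gluing. -/
theorem frame_glue (hg : 1 ≤ g) (v d : ℕ → G)
    (hv : ∀ k : Fin g, (v (2 * k + 1))⁻¹ * v (2 * k) = (v (2 * k + 2))⁻¹ * v (2 * k + 1))
    (i j : Chart g r) (k : Fin g) {s : ℝ} (hs : s ∈ Set.Icc (0 : ℝ) 1)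
    (hi : polar g 1 (2 * (k : ℕ) + s) ∈ chartSet i) (hj : polar g 1 (2 * (k : ℕ) + s) ∈ chartSet j)
    (hi' : polar g 1 (2 * (k : ℕ) + 1 + s) ∈ chartSet i)
    (hj' : polar g 1 (2 * (k : ℕ) + 1 + s) ∈ chartSet j) :
    (frame v d i (polar g 1 (2 * (k : ℕ) + s)))⁻¹ * frame v d j (polar g 1 (2 * (k : ℕ) + s)) =
      (frame v d i (polar g 1 (2 * (k : ℕ) + 1 + s)))⁻¹ *
        frame v d j (polar g 1 (2 * (k : ℕ) + 1 + s)) := by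
  have hk : ((k : ℕ) : ℝ) + 1 ≤ g := by exact_mod_cast k.2
  have hk0 : (0 : ℝ) ≤ ((k : ℕ) : ℝ) := by positivity
  have hn : ∀ t, ¬ ‖polar g 1 t‖ < 1 := fun t => by simp [norm_polar zero_le_one]
  have hVE : ∀ k' : Fin g, polar g 1 (2 * (k : ℕ) + s) ∈ chartSet (.vertex : Chart g r) →
      polar g 1 (2 * (k : ℕ) + s) ∈ chartSet (.edge k' : Chart g r) →
      polar g 1 (2 * (k : ℕ) + 1 + s) ∈ chartSet (.edge k' : Chart g r) →
      (frame v d (.vertex : Chart g r) (polar g 1 (2 * (k : ℕ) + s)))⁻¹ *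
        frame v d (.edge k' : Chart g r) (polar g 1 (2 * (k : ℕ) + s)) =
      (frame v d (.vertex : Chart g r) (polar g 1 (2 * (k : ℕ) + 1 + s)))⁻¹ *
        frame v d (.edge k' : Chart g r) (polar g 1 (2 * (k : ℕ) + 1 + s)) := by
    intro k' hV hE hE'
    rw [polar_mem_edge_iff hg (innerRadius_lt_one r) (by linarith [hs.1]) (by linarith [hs.2])] at hE hE'
    have hs0 : 0 < s := by
      refine lt_of_le_of_ne hs.1 fun h => ?_
      subst h
      have h1 : ((k' : ℕ) : ℝ) < (k : ℕ) := by linarith [hE.1]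
      have h2 : ((k' : ℕ) : ℝ) + 1 ≤ (k : ℕ) := by
        have h3 : (k' : ℕ) < k := by exact_mod_cast h1
        exact_mod_cast h3
      linarith [hE.2.1]
    have hs1 : s < 1 := by
      refine lt_of_le_of_ne hs.2 fun h => ?_
      subst h
      have h1 : ((k : ℕ) : ℝ) < (k' : ℕ) := by linarith [hE'.2.1]
      have h2 : ((k : ℕ) : ℝ) + 1 ≤ (k' : ℕ) := by
        have h3 : (k : ℕ) < k' := by exact_mod_cast h1
        exact_mod_cast h3
      linarith [hE.1]
    have ha1 : ang g (polar g 1 (2 * (k : ℕ) + s)) = 2 * (k : ℕ) + s :=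
      ang_polar hg one_pos (by linarith) (by linarith)
    have ha2 : ang g (polar g 1 (2 * (k : ℕ) + 1 + s)) = 2 * (k : ℕ) + 1 + s :=
      ang_polar hg one_pos (by linarith) (by linarith)
    have e1 : frame v d (.edge k' : Chart g r) (polar g 1 (2 * (k : ℕ) + s)) = v (2 * k) :=
      frame_edge hg (by rw [ha1]; push_cast; linarith) (by rw [ha1]; push_cast; linarith) k'
    have e2 : frame v d (.edge k' : Chart g r) (polar g 1 (2 * (k : ℕ) + 1 + s)) = v (2 * k + 1) :=
      frame_edge hg (by rw [ha2]; push_cast; linarith) (by rw [ha2]; push_cast; linarith) k'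
    rw [e1, e2]
    -- Below 1/2 the vertex and edge frames agree on both sides. At 1/2 the point leaves the vertex
    -- chart. Above 1/2 the vertex frame has passed to the next corner, and the hypothesis equates
    -- the increments along the two identified edges.
    rcases lt_trichotomy s (1 / 2) with h | h | h
    · rw [frame_vertex (n := 2 * k) (by rw [ha1]; push_cast; linarith)
        (by rw [ha1]; push_cast; linarith), frame_vertex (n := 2 * k + 1)
        (by rw [ha2]; push_cast; linarith) (by rw [ha2]; push_cast; linarith)]
      simp
    · exfalso
      obtain ⟨n, -, h1, h2⟩ := exists_nat_of_mem_vertex hg hV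
      rw [ha1, h] at h1 h2
      have h3 : n < 2 * (k : ℕ) + 1 := by
        have : (n : ℝ) < 2 * (k : ℕ) + 1 := by linarith
        exact_mod_cast this
      have h4 : 2 * (k : ℕ) < n := by
        have : 2 * ((k : ℕ) : ℝ) < n := by linarith
        exact_mod_cast this
      omega
    · rw [frame_vertex (n := 2 * k + 1) (by rw [ha1]; push_cast; linarith)
        (by rw [ha1]; push_cast; linarith), frame_vertex (n := 2 * k + 2)
        (by rw [ha2]; push_cast; linarith) (by rw [ha2]; push_cast; linarith), hv k]
  have hEE : ∀ k₁ k₂ : Fin g, ∀ z, frame v d (.edge k₁ : Chart g r) z =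
    frame v d (.edge k₂ : Chart g r) z := fun _ _ _ => rfl
  cases i with
  | cell => exact absurd hi.1 (hn _)
  | gap => exact absurd hi.1 (hn _)
  | vertex =>
    cases j with
    | cell => exact absurd hj.1 (hn _)
    | gap => exact absurd hj.1 (hn _)
    | vertex => simp
    | edge k' => exact hVE k' hi hj hj'
  | edge k' =>
    cases j with
    | cell => exact absurd hj.1 (hn _)
    | gap => exact absurd hj.1 (hn _)
    | vertex =>
      have := congrArg (·⁻¹) (hVE k' hj hi hi')
      simpa using this
    | edge k'' => simp [hEE k'' k']

/-- Existence of the bundle with given transition functions. -/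
theorem exists_hol_frame (hg : 1 ≤ g) (v d : ℕ → G) (hv0 : v 0 = 1) (hd0 : d 0 = 1)
    (hrel : v (2 * g) = d r)
    (hv : ∀ k : Fin g, (v (2 * k + 1))⁻¹ * v (2 * k) = (v (2 * k + 2))⁻¹ * v (2 * k + 1))
    (idx : HoledSurface g r → Chart g r) (hidx : ∀ x, x ∈ region g r (chartSet (idx x))) :
    ∃ (h : Hol (HoledSurface g r) G) (l : Chart g r → HoledSurface g r → G),
      (∀ i, h.IsFrame (region g r (chartSet i)) (l i)) ∧
      (∀ i j, ∀ z ∈ holedDisc r, z ∈ chartSet i → z ∈ chartSet j →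
        l i (pt g r z) * (l j (pt g r z))⁻¹ = (frame v d i z)⁻¹ * frame v d j z) ∧
      ∀ x, l (idx x) x = 1 := by
  choose rep hrep hpt using fun p => exists_pt_eq (g := g) (r := r) p
  let c : Chart g r → Chart g r → HoledSurface g r → G := fun i j p =>
    (frame v d i (rep p))⁻¹ * frame v d j (rep p)
  have hsat : ∀ i j : Chart g r, Saturated g (chartSet i ∩ chartSet j) := fun i j =>
    (saturated_chartSet hg i).inter (saturated_chartSet hg j)
  have hcz : ∀ i j, ∀ z ∈ holedDisc r, z ∈ chartSet i → z ∈ chartSet j →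
      c i j (pt g r z) = (frame v d i z)⁻¹ * frame v d j z := by
    intro i j z hz hi hj
    refine ((eq_of_pt_eq hg (hsat i j) (fun z => (frame v d i z)⁻¹ * frame v d j z) ?_ hz (hrep _)
      (hpt _).symm).2 ⟨hi, hj⟩).symm
    exact fun k s hs h h' => frame_glue hg v d hv i j k hs h.1 h.2 h'.1 h'.2
  have hcont : ∀ i j, ∀ x ∈ region g r (chartSet i) ∩ region g r (chartSet j),
      ∀ᶠ y in 𝓝 x, c i j y = c i j x := by
    intro i j x hx
    -- A level set of the transition function. Its openness is checked on the holed disc, where the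
    -- common jump ψ cancels between the two frames.
    let A : Set (HoledSurface g r) := {p | p ∈ region g r (chartSet i ∩ chartSet j) ∧ c i j p = c i j x}
    have hA : IsOpen A := by
      rw [← isQuotientMap_domRestrict_pt.isOpen_preimage, isOpen_iff_mem_nhds]
      rintro ⟨z, hz⟩ ⟨hz1, hz2⟩
      have hz1' : z ∈ chartSet i ∩ chartSet j := (pt_mem_region_iff hg (hsat i j) hz).1 hz1
      have hz2' : c i j (pt g r z) = c i j x := hz2
      rw [hcz i j z hz hz1'.1 hz1'.2] at hz2'
      obtain ⟨ψ, hψ⟩ := exists_eventually_frame_eq (r := r) hg v d hv0 hd0 hrel z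
      have hev : ∀ᶠ w in 𝓝 z, w ∈ chartSet i ∩ chartSet j ∧
          (frame v d i w)⁻¹ * frame v d j w = c i j x := by
        filter_upwards [hψ i hz1'.1, hψ j hz1'.2,
          ((isOpen_chartSet i).inter (isOpen_chartSet j)).mem_nhds hz1'] with w h1 h2 h3
        refine ⟨h3, ?_⟩
        rw [h1, h2, ← hz2']
        group
      have hc : ContinuousAt (Subtype.val : holedDisc r → ℂ) ⟨z, hz⟩ :=
        continuous_subtype_val.continuousAt
      have hev' := hc.eventually hev
      filter_upwards [hev'] with w hw
      exact ⟨(pt_mem_region_iff hg (hsat i j) w.2).2 hw.1, by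
        change c i j (pt g r w) = _
        rw [hcz i j w w.2 hw.1.1 hw.1.2, hw.2]⟩
    have hxA : x ∈ A := by
      refine ⟨?_, rfl⟩
      rw [← hpt x, pt_mem_region_iff hg (hsat i j) (hrep x)]
      rw [← hpt x] at hx
      exact ⟨(pt_mem_region_iff hg (saturated_chartSet hg i) (hrep x)).1 hx.1,
        (pt_mem_region_iff hg (saturated_chartSet hg j) (hrep x)).1 hx.2⟩
    filter_upwards [hA.mem_nhds hxA] with y hy
    exact hy.2
  obtain ⟨h, l, h1, h2, h3⟩ := exists_hol_of_cocycle (fun i => region g r (chartSet i))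
    (fun i => isOpen_region hg (saturated_chartSet hg i) (isOpen_chartSet i)) idx hidx c
    (fun i j k x _ _ _ => by simp only [c]; group) hcont
  refine ⟨h, l, h1, fun i j z hz hi hj => ?_, h3⟩
  rw [h2 i j _ ((pt_mem_region_iff hg (saturated_chartSet hg i) hz).2 hi)
    ((pt_mem_region_iff hg (saturated_chartSet hg j) hz).2 hj), hcz i j z hz hi hj]

end Cocycle

/-! ## The transition functions of a bundle -/

section Transition

open Topology unitInterval

variable {g r : ℕ} {G : Type*} [Group G]

/-- The transition function between two frames, in the coordinates of the polygon. -/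
noncomputable def transition (l : Chart g r → HoledSurface g r → G) (i j : Chart g r) (z : ℂ) : G :=
  l i (pt g r z) * (l j (pt g r z))⁻¹

theorem transition_mul (l : Chart g r → HoledSurface g r → G) (i j k : Chart g r) (z : ℂ) :
    transition l i j z * transition l j k z = transition l i k z := by
  unfold transition; group

theorem transition_inv (l : Chart g r → HoledSurface g r → G) (i j : Chart g r) (z : ℂ) :
    (transition l i j z)⁻¹ = transition l j i z := by
  unfold transition; group

theorem transition_eq_of_mul (l : Chart g r → HoledSurface g r → G) (i j k : Chart g r) (z : ℂ) :
    transition l j k z = (transition l i j z)⁻¹ * transition l i k z := by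
  unfold transition; group

section

variable {h : Hol (HoledSurface g r) G} {l : Chart g r → HoledSurface g r → G}

theorem transition_eq_of_maps (hl : ∀ i, h.IsFrame (region g r (chartSet i)) (l i))
    {i j : Chart g r} {E : Type*} [TopologicalSpace E] {S : Set E} (hS : IsPathConnected S)
    {f : E → ℂ} (hf : ContinuousOn f S)
    (hmem : ∀ s ∈ S, f s ∈ holedDisc r ∧ f s ∈ chartSet i ∧ f s ∈ chartSet j)
    {s t : E} (hs : s ∈ S) (ht : t ∈ S) : transition l i j (f s) = transition l i j (f t) :=
  (hl i).transition_eq (hl j) hS (f := fun s => pt g r (f s))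
    (continuousOn_pt.comp hf fun s hs => (hmem s hs).1)
    (fun s hs => ⟨f s, ⟨(hmem s hs).1, (hmem s hs).2.1⟩, rfl⟩)
    (fun s hs => ⟨f s, ⟨(hmem s hs).1, (hmem s hs).2.2⟩, rfl⟩) hs ht

theorem transition_polar_eq (hl : ∀ i, h.IsFrame (region g r (chartSet i)) (l i))
    {i j : Chart g r} {J K : Set ℝ} (hJ : Convex ℝ J) (hK : Convex ℝ K)
    (hr : ∀ s ∈ J, innerRadius r < s ∧ s ≤ 1)
    (hmem : ∀ s ∈ J, ∀ t ∈ K, polar g s t ∈ chartSet i ∧ polar g s t ∈ chartSet j)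
    {s s' t t' : ℝ} (hs : s ∈ J) (hs' : s' ∈ J) (ht : t ∈ K) (ht' : t' ∈ K) :
    transition l i j (polar g s t) = transition l i j (polar g s' t') := by
  refine transition_eq_of_maps hl (S := J ×ˢ K) ((hJ.prod hK).isPathConnected ⟨(s, t), hs, ht⟩)
    (f := fun p : ℝ × ℝ => polar g p.1 p.2) continuous_polar.continuousOn ?_
    (s := (s, t)) (t := (s', t')) ⟨hs, ht⟩ ⟨hs', ht'⟩
  rintro ⟨a, b⟩ ⟨ha, hb⟩
  refine ⟨?_, hmem a ha b hb⟩
  have h0 := (innerRadius_nonneg r).trans (hr a ha).1.le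
  refine mem_holedDisc_of_innerRadius_lt ?_ ?_ <;> simp only [norm_polar h0, hr a ha]

theorem transition_push_eq (hl : ∀ i, h.IsFrame (region g r (chartSet i)) (l i))
    {i j : Chart g r} {A : Set ℂ} (hA : Convex ℝ A) (hp : A ⊆ puncturedDisc r)
    (hmem : ∀ z ∈ A, push r z ∈ chartSet i ∧ push r z ∈ chartSet j) {z w : ℂ} (hz : z ∈ A)
    (hw : w ∈ A) (hz' : z ∈ holedDisc r) (hw' : w ∈ holedDisc r) :
    transition l i j z = transition l i j w := by
  have := transition_eq_of_maps hl (hA.isPathConnected ⟨z, hz⟩) (continuousOn_push.mono hp)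
    (fun z hz => ⟨push_mem (hp hz), hmem z hz⟩) hz hw
  rwa [push_of_mem hz', push_of_mem hw'] at this

end

variable (r) in
/-- A radius between the holes and the boundary of the polygon. -/
noncomputable def midRadius : ℝ := (innerRadius r + 1) / 2

theorem innerRadius_lt_midRadius : innerRadius r < midRadius r := by
  have := innerRadius_lt_one r
  unfold midRadius; linarith

theorem midRadius_lt_one : midRadius r < 1 := by
  have := innerRadius_lt_one r
  unfold midRadius; linarith

/-- The normalization of the frames of a bundle. -/
structure IsNormalized (l : Chart g r → HoledSurface g r → G) (v d : ℕ → G) : Prop where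
  upper : ∀ j : Fin r, transition l .cell (.gap j) (gapPoint j (holeRadius r)) = 1
  lower : ∀ j : Fin r, transition l .cell (.gap j) (gapPoint j (-holeRadius r)) = d ((j : ℕ) + 1)
  sector : transition l .cell .vertex (polar g (midRadius r) (1 / 4)) = 1
  start : ∀ k : Fin g,
    transition l .vertex (.edge k) (polar g (midRadius r) (2 * (k : ℕ) + 1 / 4)) = 1
  finish : ∀ k : Fin g, transition l .vertex (.edge k) (polar g (midRadius r) (2 * (k : ℕ) + 3 / 4)) =
    (v (2 * k + 1))⁻¹ * v (2 * k)

theorem polar_mem_cell (hg : 1 ≤ g) {s t : ℝ} (hs : innerRadius r < s) (hs1 : s < 1) (ht : 0 < t)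
    (ht' : t < 2 * g) : polar g s t ∈ chartSet (.cell : Chart g r) := by
  have hs0 : 0 < s := (innerRadius_nonneg r).trans_lt hs
  refine ⟨by rwa [norm_polar hs0.le], ?_⟩
  have h1 := (neg_polar_mem_slitPlane_iff hg hs0 ht ht'.le).2 ht'
  rcases eq_or_ne (polar g s t).im 0 with h | h
  · right
    intro j
    have h2 : (polar g s t).re < 0 := by
      rcases h1 with h1 | h1
      · rw [Complex.neg_re] at h1; linarith
      · rw [Complex.neg_im, h, neg_zero] at h1
        exact absurd rfl h1
    have h3 := Complex.abs_re_eq_norm.2 h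
    rw [norm_polar hs0.le, abs_of_neg h2] at h3
    linarith [neg_innerRadius_lt_holeCenter j]
  · exact Or.inl h

theorem polar_mem_edge (hg : 1 ≤ g) {s t : ℝ} (hs : innerRadius r < s) {n : ℕ} (hn : n < 2 * g)
    (h0 : (n : ℝ) < t) (h1 : t < n + 1) (k : Fin g) (hk : n / 2 = k) :
    polar g s t ∈ chartSet (.edge k : Chart g r) := by
  have hn' : (n : ℝ) + 1 ≤ 2 * g := by exact_mod_cast hn
  have hn0 : (0 : ℝ) ≤ n := by positivity
  rw [polar_mem_edge_iff hg hs (by linarith) (by linarith), ← hk]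
  rcases Nat.even_or_odd' n with ⟨c, rfl | rfl⟩
  · have h2 : 2 * c / 2 = c := by omega
    rw [h2]; push_cast at *
    exact ⟨by linarith, by linarith, fun h => by linarith⟩
  · have h2 : (2 * c + 1) / 2 = c := by omega
    rw [h2]; push_cast at *
    exact ⟨by linarith, by linarith, fun h => by linarith⟩

theorem polar_mem_vertex_nat (hg : 1 ≤ g) {s t : ℝ} (hs : innerRadius r < s) {n : ℕ}
    (h0 : (n : ℝ) - 1 / 2 < t) (h1 : t < n + 1 / 2) :
    polar g s t ∈ chartSet (.vertex : Chart g r) :=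
  polar_mem_vertex hg hs (m := n) (by rw [abs_lt]; push_cast; constructor <;> linarith)

/-! ### Normalized frames determine the transition functions and the relation -/

namespace IsNormalized

variable {h : Hol (HoledSurface g r) G} {l : Chart g r → HoledSurface g r → G} {v d : ℕ → G}

/-- The overlap consists of an upper and a lower half. On each the transition function is constant,
by transporting a convex set with `push`, and the normalization prescribes it at one point. -/
theorem cell_gap (hN : IsNormalized l v d) (hl : ∀ i, h.IsFrame (region g r (chartSet i)) (l i))
    {j : Fin r} {z : ℂ} (hz : z ∈ holedDisc r) (hc : z ∈ chartSet (.cell : Chart g r))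
    (hj : z ∈ chartSet (.gap j : Chart g r)) :
    transition l .cell (.gap j) z = frame v d (.gap j : Chart g r) z := by
  have hR := holeRadius_pos r
  have him := im_ne_zero_of_mem_cell_gap hc hj
  have hconv : Convex ℝ (chartSet (.gap j : Chart g r)) := by
    have h1 : Convex ℝ {z : ℂ | ‖z‖ < 1} := by
      have h2 : {z : ℂ | ‖z‖ < 1} = Metric.ball 0 1 := by ext z; simp
      rw [h2]
      exact convex_ball 0 1
    exact h1.inter ((convex_halfSpace_re_gt _).inter (convex_halfSpace_re_lt _))
  have hpunct : ∀ z ∈ chartSet (.gap j : Chart g r), z.im ≠ 0 → z ∈ puncturedDisc r := by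
    refine fun z hz h => ⟨hz.1, fun i hi => h ?_⟩
    rw [hi, Complex.ofReal_im]
  have hmem : ∀ z ∈ chartSet (.gap j : Chart g r), z.im ≠ 0 →
      push r z ∈ chartSet (.cell : Chart g r) ∧ push r z ∈ chartSet (.gap j : Chart g r) :=
    fun z hz h => ⟨push_mem_cell (hpunct z hz h) ⟨hz.1, Or.inl h⟩, push_mem_gap (hpunct z hz h) hz⟩
  rcases lt_or_gt_of_ne him with h0 | h0
  · have hR' : |(-holeRadius r)| ≤ holeRadius r := by rw [abs_neg, abs_of_pos hR]
    simp only [frame, if_neg h0.not_gt]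
    rw [← hN.lower j]
    exact transition_push_eq hl (A := chartSet (.gap j : Chart g r) ∩ {z | z.im < 0})
      (hconv.inter (convex_halfSpace_im_lt _)) (fun z hz => hpunct z hz.1 (ne_of_lt hz.2))
      (fun z hz => hmem z hz.1 (ne_of_lt hz.2)) ⟨hj, h0⟩
      ⟨gapPoint_mem_gap j hR', neg_lt_zero.2 hR⟩ hz (gapPoint_mem_holedDisc j hR').1
  · have hR' : |holeRadius r| ≤ holeRadius r := by rw [abs_of_pos hR]
    simp only [frame, if_pos (show 0 < z.im from h0)]
    rw [← hN.upper j]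
    exact transition_push_eq hl (A := chartSet (.gap j : Chart g r) ∩ {z | 0 < z.im})
      (hconv.inter (convex_halfSpace_im_gt _)) (fun z hz => hpunct z hz.1 (ne_of_gt hz.2))
      (fun z hz => hmem z hz.1 (ne_of_gt hz.2)) ⟨hj, h0⟩
      ⟨gapPoint_mem_gap j hR', hR⟩ hz (gapPoint_mem_holedDisc j hR').1

/-- The overlap with one side of an edge splits at the midpoint. For the first side of the pair both
values are part of the normalization; those for the second side follow through identified boundary
points. -/
theorem vertex_edge_polar (hN : IsNormalized l v d)
    (hl : ∀ i, h.IsFrame (region g r (chartSet i)) (l i)) (hg : 1 ≤ g)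
    (hv : ∀ k : Fin g, (v (2 * k + 1))⁻¹ * v (2 * k) = (v (2 * k + 2))⁻¹ * v (2 * k + 1))
    {n : ℕ} (hn : n < 2 * g) (k : Fin g) (hk : n / 2 = k) {s : ℝ} (hs : innerRadius r < s)
    (hs1 : s ≤ 1) (t : ℝ) :
    ((n : ℝ) < t → t < n + 1 / 2 → transition l .vertex (.edge k) (polar g s t) = 1) ∧
    ((n : ℝ) + 1 / 2 < t → t < n + 1 →
      transition l .vertex (.edge k) (polar g s t) = (v (n + 1))⁻¹ * v n) := by
  have hm : midRadius r ∈ Set.Ioc (innerRadius r) 1 := ⟨innerRadius_lt_midRadius, midRadius_lt_one.le⟩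
  have h1m : (1 : ℝ) ∈ Set.Ioc (innerRadius r) 1 := ⟨innerRadius_lt_one r, le_rfl⟩
  have first : ∀ m : ℕ, m < 2 * g → m / 2 = k → ∀ s ∈ Set.Ioc (innerRadius r) 1,
      ∀ s' ∈ Set.Ioc (innerRadius r) 1, ∀ t ∈ Set.Ioo (m : ℝ) (m + 1 / 2),
      ∀ t' ∈ Set.Ioo (m : ℝ) (m + 1 / 2), transition l .vertex (.edge k) (polar g s t) =
        transition l .vertex (.edge k) (polar g s' t') := by
    intro m hm hmk s hs s' hs' t ht t' ht'
    refine transition_polar_eq hl (convex_Ioc _ _) (convex_Ioo _ _) (fun s hs => hs) ?_ hs hs' ht ht'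
    intro s hs t ht
    exact ⟨polar_mem_vertex_nat hg hs.1 (n := m) (by linarith [ht.1]) ht.2,
      polar_mem_edge hg hs.1 hm ht.1 (by linarith [ht.2]) k hmk⟩
  have second : ∀ m : ℕ, m < 2 * g → m / 2 = k → ∀ s ∈ Set.Ioc (innerRadius r) 1,
      ∀ s' ∈ Set.Ioc (innerRadius r) 1, ∀ t ∈ Set.Ioo ((m : ℝ) + 1 / 2) (m + 1),
      ∀ t' ∈ Set.Ioo ((m : ℝ) + 1 / 2) (m + 1), transition l .vertex (.edge k) (polar g s t) =
        transition l .vertex (.edge k) (polar g s' t') := by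
    intro m hm hmk s hs s' hs' t ht t' ht'
    refine transition_polar_eq hl (convex_Ioc _ _) (convex_Ioo _ _) (fun s hs => hs) ?_ hs hs' ht ht'
    intro s hs t ht
    exact ⟨polar_mem_vertex_nat hg hs.1 (n := m + 1) (by push_cast; linarith [ht.1])
      (by push_cast; linarith [ht.2]),
      polar_mem_edge hg hs.1 hm (by linarith [ht.1]) ht.2 k hmk⟩
  have glue : ∀ u ∈ Set.Icc (0 : ℝ) 1,
      transition l .vertex (.edge k) (polar g 1 (2 * (k : ℕ) + u)) =
      transition l .vertex (.edge k) (polar g 1 (2 * (k : ℕ) + 1 + u)) := by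
    intro u hu
    unfold transition
    rw [pt_glue hg k hu]
  have hk2 := k.2
  rcases Nat.even_or_odd' n with ⟨c, rfl | rfl⟩
  · have hc : c = k := by omega
    subst hc
    constructor
    · intro h0 h1
      rw [← hN.start k]
      exact first _ hn hk _ ⟨hs, hs1⟩ _ hm _ ⟨h0, h1⟩ _
        ⟨by push_cast; linarith, by push_cast; linarith⟩
    · intro h0 h1
      rw [← hN.finish k]
      exact second _ hn hk _ ⟨hs, hs1⟩ _ hm _ ⟨h0, h1⟩ _
        ⟨by push_cast; linarith, by push_cast; linarith⟩
  · have hc : c = k := by omega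
    subst hc
    constructor
    · intro h0 h1
      rw [first _ hn hk _ ⟨hs, hs1⟩ _ h1m _ ⟨h0, h1⟩ (2 * (k : ℕ) + 1 + 1 / 4)
        ⟨by push_cast; linarith, by push_cast; linarith⟩,
        ← glue _ ⟨by norm_num, by norm_num⟩, ← hN.start k]
      exact first (2 * k) (by omega) (by omega) _ h1m _ hm _
        ⟨by push_cast; linarith, by push_cast; linarith⟩ _
        ⟨by push_cast; linarith, by push_cast; linarith⟩
    · intro h0 h1
      rw [second _ hn hk _ ⟨hs, hs1⟩ _ h1m _ ⟨h0, h1⟩ (2 * (k : ℕ) + 1 + 3 / 4)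
        ⟨by push_cast; linarith, by push_cast; linarith⟩,
        ← glue _ ⟨by norm_num, by norm_num⟩, ← hv k, ← hN.finish k]
      exact second (2 * k) (by omega) (by omega) _ h1m _ hm _
        ⟨by push_cast; linarith, by push_cast; linarith⟩ _
        ⟨by push_cast; linarith, by push_cast; linarith⟩

/-- Induction around the polygon. Between the corners n and n + 1 the transition from cell to edge
is constant, while that from vertex to edge changes from 1 to v(n+1)⁻¹ v(n); so the transition from
cell to vertex changes from v(n) to v(n+1). -/
theorem cell_vertex_polar (hN : IsNormalized l v d)
    (hl : ∀ i, h.IsFrame (region g r (chartSet i)) (l i)) (hg : 1 ≤ g) (hv0 : v 0 = 1)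
    (hv : ∀ k : Fin g, (v (2 * k + 1))⁻¹ * v (2 * k) = (v (2 * k + 2))⁻¹ * v (2 * k + 1))
    (n : ℕ) (hn : n ≤ 2 * g) {s t : ℝ} (hs : innerRadius r < s) (hs1 : s < 1)
    (h0 : (n : ℝ) - 1 / 2 < t) (h1 : t < n + 1 / 2) (ht : 0 < t) (ht' : t < 2 * g) :
    transition l .cell .vertex (polar g s t) = v n := by
  have hm : midRadius r ∈ Set.Ioo (innerRadius r) 1 := ⟨innerRadius_lt_midRadius, midRadius_lt_one⟩
  have hsec : ∀ m : ℕ, ∀ s ∈ Set.Ioo (innerRadius r) 1, ∀ s' ∈ Set.Ioo (innerRadius r) 1,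
      ∀ t ∈ Set.Ioo ((m : ℝ) - 1 / 2) (m + 1 / 2) ∩ Set.Ioo (0 : ℝ) (2 * g),
      ∀ t' ∈ Set.Ioo ((m : ℝ) - 1 / 2) (m + 1 / 2) ∩ Set.Ioo (0 : ℝ) (2 * g),
      transition l .cell .vertex (polar g s t) = transition l .cell .vertex (polar g s' t') := by
    intro m s hs s' hs' t ht t' ht'
    refine transition_polar_eq hl (convex_Ioo _ _) ((convex_Ioo _ _).inter (convex_Ioo _ _))
      (fun s hs => ⟨hs.1, hs.2.le⟩) ?_ hs hs' ht ht'
    exact fun s hs t ht => ⟨polar_mem_cell hg hs.1 hs.2 ht.2.1 ht.2.2,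
      polar_mem_vertex_nat hg hs.1 ht.1.1 ht.1.2⟩
  have hg' : (1 : ℝ) ≤ g := by exact_mod_cast hg
  induction n generalizing s t with
  | zero =>
    push_cast at h0 h1
    rw [hv0, ← hN.sector]
    exact hsec 0 _ ⟨hs, hs1⟩ _ hm _ ⟨⟨by push_cast; linarith, by push_cast; linarith⟩, ht, ht'⟩ _
      ⟨⟨by push_cast; linarith, by push_cast; linarith⟩, by norm_num, by linarith⟩
  | succ n ih =>
    have hn' : (n : ℝ) + 1 ≤ 2 * g := by exact_mod_cast hn
    have hn0 : (0 : ℝ) ≤ n := by positivity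
    push_cast at h0 h1
    have hk : n / 2 < g := by omega
    have hVE := fun t => vertex_edge_polar hN hl hg hv (n := n) (by omega) ⟨n / 2, hk⟩ rfl
      innerRadius_lt_midRadius midRadius_lt_one.le t
    have e1 := ih (by omega) (s := midRadius r) (t := n + 1 / 4) hm.1 hm.2 (by linarith)
      (by linarith) (by linarith) (by linarith)
    have e2 := (hVE (n + 1 / 4)).1 (by linarith) (by linarith)
    have e3 := (hVE (n + 3 / 4)).2 (by linarith) (by linarith)
    have e4 : transition l .cell (.edge ⟨n / 2, hk⟩) (polar g (midRadius r) (n + 1 / 4)) =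
        transition l .cell (.edge ⟨n / 2, hk⟩) (polar g (midRadius r) (n + 3 / 4)) := by
      refine transition_polar_eq hl (convex_Ioo _ _) (convex_Ioo (n : ℝ) (n + 1))
        (fun s hs => ⟨hs.1, hs.2.le⟩) ?_ hm hm ⟨by linarith, by linarith⟩ ⟨by linarith, by linarith⟩
      exact fun s hs t ht => ⟨polar_mem_cell hg hs.1 hs.2 (by linarith [ht.1]) (by linarith [ht.2]),
        polar_mem_edge hg hs.1 (by omega) ht.1 ht.2 _ rfl⟩
    rw [hsec (n + 1) _ ⟨hs, hs1⟩ _ hm _ ⟨⟨by push_cast; linarith, by push_cast; linarith⟩, ht, ht'⟩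
      (n + 3 / 4) ⟨⟨by push_cast; linarith, by push_cast; linarith⟩, by linarith, by linarith⟩]
    rw [← transition_mul l .cell .vertex (.edge ⟨n / 2, hk⟩),
      ← transition_mul l .cell .vertex (.edge ⟨n / 2, hk⟩), e1, e2, e3, mul_one] at e4
    rw [eq_mul_inv_of_mul_eq e4.symm]; group

theorem cell_vertex (hN : IsNormalized l v d)
    (hl : ∀ i, h.IsFrame (region g r (chartSet i)) (l i)) (hg : 1 ≤ g) (hv0 : v 0 = 1)
    (hv : ∀ k : Fin g, (v (2 * k + 1))⁻¹ * v (2 * k) = (v (2 * k + 2))⁻¹ * v (2 * k + 1))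
    {z : ℂ} (hc : z ∈ chartSet (.cell : Chart g r)) (hV : z ∈ chartSet (.vertex : Chart g r))
    (hs : -z ∈ Complex.slitPlane) :
    transition l .cell .vertex z = frame v d (.vertex : Chart g r) z := by
  obtain ⟨n, hn, h1, h2⟩ := exists_nat_of_mem_vertex hg hV
  have h0 : 0 < ‖z‖ := (innerRadius_nonneg r).trans_lt hV.1
  rw [frame_vertex h1.le h2]
  have h3 := (neg_polar_mem_slitPlane_iff hg h0 (ang_pos hg z) (ang_le z)).1 (by rwa [polar_ang hg])
  have h4 := cell_vertex_polar hN hl hg hv0 hv n hn hV.1 hc.1 h1 h2 (ang_pos hg z) h3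
  rwa [polar_ang hg] at h4

theorem cell_edge (hN : IsNormalized l v d)
    (hl : ∀ i, h.IsFrame (region g r (chartSet i)) (l i)) (hg : 1 ≤ g) (hv0 : v 0 = 1)
    (hv : ∀ k : Fin g, (v (2 * k + 1))⁻¹ * v (2 * k) = (v (2 * k + 2))⁻¹ * v (2 * k + 1))
    {k : Fin g} {z : ℂ} (hc : z ∈ chartSet (.cell : Chart g r))
    (hE : z ∈ chartSet (.edge k : Chart g r)) :
    transition l .cell (.edge k) z = frame v d (.edge k : Chart g r) z := by
  obtain ⟨n, hn, h1, h2⟩ := exists_nat_of_mem_edge hE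
  have hk := k.2
  have hng : n < 2 * g := by omega
  have hn' : (n : ℝ) + 1 ≤ 2 * g := by exact_mod_cast hng
  have hn0 : (0 : ℝ) ≤ n := by positivity
  have hm : midRadius r ∈ Set.Ioo (innerRadius r) 1 := ⟨innerRadius_lt_midRadius, midRadius_lt_one⟩
  rw [frame_edge hg h1.le h2]
  have e1 := cell_vertex_polar hN hl hg hv0 hv n hng.le (s := midRadius r) (t := n + 1 / 4)
    hm.1 hm.2 (by linarith) (by linarith) (by linarith) (by linarith)
  have e2 := (vertex_edge_polar hN hl hg hv hng k hn hm.1 hm.2.le (n + 1 / 4)).1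
    (by linarith) (by linarith)
  have e4 : transition l .cell (.edge k) (polar g ‖z‖ (ang g z)) =
      transition l .cell (.edge k) (polar g (midRadius r) (n + 1 / 4)) := by
    refine transition_polar_eq hl (convex_Ioo _ _) (convex_Ioo (n : ℝ) (n + 1))
      (fun s hs => ⟨hs.1, hs.2.le⟩) ?_ ⟨hE.1, hc.1⟩ hm ⟨h1, h2⟩ ⟨by linarith, by linarith⟩
    exact fun s hs t ht => ⟨polar_mem_cell hg hs.1 hs.2 (by linarith [ht.1]) (by linarith [ht.2]),
      polar_mem_edge hg hs.1 (by omega) ht.1 ht.2 _ hn⟩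
  rw [polar_ang hg] at e4
  rw [e4, ← transition_mul l .cell .vertex, e1, e2, mul_one]

theorem vertex_edge (hN : IsNormalized l v d)
    (hl : ∀ i, h.IsFrame (region g r (chartSet i)) (l i)) (hg : 1 ≤ g)
    (hv : ∀ k : Fin g, (v (2 * k + 1))⁻¹ * v (2 * k) = (v (2 * k + 2))⁻¹ * v (2 * k + 1))
    {k : Fin g} {z : ℂ} (hz : z ∈ holedDisc r) (hV : z ∈ chartSet (.vertex : Chart g r))
    (hE : z ∈ chartSet (.edge k : Chart g r)) :
    transition l .vertex (.edge k) z =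
      (frame v d (.vertex : Chart g r) z)⁻¹ * frame v d (.edge k : Chart g r) z := by
  obtain ⟨n, hn, h1, h2⟩ := exists_nat_of_mem_edge hE
  obtain ⟨m, -, h3, h4⟩ := exists_nat_of_mem_vertex hg hV
  have hk := k.2
  have e := vertex_edge_polar hN hl hg hv (by omega : n < 2 * g) k hn hE.1 hz.1 (ang g z)
  rw [polar_ang hg] at e
  rw [frame_edge hg h1.le h2, frame_vertex h3.le h4]
  have h5 : m < n + 2 := by
    have : (m : ℝ) < n + 2 := by linarith
    exact_mod_cast this
  have h6 : n < m + 1 := by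
    have : (n : ℝ) < m + 1 := by linarith
    exact_mod_cast this
  obtain rfl | rfl : m = n ∨ m = n + 1 := by omega
  · rw [e.1 h1 h4]; simp
  · push_cast at h3
    rw [e.2 (by linarith) h2]

/-- A transition function is constant near a point of the positive real axis, whereas the vertex
frame jumps there. Sampling just above and just below produces the relation. -/
theorem exists_near_slit (hl : ∀ i, h.IsFrame (region g r (chartSet i)) (l i)) (hg : 1 ≤ g)
    (v d : ℕ → G) {i : Chart g r} {z : ℂ} (hV : z ∈ chartSet (.vertex : Chart g r))
    (hi : z ∈ chartSet i) (hz : ‖z‖ < 1) (him : z.im = 0) (hre : 0 < z.re) :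
    ∃ w₁ w₂ : ℂ, (∀ w, w = w₁ ∨ w = w₂ → w ∈ holedDisc r ∧ ‖w‖ < 1 ∧
      w ∈ chartSet (.vertex : Chart g r) ∧ w ∈ chartSet i ∧
      transition l i .vertex z = transition l i .vertex w) ∧ 0 < w₁.im ∧ w₂.im < 0 ∧
      frame v d (.vertex : Chart g r) w₁ = v 0 ∧ frame v d (.vertex : Chart g r) w₂ = v (2 * g) := by
  have hopen : IsOpen {w : ℂ | ‖w‖ < 1} := isOpen_lt continuous_norm continuous_const
  have hev := (eventually_frame_vertex_of_real (r := r) hg v d him hre).and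
    ((hopen.eventually_mem hz).and (((isOpen_chartSet .vertex).eventually_mem hV).and
      ((isOpen_chartSet i).eventually_mem hi)))
  obtain ⟨ε, hε, hball⟩ := Metric.eventually_nhds_iff_ball.1 hev
  have hw : ∀ y : ℝ, |y| < ε → z + y * Complex.I ∈ Metric.ball z ε ∧ (z + y * Complex.I).im = y := by
    intro y hy
    constructor
    · rw [Metric.mem_ball, dist_eq_norm, add_sub_cancel_left, norm_mul, Complex.norm_I, mul_one,
        Complex.norm_real]
      exact hy
    · simp [him]
  have hd : ∀ w ∈ Metric.ball z ε, w ∈ holedDisc r := fun w hw =>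
    mem_holedDisc_of_innerRadius_lt (hball w hw).2.2.1.1 (le_of_lt (hball w hw).2.1)
  have h1 := hw (ε / 2) (by rw [abs_of_pos (by linarith)]; linarith)
  have h2 := hw (-(ε / 2)) (by rw [abs_neg, abs_of_pos (by linarith)]; linarith)
  refine ⟨z + (ε / 2 : ℝ) * Complex.I, z + (-(ε / 2) : ℝ) * Complex.I, ?_, ?_, ?_, ?_, ?_⟩
  rotate_left
  · exact h1.2.symm ▸ half_pos hε
  · exact h2.2.symm ▸ neg_lt_zero.2 (half_pos hε)
  · rw [(hball _ h1.1).1, h1.2, if_pos (half_pos hε)]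
  · rw [(hball _ h2.1).1, h2.2, if_neg (by linarith)]
  · intro w hw
    have hwb : w ∈ Metric.ball z ε := by
      rcases hw with rfl | rfl
      · exact h1.1
      · exact h2.1
    refine ⟨hd w hwb, (hball w hwb).2.1, (hball w hwb).2.2.1, (hball w hwb).2.2.2, ?_⟩
    exact transition_eq_of_maps hl ((convex_ball z ε).isPathConnected ⟨w, hwb⟩) (f := id)
      continuousOn_id (fun w hw => ⟨hd w hw, (hball w hw).2.2.2, (hball w hw).2.2.1⟩)
      (Metric.mem_ball_self hε) hwb

/-- Above the axis the transition function is v(0) = 1, below it is d(r)⁻¹ v(2g); both are its value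
on the axis. -/
theorem gap_vertex (hN : IsNormalized l v d)
    (hl : ∀ i, h.IsFrame (region g r (chartSet i)) (l i)) (hg : 1 ≤ g) (hv0 : v 0 = 1)
    (hv : ∀ k : Fin g, (v (2 * k + 1))⁻¹ * v (2 * k) = (v (2 * k + 2))⁻¹ * v (2 * k + 1))
    {j : Fin r} {z : ℂ} (hV : z ∈ chartSet (.vertex : Chart g r))
    (hj : z ∈ chartSet (.gap j : Chart g r)) (him : z.im = 0) :
    transition l (.gap j) .vertex z = 1 ∧ v (2 * g) = d r := by
  have hre := re_pos_of_mem_gap hj him hV.1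
  obtain ⟨w₁, w₂, hw, hp, hm, e1, e2⟩ := exists_near_slit hl hg v d hV hj hj.1 him
    ((innerRadius_nonneg r).trans_lt hre)
  have key : ∀ w, w = w₁ ∨ w = w₂ → w.im ≠ 0 → transition l (.gap j) .vertex z =
      (frame v d (.gap j : Chart g r) w)⁻¹ * frame v d (.vertex : Chart g r) w := by
    intro w hww hne
    obtain ⟨h1, h2, h3, h4, h5⟩ := hw w hww
    have hc : w ∈ chartSet (.cell : Chart g r) := ⟨h2, Or.inl hne⟩
    rw [h5, transition_eq_of_mul l .cell, hN.cell_gap hl h1 hc h4,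
      hN.cell_vertex hl hg hv0 hv hc h3 (Or.inr (by simpa using hne))]
  have k1 := key w₁ (Or.inl rfl) hp.ne'
  have k2 := key w₂ (Or.inr rfl) hm.ne
  rw [e1] at k1
  rw [e2] at k2
  simp only [frame, if_pos hp, if_neg hm.not_gt, hv0] at k1 k2
  rw [eq_last_of_mem_gap hj hre, k1, inv_one, one_mul] at k2
  refine ⟨by rw [k1]; simp, ?_⟩
  rw [eq_comm, inv_mul_eq_one] at k2
  exact k2.symm

theorem cell_vertex_slit (hN : IsNormalized l v d)
    (hl : ∀ i, h.IsFrame (region g r (chartSet i)) (l i)) (hg : 1 ≤ g) (hv0 : v 0 = 1)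
    (hv : ∀ k : Fin g, (v (2 * k + 1))⁻¹ * v (2 * k) = (v (2 * k + 2))⁻¹ * v (2 * k + 1))
    {z : ℂ} (hV : z ∈ chartSet (.vertex : Chart g r)) (hc : z ∈ chartSet (.cell : Chart g r))
    (him : z.im = 0) (hre : 0 < z.re) :
    transition l .cell .vertex z = v 0 ∧ v (2 * g) = 1 := by
  obtain ⟨w₁, w₂, hw, hp, hm, e1, e2⟩ := exists_near_slit hl hg v d hV hc hc.1 him hre
  have key : ∀ w, w = w₁ ∨ w = w₂ → w.im ≠ 0 → transition l .cell .vertex z =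
      frame v d (.vertex : Chart g r) w := by
    intro w hww hne
    obtain ⟨h1, h2, h3, h4, h5⟩ := hw w hww
    rw [h5, hN.cell_vertex hl hg hv0 hv h4 h3 (Or.inr (by simpa using hne))]
  have k1 := key w₁ (Or.inl rfl) hp.ne'
  have k2 := key w₂ (Or.inr rfl) hm.ne
  rw [e1] at k1
  rw [e2] at k2
  exact ⟨k1, by rw [← k2, k1, hv0]⟩

/-- The relation between the holonomies. -/
theorem relation (hN : IsNormalized l v d)
    (hl : ∀ i, h.IsFrame (region g r (chartSet i)) (l i)) (hg : 1 ≤ g) (hv0 : v 0 = 1) (hd0 : d 0 = 1)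
    (hv : ∀ k : Fin g, (v (2 * k + 1))⁻¹ * v (2 * k) = (v (2 * k + 2))⁻¹ * v (2 * k + 1)) :
    v (2 * g) = d r := by
  have hm0 : 0 < midRadius r := (innerRadius_nonneg r).trans_lt innerRadius_lt_midRadius
  have hpol : polar g (midRadius r) 0 = (midRadius r : ℂ) := by simp [polar]
  have hV : (midRadius r : ℂ) ∈ chartSet (.vertex : Chart g r) := by
    rw [← hpol]
    exact polar_mem_vertex hg innerRadius_lt_midRadius (m := 0) (by norm_num)
  have hn : ‖(midRadius r : ℂ)‖ < 1 := by
    rw [Complex.norm_real, Real.norm_of_nonneg hm0.le]; exact midRadius_lt_one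
  -- Without holes the test point on the positive axis lies in the cell; otherwise it lies in the
  -- last gap, whose right end is 1.
  rcases Nat.eq_zero_or_pos r with rfl | hr
  · rw [hd0]
    refine (hN.cell_vertex_slit hl hg hv0 hv hV ⟨hn, Or.inr fun j => j.elim0⟩ (by simp) ?_).2
    simpa using hm0
  · refine (hN.gap_vertex hl hg hv0 hv (j := ⟨r - 1, by omega⟩) hV ⟨hn, ?_, ?_⟩ (by simp)).2
    · rw [Complex.ofReal_re]
      exact (holeCenter_lt_innerRadius _).trans innerRadius_lt_midRadius
    · rw [Complex.ofReal_re, holeCenter_add_gap]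
      have h1 : (((r - 1 : ℕ) : ℝ) + 1 - r) = 0 := by
        rw [Nat.cast_sub hr]; push_cast; ring
      have h6 : innerRadius r + 1 / (r + 1) = 1 := by unfold innerRadius; field_simp
      simp only [h1, mul_zero, zero_div, add_zero, h6]
      exact midRadius_lt_one

/-- The transition functions are determined by the normalization. -/
theorem transition_eq (hN : IsNormalized l v d)
    (hl : ∀ i, h.IsFrame (region g r (chartSet i)) (l i)) (hg : 1 ≤ g) (hv0 : v 0 = 1)
    (hv : ∀ k : Fin g, (v (2 * k + 1))⁻¹ * v (2 * k) = (v (2 * k + 2))⁻¹ * v (2 * k + 1))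
    {i j : Chart g r} {z : ℂ} (hz : z ∈ holedDisc r) (hi : z ∈ chartSet i) (hj : z ∈ chartSet j) :
    transition l i j z = (frame v d i z)⁻¹ * frame v d j z := by
  have hcell : ∀ i : Chart g r, z ∈ chartSet (.cell : Chart g r) → z ∈ chartSet i →
      transition l .cell i z = frame v d i z := by
    intro i hc hi
    cases i with
    | cell => simp [transition, frame]
    | gap j => exact hN.cell_gap hl hz hc hi
    | edge k => exact hN.cell_edge hl hg hv0 hv hc hi
    | vertex =>
      by_cases hs : -z ∈ Complex.slitPlane
      · exact hN.cell_vertex hl hg hv0 hv hc hi hs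
      · have him : z.im = 0 := by
          by_contra h
          exact hs (Or.inr (by simpa using h))
        have hre : 0 < z.re := by
          have h1 : 0 ≤ z.re := by
            by_contra h
            exact hs (Or.inl (by rw [Complex.neg_re]; linarith))
          have h2 := (innerRadius_nonneg r).trans_lt hi.1
          rw [← Complex.abs_re_eq_norm.2 him] at h2
          exact lt_of_le_of_ne h1 (abs_pos.1 h2).symm
        obtain ⟨h1, h2⟩ := hN.cell_vertex_slit hl hg hv0 hv hi hc him hre
        have h3 := (eventually_frame_vertex_of_real (r := r) hg v d him hre).self_of_nhds
        rw [him, if_neg (lt_irrefl _)] at h3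
        rw [h1, h3, h2, hv0]
  by_cases hc : z ∈ chartSet (.cell : Chart g r)
  · rw [transition_eq_of_mul l .cell, hcell i hc hi, hcell j hc hj]
  have hgim : ∀ {j : Fin r}, z ∈ chartSet (.gap j : Chart g r) → z.im = 0 := by
    intro j hj
    by_contra h
    exact hc ⟨hj.1, Or.inl h⟩
  have hself : ∀ i : Chart g r, transition l i i z = (frame v d i z)⁻¹ * frame v d i z :=
    fun i => by simp [transition]
  have hsymm : ∀ i j : Chart g r, transition l i j z = (frame v d i z)⁻¹ * frame v d j z →
      transition l j i z = (frame v d j z)⁻¹ * frame v d i z := by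
    intro i j h
    rw [← transition_inv, h]; group
  have hGV : ∀ j : Fin r, z ∈ chartSet (.gap j : Chart g r) → z ∈ chartSet (.vertex : Chart g r) →
      transition l (.gap j) .vertex z =
        (frame v d (.gap j : Chart g r) z)⁻¹ * frame v d (.vertex : Chart g r) z := by
    intro j hj hV
    have him := hgim hj
    obtain ⟨h1, h2⟩ := hN.gap_vertex hl hg hv0 hv hV hj him
    have hre := re_pos_of_mem_gap hj him hV.1
    have h3 := (eventually_frame_vertex_of_real (r := r) hg v d him
      ((innerRadius_nonneg r).trans_lt hre)).self_of_nhds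
    rw [him, if_neg (lt_irrefl _)] at h3
    rw [h1, h3, h2]
    simp only [frame, him, lt_irrefl, if_false, eq_last_of_mem_gap hj hre, inv_mul_cancel]
  cases i with
  | cell => exact absurd hi hc
  | gap i =>
    cases j with
    | cell => exact absurd hj hc
    | gap j => obtain rfl := gap_disjoint hi hj; exact hself _
    | vertex => exact hGV i hi hj
    | edge k => exact absurd (hgim hi) (im_ne_zero_of_mem_edge_gap hj hi)
  | vertex =>
    cases j with
    | cell => exact absurd hj hc
    | gap j => exact hsymm _ _ (hGV j hj hi)
    | vertex => exact hself _
    | edge k => exact hN.vertex_edge hl hg hv hz hi hj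
  | edge k =>
    cases j with
    | cell => exact absurd hj hc
    | gap j => exact absurd (hgim hj) (im_ne_zero_of_mem_edge_gap hi hj)
    | vertex => exact hsymm _ _ (hN.vertex_edge hl hg hv hz hj hi)
    | edge k' =>
      have hkk : k = k' := by
        obtain ⟨n, hn, h1, h2⟩ := exists_nat_of_mem_edge hi
        obtain ⟨m, hm, h3, h4⟩ := exists_nat_of_mem_edge hj
        have h5 : n < m + 1 := by
          have : (n : ℝ) < m + 1 := by linarith
          exact_mod_cast this
        have h6 : m < n + 1 := by
          have : (m : ℝ) < n + 1 := by linarith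
          exact_mod_cast this
        exact Fin.ext (by rw [← hn, ← hm, (by omega : n = m)])
      subst hkk
      exact hself _

end IsNormalized

end Transition

/-! ## Bundles and tuples -/

section Tuples

open Topology unitInterval

variable {g r : ℕ} {G : Type*} [Group G]

/-- The products of the first elements of a sequence. -/
def partialProd (f : ℕ → G) : ℕ → G
  | 0 => 1
  | n + 1 => partialProd f n * f n

theorem partialProd_eq_prod_ofFn (f : ℕ → G) (n : ℕ) :
    partialProd f n = (List.ofFn fun i : Fin n => f i).prod := by
  induction n with
  | zero => simp [partialProd]
  | succ n ih => rw [partialProd, List.ofFn_succ', List.concat_eq_append, List.prod_append, ih]; simp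

theorem partialProd_div_two (f : ℕ → G) (n : ℕ) :
    partialProd (fun m => f (m / 2)) (2 * n) = partialProd (fun m => f m ^ 2) n := by
  induction n with
  | zero => rfl
  | succ n ih =>
    rw [Nat.mul_succ, partialProd, partialProd, partialProd, ih, mul_assoc]
    have h1 : (2 * n + 1) / 2 = n := by omega
    have h2 : 2 * n / 2 = n := by omega
    rw [h1, h2, pow_two]

/-- Extension of a tuple by the neutral element. -/
def extend {n : ℕ} (f : Fin n → G) (m : ℕ) : G := if h : m < n then f ⟨m, h⟩ else 1

theorem extend_coe {n : ℕ} (f : Fin n → G) (i : Fin n) : extend f i = f i := dif_pos i.2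

/-- The values at the corners of the polygon, from the holonomies along the edges. -/
def corner (a : Fin g → G) : ℕ → G := partialProd fun m => extend a (m / 2)

/-- The values at the gaps between the holes, from the holonomies around the holes. -/
def gapVal (k : Fin r → G) : ℕ → G := partialProd (extend k)

/-- Both edges of a pair carry the same element, as the word a a prescribes; together with
`corner_finish` this is the compatibility required by the gluing. -/
theorem corner_start (a : Fin g → G) (k : Fin g) :
    (corner a (2 * k + 1))⁻¹ * corner a (2 * k) = (a k)⁻¹ := by
  have h2 : 2 * (k : ℕ) / 2 = k := by omega
  rw [corner, partialProd, h2, extend_coe]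
  group

theorem corner_finish (a : Fin g → G) (k : Fin g) :
    (corner a (2 * k + 2))⁻¹ * corner a (2 * k + 1) = (a k)⁻¹ := by
  have h2 : (2 * (k : ℕ) + 1) / 2 = k := by omega
  rw [corner, partialProd, h2, extend_coe]
  group

theorem corner_two_mul (a : Fin g → G) : corner a (2 * g) = (List.ofFn fun i => a i ^ 2).prod := by
  rw [corner, partialProd_div_two, partialProd_eq_prod_ofFn]
  simp only [extend_coe]

theorem gapVal_self (k : Fin r → G) : gapVal k r = (List.ofFn k).prod := by
  rw [gapVal, partialProd_eq_prod_ofFn]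
  simp only [extend_coe]

theorem gapVal_succ (k : Fin r → G) (j : Fin r) : gapVal k ((j : ℕ) + 1) = gapVal k j * k j := by
  rw [gapVal, partialProd, extend_coe]

theorem gapVal_inv_mul (d : ℕ → G) (hd : d 0 = 1) (n : ℕ) (hn : n ≤ r) :
    gapVal (fun j : Fin r => (d j)⁻¹ * d ((j : ℕ) + 1)) n = d n := by
  induction n with
  | zero => exact hd.symm
  | succ n ih =>
    have := gapVal_succ (fun j : Fin r => (d j)⁻¹ * d ((j : ℕ) + 1)) ⟨n, hn⟩
    rw [this, ih (by omega)]
    simp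

/-! ### Points in the intersections of the charts -/

theorem gapPoint_mem_cell (j : Fin r) {y : ℝ} (hy : |y| ≤ holeRadius r) (hy0 : y ≠ 0) :
    gapPoint j y ∈ chartSet (.cell : Chart g r) :=
  ⟨(gapPoint_mem_holedDisc j hy).2, Or.inl hy0⟩

theorem polar_midRadius_mem_holedDisc (t : ℝ) : polar g (midRadius r) t ∈ holedDisc r := by
  have h0 : 0 ≤ midRadius r := (innerRadius_nonneg r).trans innerRadius_lt_midRadius.le
  refine mem_holedDisc_of_innerRadius_lt ?_ ?_ <;> rw [norm_polar h0]
  · exact innerRadius_lt_midRadius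
  · exact midRadius_lt_one.le

theorem sector_mem (hg : 1 ≤ g) : polar g (midRadius r) (1 / 4) ∈ chartSet (.cell : Chart g r) ∧
    polar g (midRadius r) (1 / 4) ∈ chartSet (.vertex : Chart g r) := by
  have hg' : (1 : ℝ) ≤ g := by exact_mod_cast hg
  exact ⟨polar_mem_cell hg innerRadius_lt_midRadius midRadius_lt_one (by norm_num) (by linarith),
    polar_mem_vertex_nat hg innerRadius_lt_midRadius (n := 0) (by norm_num) (by norm_num)⟩

theorem start_mem (hg : 1 ≤ g) (k : Fin g) :
    polar g (midRadius r) (2 * (k : ℕ) + 1 / 4) ∈ chartSet (.vertex : Chart g r) ∧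
    polar g (midRadius r) (2 * (k : ℕ) + 1 / 4) ∈ chartSet (.edge k : Chart g r) := by
  have hk := k.2
  exact ⟨polar_mem_vertex_nat hg innerRadius_lt_midRadius (n := 2 * k) (by push_cast; linarith)
    (by push_cast; linarith), polar_mem_edge hg innerRadius_lt_midRadius (n := 2 * k) (by omega)
    (by push_cast; linarith) (by push_cast; linarith) k (by omega)⟩

theorem finish_mem (hg : 1 ≤ g) (k : Fin g) :
    polar g (midRadius r) (2 * (k : ℕ) + 3 / 4) ∈ chartSet (.vertex : Chart g r) ∧
    polar g (midRadius r) (2 * (k : ℕ) + 3 / 4) ∈ chartSet (.edge k : Chart g r) := by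
  have hk := k.2
  exact ⟨polar_mem_vertex_nat hg innerRadius_lt_midRadius (n := 2 * k + 1) (by push_cast; linarith)
    (by push_cast; linarith), polar_mem_edge hg innerRadius_lt_midRadius (n := 2 * k) (by omega)
    (by push_cast; linarith) (by push_cast; linarith) k (by omega)⟩

theorem isPathConnected_region (hg : 1 ≤ g) (i : Chart g r) :
    IsPathConnected (region g r (chartSet i)) := by
  have := contractibleSpace_chart hg i
  exact isPathConnected_iff_pathConnectedSpace.2 inferInstance

theorem pathConnectedSpace_holedSurface (hg : 1 ≤ g) : PathConnectedSpace (HoledSurface g r) := by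
  have hR := holeRadius_pos r
  have hR' : |holeRadius r| ≤ holeRadius r := by rw [abs_of_pos hR]
  have key : ∀ (i : Chart g r) (z w : ℂ), z ∈ holedDisc r → z ∈ chartSet i → w ∈ holedDisc r →
      w ∈ chartSet i → Joined (pt g r z) (pt g r w) := fun i z w hz hzi hw hwi =>
    ((isPathConnected_region hg i).joinedIn _ ⟨z, ⟨hz, hzi⟩, rfl⟩ _ ⟨w, ⟨hw, hwi⟩, rfl⟩).joined
  have hb : ∀ p : HoledSurface g r, Joined p (pt g r (polar g (midRadius r) (1 / 4))) := by
    intro p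
    obtain ⟨z, hz, rfl⟩ := exists_pt_eq p
    obtain ⟨i, hi⟩ := exists_mem_chartSet (g := g) hg hz
    have hs := sector_mem (g := g) (r := r) hg
    have hd := polar_midRadius_mem_holedDisc (g := g) (r := r)
    cases i with
    | cell => exact key _ _ _ hz hi (hd _) hs.1
    | vertex => exact key _ _ _ hz hi (hd _) hs.2
    | gap j =>
      have h1 := (gapPoint_mem_holedDisc j hR').1
      exact (key _ _ _ hz hi h1 (gapPoint_mem_gap j hR')).trans
        (key _ _ _ h1 (gapPoint_mem_cell j hR' hR.ne') (hd _) hs.1)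
    | edge k =>
      exact (key _ _ _ hz hi (hd _) (start_mem hg k).2).trans
        (key _ _ _ (hd _) (start_mem hg k).1 (hd _) hs.2)
  exact ⟨⟨pt g r 1⟩, fun p q => (hb p).trans (hb q).symm⟩

/-! ### Normalized frames -/

theorem isNormalized_of_transition_eq (hg : 1 ≤ g) {l : Chart g r → HoledSurface g r → G}
    {v d : ℕ → G} (hv0 : v 0 = 1)
    (hl : ∀ i j, ∀ z ∈ holedDisc r, z ∈ chartSet i → z ∈ chartSet j →
      transition l i j z = (frame v d i z)⁻¹ * frame v d j z) : IsNormalized l v d := by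
  have hR := holeRadius_pos r
  have hg' : (1 : ℝ) ≤ g := by exact_mod_cast hg
  have hm0 : 0 < midRadius r := (innerRadius_nonneg r).trans_lt innerRadius_lt_midRadius
  have hR1 : |holeRadius r| ≤ holeRadius r := by rw [abs_of_pos hR]
  have hR2 : |(-holeRadius r)| ≤ holeRadius r := by rw [abs_neg, abs_of_pos hR]
  have hd := polar_midRadius_mem_holedDisc (g := g) (r := r)
  have hang : ∀ t : ℝ, 0 < t → t ≤ 2 * g → ang g (polar g (midRadius r) t) = t :=
    fun t h h' => ang_polar hg hm0 h h'
  refine ⟨fun j => ?_, fun j => ?_, ?_, fun k => ?_, fun k => ?_⟩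
  · rw [hl _ _ _ (gapPoint_mem_holedDisc j hR1).1 (gapPoint_mem_cell j hR1 hR.ne')
      (gapPoint_mem_gap j hR1)]
    simp [frame, gapPoint, hR]
  · rw [hl _ _ _ (gapPoint_mem_holedDisc j hR2).1 (gapPoint_mem_cell j hR2 (neg_ne_zero.2 hR.ne'))
      (gapPoint_mem_gap j hR2)]
    simp [frame, gapPoint, hR.le]
  · rw [hl _ _ _ (hd _) (sector_mem hg).1 (sector_mem hg).2]
    have h1 := hang (1 / 4) (by norm_num) (by linarith)
    rw [frame_vertex (n := 0) (by rw [h1]; norm_num) (by rw [h1]; norm_num), hv0]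
    simp [frame]
  · have hk : ((k : ℕ) : ℝ) + 1 ≤ g := by exact_mod_cast k.2
    rw [hl _ _ _ (hd _) (start_mem hg k).1 (start_mem hg k).2]
    have h1 := hang (2 * (k : ℕ) + 1 / 4) (by positivity) (by linarith)
    rw [frame_vertex (n := 2 * k) (by rw [h1]; push_cast; linarith) (by rw [h1]; push_cast; linarith),
      frame_edge hg (n := 2 * k) (by rw [h1]; push_cast; linarith)
        (by rw [h1]; push_cast; linarith) k, inv_mul_cancel]
  · have hk : ((k : ℕ) : ℝ) + 1 ≤ g := by exact_mod_cast k.2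
    rw [hl _ _ _ (hd _) (finish_mem hg k).1 (finish_mem hg k).2]
    have h1 := hang (2 * (k : ℕ) + 3 / 4) (by positivity) (by linarith)
    rw [frame_vertex (n := 2 * k + 1) (by rw [h1]; push_cast; linarith)
      (by rw [h1]; push_cast; linarith),
      frame_edge hg (n := 2 * k) (by rw [h1]; push_cast; linarith)
        (by rw [h1]; push_cast; linarith) k]

/-- Every bundle has normalized frames. -/
theorem exists_isNormalized (hg : 1 ≤ g) (h : Hol (HoledSurface g r) G) (y₀ : HoledSurface g r)
    (i₀ : Chart g r) : ∃ (l : Chart g r → HoledSurface g r → G) (a : Fin g → G) (k : Fin r → G),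
      (∀ i, h.IsFrame (region g r (chartSet i)) (l i)) ∧ IsNormalized l (corner a) (gapVal k) ∧
      l i₀ y₀ = 1 := by
  have hex : ∀ i : Chart g r, ∃ l, h.IsFrame (region g r (chartSet i)) l := fun i => by
    have := contractibleSpace_chart hg i
    exact h.exists_isFrame _
  choose m hm using hex
  -- Frames may be changed by left constants. The constants are chosen along a tree rooted at the
  -- cell, going to the gaps and the vertex and from the vertex to the edges, so as to trivialize
  -- one transition value per branch.
  let b : Chart g r → G
    | .cell => 1
    | .vertex => transition m .cell .vertex (polar g (midRadius r) (1 / 4))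
    | .gap j => transition m .cell (.gap j) (gapPoint j (holeRadius r))
    | .edge k => transition m .cell .vertex (polar g (midRadius r) (1 / 4)) *
        transition m .vertex (.edge k) (polar g (midRadius r) (2 * (k : ℕ) + 1 / 4))
  -- The remaining common constant only conjugates the transition functions; it is used to fix the
  -- frame at the base point.
  let c := (b i₀ * m i₀ y₀)⁻¹
  let l : Chart g r → HoledSurface g r → G := fun i x => c * (b i * m i x)
  have htr : ∀ i j z, transition l i j z = c * (b i * transition m i j z * (b j)⁻¹) * c⁻¹ :=
    fun i j z => by simp only [transition, l]; group
  let d : ℕ → G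
    | 0 => 1
    | n + 1 => extend (fun j : Fin r =>
        transition l .cell (.gap j) (gapPoint j (-holeRadius r))) n
  refine ⟨l, fun k => (transition l .vertex (.edge k)
    (polar g (midRadius r) (2 * (k : ℕ) + 3 / 4)))⁻¹, fun j => (d j)⁻¹ * d ((j : ℕ) + 1),
    fun i => ((hm i).const_mul (b i)).const_mul c, ⟨fun j => ?_, fun j => ?_, ?_, fun k => ?_,
    fun k => ?_⟩, inv_mul_cancel _⟩
  · rw [htr]
    simp only [b]; group
  · rw [gapVal_inv_mul d rfl _ j.2]
    exact (extend_coe (fun j : Fin r =>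
      transition l .cell (.gap j) (gapPoint j (-holeRadius r))) j).symm
  · rw [htr]
    simp only [b]; group
  · rw [htr]
    simp only [b]; group
  · rw [corner_start, inv_inv]

/-- The holonomies of loops determine the normalized holonomies. -/
theorem eq_of_val_eq {h h' : Hol (HoledSurface g r) G} (hg : 1 ≤ g)
    {y₀ : HoledSurface g r} {i₀ : Chart g r} (hy₀ : y₀ ∈ region g r (chartSet i₀))
    (hh : ∀ p : Path y₀ y₀, h.val p = h'.val p) {l l' : Chart g r → HoledSurface g r → G}
    (hl : ∀ i, h.IsFrame (region g r (chartSet i)) (l i))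
    (hl' : ∀ i, h'.IsFrame (region g r (chartSet i)) (l' i)) {a a' : Fin g → G} {k k' : Fin r → G}
    (hN : IsNormalized l (corner a) (gapVal k)) (hN' : IsNormalized l' (corner a') (gapVal k'))
    (h1 : l i₀ y₀ = 1) (h1' : l' i₀ y₀ = 1) : a = a' ∧ k = k' := by
  have := pathConnectedSpace_holedSurface (r := r) hg
  obtain ⟨b, hb, hval⟩ := Hol.exists_gauge (h := h) (h' := h') y₀ hh
  -- After the change of gauge both families are frames of the same bundle and differ by a constant
  -- on each chart. The normalizations force all these constants to be equal, and the base point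
  -- forces them to be 1.
  have hl'' : ∀ i, h.IsFrame (region g r (chartSet i)) fun x => l' i x * (b x)⁻¹ := by
    intro i x y p hp
    rw [hval p, hl' i p hp]
    group
  choose c hc using fun i => (hl i).exists_eq_mul (hl'' i) (isPathConnected_region hg i)
  have hci : c i₀ = 1 := by
    have := hc i₀ y₀ hy₀
    rw [h1, h1', hb] at this
    simpa using this.symm
  have htr : ∀ i j z, z ∈ holedDisc r → z ∈ chartSet i → z ∈ chartSet j →
      transition l' i j z = c i * transition l i j z * (c j)⁻¹ := by
    intro i j z hz hi hj
    have e1 := hc i _ ⟨z, ⟨hz, hi⟩, rfl⟩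
    have e2 := hc j _ ⟨z, ⟨hz, hj⟩, rfl⟩
    rw [mul_inv_eq_iff_eq_mul] at e1 e2
    rw [transition, transition, e1, e2]
    group
  have hR := holeRadius_pos r
  have hR1 : |holeRadius r| ≤ holeRadius r := by rw [abs_of_pos hR]
  have hR2 : |(-holeRadius r)| ≤ holeRadius r := by rw [abs_neg, abs_of_pos hR]
  have hd := polar_midRadius_mem_holedDisc (g := g) (r := r)
  have hcG : ∀ j : Fin r, c (.gap j) = c .cell := by
    intro j
    have := htr _ _ _ (gapPoint_mem_holedDisc j hR1).1 (gapPoint_mem_cell j hR1 hR.ne')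
      (gapPoint_mem_gap j hR1)
    rw [hN.upper, hN'.upper, mul_one, eq_comm, mul_inv_eq_one] at this
    exact this.symm
  have hcV : c .vertex = c .cell := by
    have := htr _ _ _ (hd _) (sector_mem hg).1 (sector_mem hg).2
    rw [hN.sector, hN'.sector, mul_one, eq_comm, mul_inv_eq_one] at this
    exact this.symm
  have hcE : ∀ k : Fin g, c (.edge k) = c .cell := by
    intro k
    have := htr _ _ _ (hd _) (start_mem hg k).1 (start_mem hg k).2
    rw [hN.start, hN'.start, mul_one, eq_comm, mul_inv_eq_one, hcV] at this
    exact this.symm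
  have hcell : c .cell = 1 := by
    rw [← hci]
    cases i₀ with
    | cell => rfl
    | vertex => exact hcV.symm
    | gap j => exact (hcG j).symm
    | edge k => exact (hcE k).symm
  constructor
  · funext i
    have := htr _ _ _ (hd _) (finish_mem hg i).1 (finish_mem hg i).2
    rw [hN.finish, hN'.finish, corner_start, corner_start, hcE, hcV, hcell] at this
    simpa using this.symm
  · have hgap : ∀ n ≤ r, gapVal k n = gapVal k' n := by
      intro n hn
      cases n with
      | zero => rfl
      | succ n =>
        have := htr _ _ _ (gapPoint_mem_holedDisc ⟨n, hn⟩ hR2).1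
          (gapPoint_mem_cell ⟨n, hn⟩ hR2 (neg_ne_zero.2 hR.ne')) (gapPoint_mem_gap ⟨n, hn⟩ hR2)
        rw [hN.lower, hN'.lower, hcG, hcell] at this
        simpa using this.symm
    funext j
    have e1 := gapVal_succ k j
    rw [hgap _ j.2, hgap _ j.2.le, gapVal_succ k' j] at e1
    exact (mul_left_cancel e1).symm

/-- The normalized holonomies determine the holonomies of loops. -/
theorem IsNormalized.val_eq {h h' : Hol (HoledSurface g r) G} (hg : 1 ≤ g)
    {y₀ : HoledSurface g r} {i₀ : Chart g r} (hy₀ : y₀ ∈ region g r (chartSet i₀))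
    {l l' : Chart g r → HoledSurface g r → G}
    (hl : ∀ i, h.IsFrame (region g r (chartSet i)) (l i))
    (hl' : ∀ i, h'.IsFrame (region g r (chartSet i)) (l' i)) {a : Fin g → G} {k : Fin r → G}
    (hN : IsNormalized l (corner a) (gapVal k)) (hN' : IsNormalized l' (corner a) (gapVal k))
    (h1 : l i₀ y₀ = 1) (h1' : l' i₀ y₀ = 1) (p : Path y₀ y₀) : h.val p = h'.val p := by
  have hv : ∀ k : Fin g, (corner a (2 * k + 1))⁻¹ * corner a (2 * k) =
      (corner a (2 * k + 2))⁻¹ * corner a (2 * k + 1) := fun k => by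
    rw [corner_start, corner_finish]
  have key := Hol.frame_mul_val_eq (h := h) (h' := h') (U := fun i : Chart g r => region g r (chartSet i))
    (fun i => isOpen_region hg (saturated_chartSet hg i) (isOpen_chartSet i)) ?_ hl hl' ?_ p hy₀ hy₀
  · simpa [h1, h1'] using key
  · intro x
    obtain ⟨z, hz, rfl⟩ := exists_pt_eq x
    obtain ⟨i, hi⟩ := exists_mem_chartSet (g := g) hg hz
    exact ⟨i, z, ⟨hz, hi⟩, rfl⟩
  · intro i j x hxi hxj
    obtain ⟨z, hz, rfl⟩ := exists_pt_eq x
    have hi := (pt_mem_region_iff hg (saturated_chartSet hg i) hz).1 hxi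
    have hj := (pt_mem_region_iff hg (saturated_chartSet hg j) hz).1 hxj
    exact (hN.transition_eq hl hg rfl hv hz hi hj).trans (hN'.transition_eq hl' hg rfl hv hz hi hj).symm

/-- Existence of the bundle with given holonomies. -/
theorem exists_hol_isNormalized (hg : 1 ≤ g) (a : Fin g → G) (k : Fin r → G)
    (hrel : (List.ofFn fun i => a i ^ 2).prod = (List.ofFn k).prod)
    (y₀ : HoledSurface g r) {i₀ : Chart g r} (hy₀ : y₀ ∈ region g r (chartSet i₀)) :
    ∃ (h : Hol (HoledSurface g r) G) (l : Chart g r → HoledSurface g r → G),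
      (∀ i, h.IsFrame (region g r (chartSet i)) (l i)) ∧ IsNormalized l (corner a) (gapVal k) ∧
      l i₀ y₀ = 1 := by
  classical
  have hcov : ∀ x : HoledSurface g r, ∃ i : Chart g r, x ∈ region g r (chartSet i) := by
    intro x
    obtain ⟨z, hz, rfl⟩ := exists_pt_eq x
    obtain ⟨i, hi⟩ := exists_mem_chartSet (g := g) hg hz
    exact ⟨i, z, ⟨hz, hi⟩, rfl⟩
  choose idx hidx using hcov
  -- The fibre over the base point is trivialized by the chart i₀, so that the frame of i₀ takes the
  -- value 1 there.
  obtain ⟨h, l, h1, h2, h3⟩ := exists_hol_frame hg (corner a) (gapVal k) rfl rfl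
    (by rw [corner_two_mul, gapVal_self, hrel]) (fun k => by rw [corner_start, corner_finish])
    (Function.update idx y₀ i₀) (fun x => by
      rcases eq_or_ne x y₀ with rfl | hx
      · rwa [Function.update_self]
      · rw [Function.update_of_ne hx]; exact hidx x)
  refine ⟨h, l, h1, isNormalized_of_transition_eq hg rfl h2, ?_⟩
  have := h3 y₀
  rwa [Function.update_self] at this

end Tuples

/-! ## Holonomy around the holes -/

section Boundary

open Topology unitInterval

variable {g r : ℕ} {G : Type*} [Group G]

theorem Hol.IsFrame.val_subpath {X : Type*} [TopologicalSpace X] {h : Hol X G} {U : Set X}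
    {l : X → G} (hl : h.IsFrame U l) {x y : X} (p : Path x y) {s t : I} (hst : s ≤ t)
    (hp : ∀ u : I, s ≤ u → u ≤ t → p u ∈ U) :
    h.val (p.subpath s t) = (l (p s))⁻¹ * l (p t) := by
  refine hl _ fun u => ?_
  have h1 : p.subpath s t u ∈ Set.range (p.subpath s t) := ⟨u, rfl⟩
  rw [Path.range_subpath_of_le _ _ _ hst] at h1
  obtain ⟨w, hw, hw'⟩ := h1
  rw [← hw']
  exact hp w hw.1 hw.2

theorem holeBdry_re (j : Fin r) (t : ℝ) :
    (holeBdry j t).re = holeCenter j + holeRadius r * Real.cos (2 * Real.pi * t) := by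
  rw [holeBdry, Complex.add_re, Complex.ofReal_re, Complex.re_ofReal_mul, Complex.exp_ofReal_mul_I_re]

theorem holeBdry_im (j : Fin r) (t : ℝ) :
    (holeBdry j t).im = holeRadius r * Real.sin (2 * Real.pi * t) := by
  rw [holeBdry, Complex.add_im, Complex.ofReal_im, Complex.im_ofReal_mul, Complex.exp_ofReal_mul_I_im,
    zero_add]

theorem norm_holeBdry_lt (j : Fin r) (t : ℝ) : ‖holeBdry j t‖ < 1 :=
  norm_lt_one_of_dist_le (dist_holeBdry j t).le

theorem holeBdry_mem_holedDisc (j : Fin r) (t : ℝ) : holeBdry j t ∈ holedDisc r := by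
  refine ⟨(norm_holeBdry_lt j t).le, fun i => ?_⟩
  have hd := dist_holeBdry j t
  rcases eq_or_ne i j with rfl | hij
  · exact hd.ge
  · have h1 := dist_triangle_left (holeCenter i : ℂ) (holeCenter j : ℂ) (holeBdry j t)
    rw [dist_eq_norm, ← Complex.ofReal_sub, Complex.norm_real, Real.norm_eq_abs] at h1
    linarith [two_mul_holeRadius_lt hij]

theorem boundaryCircle_apply (j : Fin r) (t : I) :
    boundaryCircle g j t = pt g r (holeBdry j t) := by
  rw [pt_of_mem (holeBdry_mem_holedDisc j t)]
  rfl

theorem holeBdry_mem_gap {j : Fin r} {t : ℝ} (h : 0 < Real.cos (2 * Real.pi * t)) :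
    holeBdry j t ∈ chartSet (.gap j : Chart g r) := by
  have hR := holeRadius_pos r
  have h1 := Real.cos_le_one (2 * Real.pi * t)
  refine ⟨norm_holeBdry_lt j t, ?_, ?_⟩ <;> rw [holeBdry_re]
  · nlinarith
  · nlinarith

theorem holeBdry_mem_cell {j : Fin r} {t : ℝ} (h : Real.sin (2 * Real.pi * t) ≠ 0) :
    holeBdry j t ∈ chartSet (.cell : Chart g r) :=
  ⟨norm_holeBdry_lt j t, Or.inl (by
    rw [holeBdry_im]; exact mul_ne_zero (holeRadius_pos r).ne' h)⟩

/-- The chart to the left of a hole. -/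
theorem exists_chart_left (j : Fin r) (v d : ℕ → G) (hd0 : d 0 = 1) : ∃ i : Chart g r,
    (∀ t, Real.cos (2 * Real.pi * t) < 0 → holeBdry j t ∈ chartSet i) ∧
    (∀ z, 0 < z.im → frame v d i z = 1) ∧ (∀ z, z.im < 0 → frame v d i z = d j) := by
  have hR := holeRadius_pos r
  rcases Nat.eq_zero_or_pos (j : ℕ) with hj | hj
  · refine ⟨.cell, fun t ht => ⟨norm_holeBdry_lt j t, Or.inr fun i => ?_⟩, fun _ _ => rfl,
      fun _ _ => by rw [hj, hd0]; rfl⟩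
    rw [holeBdry_re]
    have h1 : holeCenter j ≤ holeCenter i := by
      have h2 := holeCenter_sub i j
      rw [hj, Nat.cast_zero, sub_zero] at h2
      have : 0 ≤ 4 * holeRadius r * ((i : ℕ) : ℝ) := by positivity
      linarith
    nlinarith
  · have hj' : (j : ℕ) - 1 < r := by have := j.2; omega
    have h2 := holeCenter_sub ⟨(j : ℕ) - 1, hj'⟩ j
    rw [Nat.cast_sub hj, Nat.cast_one, sub_sub_cancel_left] at h2
    refine ⟨.gap ⟨(j : ℕ) - 1, hj'⟩, fun t ht => ⟨norm_holeBdry_lt j t, ?_, ?_⟩, fun z hz => ?_,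
      fun z hz => ?_⟩
    · rw [holeBdry_re]
      have := Real.neg_one_le_cos (2 * Real.pi * t)
      nlinarith
    · rw [holeBdry_re]
      nlinarith
    · simp only [frame, if_pos hz]
    · simp only [frame, if_neg hz.not_gt, Nat.sub_add_cancel hj]

theorem cos_two_pi_mul_sub_one (t : ℝ) :
    Real.cos (2 * Real.pi * (t - 1)) = Real.cos (2 * Real.pi * t) := by
  rw [mul_sub, mul_one, Real.cos_sub_two_pi]

theorem sin_two_pi_mul_sub_one (t : ℝ) :
    Real.sin (2 * Real.pi * (t - 1)) = Real.sin (2 * Real.pi * t) := by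
  rw [mul_sub, mul_one, Real.sin_sub_two_pi]

/-- The circle passes through the gap on its right, the upper half of the cell, the chart on its
left, the lower half of the cell, and the gap again. The transitions are 1, 1, d_j⁻¹ and d_{j+1},
with product k_j; the frame at the starting point conjugates it. -/
theorem IsNormalized.isConj_val_boundaryCircle {h : Hol (HoledSurface g r) G}
    {l : Chart g r → HoledSurface g r → G} (hg : 1 ≤ g)
    (hl : ∀ i, h.IsFrame (region g r (chartSet i)) (l i)) {a : Fin g → G} {k : Fin r → G}
    (hN : IsNormalized l (corner a) (gapVal k)) (j : Fin r) :
    IsConj (k j) (h.val (boundaryCircle g j)) := by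
  have hpi := Real.pi_pos
  have hR := holeRadius_pos r
  have hv : ∀ k : Fin g, (corner a (2 * k + 1))⁻¹ * corner a (2 * k) =
      (corner a (2 * k + 2))⁻¹ * corner a (2 * k + 1) := fun k => by
    rw [corner_start, corner_finish]
  obtain ⟨i, hi, hi1, hi2⟩ := exists_chart_left (g := g) j (corner a) (gapVal k) rfl
  let p := boundaryCircle g j
  have hp : ∀ t : I, p t = pt g r (holeBdry j t) := boundaryCircle_apply j
  have hreg : ∀ (c : Chart g r) (t : I), holeBdry j t ∈ chartSet c → p t ∈ region g r (chartSet c) :=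
    fun c t ht => by rw [hp]; exact ⟨_, ⟨holeBdry_mem_holedDisc j t, ht⟩, rfl⟩
  have htr : ∀ (c c' : Chart g r) (t : I), holeBdry j t ∈ chartSet c → holeBdry j t ∈ chartSet c' →
      l c (p t) * (l c' (p t))⁻¹ = (frame (corner a) (gapVal k) c (holeBdry j t))⁻¹ *
        frame (corner a) (gapVal k) c' (holeBdry j t) := fun c c' t hc hc' => by
    rw [hp]
    exact hN.transition_eq hl hg rfl hv (holeBdry_mem_holedDisc j t) hc hc'
  have cos1 : ∀ t : ℝ, -(1 / 8) ≤ t → t ≤ 1 / 8 → 0 < Real.cos (2 * Real.pi * t) := fun t h0 h1 =>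
    Real.cos_pos_of_mem_Ioo ⟨by nlinarith, by nlinarith⟩
  have cos2 : ∀ t : ℝ, 3 / 8 ≤ t → t ≤ 5 / 8 → Real.cos (2 * Real.pi * t) < 0 := fun t h0 h1 =>
    Real.cos_neg_of_pi_div_two_lt_of_lt (by nlinarith) (by nlinarith)
  have cos3 : ∀ t : ℝ, 7 / 8 ≤ t → t ≤ 1 → 0 < Real.cos (2 * Real.pi * t) := fun t h0 h1 => by
    rw [← cos_two_pi_mul_sub_one]; exact cos1 _ (by linarith) (by linarith)
  have sin1 : ∀ t : ℝ, 1 / 8 ≤ t → t ≤ 3 / 8 → 0 < Real.sin (2 * Real.pi * t) := fun t h0 h1 =>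
    Real.sin_pos_of_pos_of_lt_pi (by nlinarith) (by nlinarith)
  have sin2 : ∀ t : ℝ, 5 / 8 ≤ t → t ≤ 7 / 8 → Real.sin (2 * Real.pi * t) < 0 := fun t h0 h1 => by
    rw [← sin_two_pi_mul_sub_one]
    exact Real.sin_neg_of_neg_of_neg_pi_lt (by nlinarith) (by nlinarith)
  -- Odd eighths of the circle are off both axes, so each lies in both the chart being left and the
  -- chart being entered.
  let t1 : I := ⟨1 / 8, by norm_num, by norm_num⟩
  let t3 : I := ⟨3 / 8, by norm_num, by norm_num⟩
  let t5 : I := ⟨5 / 8, by norm_num, by norm_num⟩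
  let t7 : I := ⟨7 / 8, by norm_num, by norm_num⟩
  have s1 := (hl (.gap j)).val_subpath p (s := 0) (t := t1) t1.2.1 fun u h0 h1 =>
    hreg _ _ (holeBdry_mem_gap (cos1 u (by linarith [u.2.1]) h1))
  have s2 := (hl .cell).val_subpath p (s := t1) (t := t3) (by change (1 / 8 : ℝ) ≤ 3 / 8; norm_num)
    fun u h0 h1 => hreg _ _ (holeBdry_mem_cell (sin1 u h0 h1).ne')
  have s3 := (hl i).val_subpath p (s := t3) (t := t5) (by change (3 / 8 : ℝ) ≤ 5 / 8; norm_num)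
    fun u h0 h1 => hreg _ _ (hi u (cos2 u h0 h1))
  have s4 := (hl .cell).val_subpath p (s := t5) (t := t7) (by change (5 / 8 : ℝ) ≤ 7 / 8; norm_num)
    fun u h0 h1 => hreg _ _ (holeBdry_mem_cell (sin2 u h0 h1).ne)
  have s5 := (hl (.gap j)).val_subpath p (s := t7) (t := 1) t7.2.2 fun u h0 h1 =>
    hreg _ _ (holeBdry_mem_gap (cos3 u h0 u.2.2))
  have im1 : 0 < (holeBdry j t1).im := by
    rw [holeBdry_im]; exact mul_pos hR (sin1 _ le_rfl (by change (1 / 8 : ℝ) ≤ 3 / 8; norm_num))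
  have im3 : 0 < (holeBdry j t3).im := by
    rw [holeBdry_im]; exact mul_pos hR (sin1 _ (by change (1 / 8 : ℝ) ≤ 3 / 8; norm_num) le_rfl)
  have im5 : (holeBdry j t5).im < 0 := by
    rw [holeBdry_im]
    exact mul_neg_of_pos_of_neg hR (sin2 _ le_rfl (by change (5 / 8 : ℝ) ≤ 7 / 8; norm_num))
  have im7 : (holeBdry j t7).im < 0 := by
    rw [holeBdry_im]
    exact mul_neg_of_pos_of_neg hR (sin2 _ (by change (5 / 8 : ℝ) ≤ 7 / 8; norm_num) le_rfl)
  have hc : ∀ t : ℝ, (holeBdry j t).im ≠ 0 → holeBdry j t ∈ chartSet (.cell : Chart g r) :=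
    fun t ht => ⟨norm_holeBdry_lt j t, Or.inl ht⟩
  have e1 := htr (.gap j) .cell t1 (holeBdry_mem_gap (cos1 _ (by change -(1 / 8) ≤ (1 / 8 : ℝ); norm_num)
    le_rfl)) (hc _ im1.ne')
  have e3 := htr .cell i t3 (hc _ im3.ne') (hi _ (cos2 _ le_rfl (by
    change (3 / 8 : ℝ) ≤ 5 / 8; norm_num)))
  have e5 := htr i .cell t5 (hi _ (cos2 _ (by change (3 / 8 : ℝ) ≤ 5 / 8; norm_num) le_rfl))
    (hc _ im5.ne)
  have e7 := htr .cell (.gap j) t7 (hc _ im7.ne) (holeBdry_mem_gap (cos3 _ le_rfl t7.2.2))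
  rw [hi1 _ im3] at e3
  rw [hi2 _ im5] at e5
  simp only [frame, if_pos im1, if_neg im7.not_gt, inv_one, mul_one, one_mul] at e1 e3 e5 e7
  have hval : h.val p = h.val (p.subpath 0 t1) * h.val (p.subpath t1 t3) * h.val (p.subpath t3 t5) *
      h.val (p.subpath t5 t7) * h.val (p.subpath t7 1) := by
    rw [h.val_subpath_mul, h.val_subpath_mul, h.val_subpath_mul, h.val_subpath_mul,
      h.val_subpath_zero_one]
  have h01 : p 0 = p 1 := by rw [p.source, p.target]
  have hk : (gapVal k j)⁻¹ * gapVal k ((j : ℕ) + 1) = k j := by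
    rw [gapVal_succ, inv_mul_cancel_left]
  rw [isConj_iff]
  refine ⟨(l (.gap j) (p 1))⁻¹, ?_⟩
  change _ = h.val p
  rw [hval, s1, s2, s3, s4, s5, h01]
  symm
  calc _ = (l (.gap j) (p 1))⁻¹ * ((l (.gap j) (p t1) * (l .cell (p t1))⁻¹) *
        (l .cell (p t3) * (l i (p t3))⁻¹) * (l i (p t5) * (l .cell (p t5))⁻¹) *
        (l .cell (p t7) * (l (.gap j) (p t7))⁻¹)) * l (.gap j) (p 1) := by group
    _ = _ := by rw [e1, e3, e5, e7, one_mul, one_mul, hk, inv_inv]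

end Boundary

/-! ## Holonomy and morphisms from the fundamental group -/

section Morphisms

open Topology unitInterval

variable {X Y G : Type*} [TopologicalSpace X] [TopologicalSpace Y] [Group G]

/-- The holonomy of the pull-back of a bundle. -/
def Hol.comap (h : Hol Y G) {f : X → Y} (hf : Continuous f) : Hol X G where
  val p := h.val (p.map hf)
  val_trans p q := by rw [Path.map_trans, h.val_trans]
  val_congr hpq := h.val_congr (hpq.map ⟨_, hf⟩)

/-- The morphism from the fundamental group given by the holonomy of loops; the inverse is due to
the order of composition in the fundamental group. -/
def Hol.toHom (h : Hol X G) (x : X) : FundamentalGroup X x →* G where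
  toFun p := Quotient.lift (fun p : Path x x => (h.val p)⁻¹)
    (fun _ _ hpq => congrArg (·⁻¹) (h.val_congr hpq)) p
  map_one' := by
    change (h.val (Path.refl x))⁻¹ = 1
    rw [h.val_refl, inv_one]
  map_mul' p q := by
    induction p using Quotient.ind with | _ p
    induction q using Quotient.ind with | _ q
    change (h.val (q.trans p))⁻¹ = (h.val p)⁻¹ * (h.val q)⁻¹
    rw [h.val_trans, mul_inv_rev]

/-- A path is closed up to a loop at x with chosen connecting paths. The chosen path from x to
itself need not be trivial; conjugation by its value c restores the given morphism on loops. -/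
theorem exists_hol_of_hom [PathConnectedSpace X] {x : X} (ρ : FundamentalGroup X x →* G) :
    ∃ h : Hol X G, h.toHom x = ρ := by
  let φ : Path x x → G := fun p => ρ (FundamentalGroup.fromPath (Path.Homotopic.Quotient.mk p))
  have hφ : ∀ p q : Path x x, φ (p.trans q) = φ q * φ p := fun p q => by
    rw [← map_mul]; rfl
  have hφ' : ∀ {p q : Path x x}, p.Homotopic q → φ p = φ q := fun {p q} hpq => by
    simp only [φ, Path.Homotopic.Quotient.eq.2 hpq]
  let q : ∀ y, Path x y := fun y => PathConnectedSpace.somePath x y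
  let c := φ (q x)
  let h : Hol X G :=
    { val := fun {a b} p => c * (φ (((q a).trans p).trans (q b).symm))⁻¹ * c⁻¹
      val_trans := fun {u v w} p p' => by
        have h1 : (((q u).trans (p.trans p')).trans (q w).symm).Homotopic
            ((((q u).trans p).trans (q v).symm).trans (((q v).trans p').trans (q w).symm)) := by
          rw [← Path.Homotopic.Quotient.eq]
          simp only [Path.Homotopic.Quotient.mk_trans, Path.Homotopic.Quotient.mk_symm,
            Path.Homotopic.Quotient.trans_assoc]
          rw [← Path.Homotopic.Quotient.trans_assoc (Path.Homotopic.Quotient.mk (q v)).symm,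
            Path.Homotopic.Quotient.symm_trans, Path.Homotopic.Quotient.refl_trans]
        rw [hφ' h1, hφ]
        group
      val_congr := fun {u v p p'} hp => by
        have h1 := Path.Homotopic.hcomp (Path.Homotopic.hcomp (Path.Homotopic.refl (q u)) hp)
          (Path.Homotopic.refl (q v).symm)
        rw [hφ' h1] }
  refine ⟨h, MonoidHom.ext fun p => ?_⟩
  induction p using Quotient.ind with | _ p
  have hc : φ (q x).symm = c⁻¹ := by
    have h1 : φ (Path.refl x) = 1 := map_one ρ
    rw [eq_inv_iff_mul_eq_one, ← hφ, ← h1]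
    exact hφ' ⟨(Path.Homotopy.reflTransSymm (q x)).symm⟩
  change (c * (φ (((q x).trans p).trans (q x).symm))⁻¹ * c⁻¹)⁻¹ = φ p
  rw [hφ, hφ, hc, show φ (q x) = c from rfl]
  group

theorem _root_.IsConj.inv {a b : G} (h : IsConj a b) : IsConj a⁻¹ b⁻¹ := by
  obtain ⟨c, hc⟩ := isConj_iff.1 h
  exact isConj_iff.2 ⟨c, by rw [← hc]; group⟩

/-- Two sources of inversion combine: the direction of the loop and the inverse in `Hol.toHom`. If
the loop follows the circle, γ' is γ⁻¹; if it runs backwards, they cancel. The choice does not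
depend on the bundle. -/
theorem exists_conjugacy_condition {x y : X} {ℓ : Path x x} {C : Path y y}
    (hℓ : GoesAround ℓ C) (γ : G) : ∃ γ' : G, (γ' = γ ∨ γ' = γ⁻¹) ∧ ∀ (h : Hol X G) (κ : G),
      IsConj κ (h.val C) → ((h.val ℓ)⁻¹ ∈ conjugatesOf γ ↔ κ ∈ conjugatesOf γ') := by
  obtain ⟨p, hp | hp⟩ := hℓ
  · refine ⟨γ⁻¹, Or.inr rfl, fun h κ hκ => ?_⟩
    rw [h.val_congr hp, h.val_trans, h.val_trans, h.val_symm]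
    have h1 : IsConj κ⁻¹ (h.val p * h.val C * (h.val p)⁻¹)⁻¹ :=
      (hκ.trans (isConj_iff.2 ⟨h.val p, rfl⟩)).inv
    change IsConj γ _ ↔ IsConj γ⁻¹ κ
    exact ⟨fun h2 => by simpa using (h2.trans h1.symm).inv, fun h2 => by
      simpa using h2.inv.trans h1⟩
  · refine ⟨γ, Or.inl rfl, fun h κ hκ => ?_⟩
    rw [h.val_congr hp, h.val_trans, h.val_trans, h.val_symm, h.val_symm]
    have h1 : IsConj κ (h.val p * (h.val C)⁻¹ * (h.val p)⁻¹)⁻¹ :=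
      hκ.trans (isConj_iff.2 ⟨h.val p, by group⟩)
    exact ⟨fun h2 => IsConj.trans h2 h1.symm, fun h2 => IsConj.trans h2 h1⟩

end Morphisms

/-! ### Morphisms correspond to solutions of the equation -/

section Counting

variable {g r : ℕ} {X G : Type*} [TopologicalSpace X] [Group G]

theorem Hol.comap_comap_symm {Y : Type*} [TopologicalSpace Y] (h : Hol X G) (e : Y ≃ₜ X) {x y : X}
    (p : Path x y) : (h.comap e.continuous).val (p.map e.symm.continuous) = h.val p := by
  have h1 : (p.map e.symm.continuous).map e.continuous =
      p.cast (e.apply_symm_apply x) (e.apply_symm_apply y) := by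
    ext t; simp
  change h.val ((p.map e.symm.continuous).map e.continuous) = _
  rw [h1, h.val_cast]

/-- The morphisms with prescribed holonomies correspond to the solutions of an equation in the
group. -/
theorem nonempty_equiv_holonomySet (hg : 1 ≤ g) (e : HoledSurface g r ≃ₜ X) (x : X)
    (ℓ : Fin r → Path x x) (γ γ' : Fin r → G)
    (hcond : ∀ j, ∀ (h : Hol X G) (κ : G),
      IsConj κ (h.val ((boundaryCircle g j).map e.continuous)) →
        ((h.val (ℓ j))⁻¹ ∈ conjugatesOf (γ j) ↔ κ ∈ conjugatesOf (γ' j))) :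
    Nonempty ({p : (Fin g → G) × (Fin r → G) // (∀ j, p.2 j ∈ conjugatesOf (γ' j)) ∧
      (List.ofFn fun i => p.1 i ^ 2).prod = (List.ofFn p.2).prod} ≃ holonomySet ℓ γ) := by
  have := pathConnectedSpace_holedSurface (r := r) hg
  have : PathConnectedSpace X := e.surjective.pathConnectedSpace e.continuous
  let y₀ := e.symm x
  obtain ⟨i₀, hy₀⟩ : ∃ i₀ : Chart g r, y₀ ∈ region g r (chartSet i₀) := by
    obtain ⟨z, hz, hzy⟩ := exists_pt_eq y₀
    obtain ⟨i, hi⟩ := exists_mem_chartSet (g := g) hg hz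
    exact ⟨i, z, ⟨hz, hi⟩, hzy⟩
  choose H L hL hN h1 using fun p : {p : (Fin g → G) × (Fin r → G) //
    (∀ j, p.2 j ∈ conjugatesOf (γ' j)) ∧
      (List.ofFn fun i => p.1 i ^ 2).prod = (List.ofFn p.2).prod} =>
    exists_hol_isNormalized hg p.1.1 p.1.2 p.2.2 y₀ hy₀
  let hX := fun p => (H p).comap e.symm.continuous
  have hXC : ∀ p j, IsConj (p.1.2 j) ((hX p).val ((boundaryCircle g j).map e.continuous)) := by
    intro p j
    have e1 : (hX p).val ((boundaryCircle g j).map e.continuous) = (H p).val (boundaryCircle g j) :=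
      (H p).comap_comap_symm e.symm (boundaryCircle g j)
    rw [e1]
    exact (hN p).isConj_val_boundaryCircle hg (hL p) j
  let Φ : {p : (Fin g → G) × (Fin r → G) // (∀ j, p.2 j ∈ conjugatesOf (γ' j)) ∧
      (List.ofFn fun i => p.1 i ^ 2).prod = (List.ofFn p.2).prod} → holonomySet ℓ γ := fun p =>
    ⟨(hX p).toHom x, fun j => (hcond j (hX p) _ (hXC p j)).2 (p.2.1 j)⟩
  refine ⟨Equiv.ofBijective Φ ⟨fun p q hpq => ?_, fun ρ => ?_⟩⟩
  -- Injectivity: equal morphisms have equal holonomy on loops, and normalized data can be recovered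
  -- from it.
  · have hloop : ∀ c : Path y₀ y₀, (H p).val c = (H q).val c := by
      intro c
      have e0 : e y₀ = x := e.apply_symm_apply x
      have e1 := DFunLike.congr_fun (congrArg Subtype.val hpq) (FundamentalGroup.fromPath
        (Path.Homotopic.Quotient.mk ((c.map e.continuous).cast e0.symm e0.symm)))
      have e2 : ((hX p).val ((c.map e.continuous).cast e0.symm e0.symm))⁻¹ =
        ((hX q).val ((c.map e.continuous).cast e0.symm e0.symm))⁻¹ := e1
      rw [inv_inj, Hol.val_cast, Hol.val_cast] at e2
      have e3 := (H p).comap_comap_symm e.symm c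
      have e4 := (H q).comap_comap_symm e.symm c
      exact e3.symm.trans (e2.trans e4)
    obtain ⟨ha, hk⟩ := eq_of_val_eq hg hy₀ hloop (hL p) (hL q) (hN p) (hN q) (h1 p) (h1 q)
    exact Subtype.ext (Prod.ext ha hk)
  -- Surjectivity: the data read off from normalized frames solve the equation, and the bundle built
  -- from them has the same loop holonomy as the given one.
  · obtain ⟨h, hh⟩ := exists_hol_of_hom ρ.1
    obtain ⟨l, a, k, hl, hNl, hl1⟩ := exists_isNormalized hg (h.comap e.continuous) y₀ i₀
    have hk : ∀ j, k j ∈ conjugatesOf (γ' j) := by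
      intro j
      refine (hcond j h (k j) (hNl.isConj_val_boundaryCircle hg hl j)).1 ?_
      have := ρ.2 j
      rwa [← hh] at this
    have hrel : (List.ofFn fun i => a i ^ 2).prod = (List.ofFn k).prod := by
      rw [← corner_two_mul, ← gapVal_self]
      exact hNl.relation hl hg rfl rfl fun k => by rw [corner_start, corner_finish]
    refine ⟨⟨(a, k), hk, hrel⟩, Subtype.ext ?_⟩
    rw [← hh]
    refine MonoidHom.ext fun c => ?_
    induction c using Quotient.ind with | _ c
    change ((H _).val (c.map e.symm.continuous))⁻¹ = (h.val c)⁻¹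
    rw [← h.comap_comap_symm e c]
    congr 1
    exact (hN ⟨(a, k), hk, hrel⟩).val_eq hg hy₀ (hL _) hl hNl (h1 _) hl1 (c.map e.symm.continuous)

end Counting
end SurfaceCount

theorem mainTheorem3 {G : Type*} [Group G] [Fintype G] (g r : ℕ) (hg : 1 ≤ g)
    {X : Type*} [TopologicalSpace X] (e : SurfaceCount.HoledSurface g r ≃ₜ X)
    (x : X) (ℓ : Fin r → Path x x)
    (hℓ : ∀ j, SurfaceCount.GoesAround (ℓ j)
      ((SurfaceCount.boundaryCircle g j).map e.continuous))
    (γ : Fin r → G) :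
    (SurfaceCount.holonomySet ℓ γ).Finite ∧
      (Nat.card (SurfaceCount.holonomySet ℓ γ) : ℂ) / (Nat.card G : ℂ) =
        (Nat.card G : ℂ) ^ (-(2 - (g : ℤ))) * (∏ j, (Nat.card (conjugatesOf (γ j)) : ℂ)) *
          ∑ π : {π : SurfaceCount.Irr G // π.frobeniusSchur ≠ 0},
            (π.1.frobeniusSchur * (π.1.dim : ℂ)) ^ (2 - (g : ℤ)) *
              ((∏ j, π.1.character (γ j)) / (π.1.dim : ℂ) ^ r) := by
  choose γ' hγ' hcond using fun j => SurfaceCount.exists_conjugacy_condition (hℓ j) (γ j)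
  obtain ⟨f⟩ := SurfaceCount.nonempty_equiv_holonomySet hg e x ℓ γ γ' hcond
  rw [← SurfaceCount.card_solutions g r hg γ γ' hγ', Nat.card_congr f]
  exact ⟨Set.finite_coe_iff.1 (Finite.of_equiv _ f), rfl⟩
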